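/- Let $\mathcal C$ be a small category with a Grothendieck topology. A simplicial presheaf is a functor $\mathcal C^{op}\to s\mathbf{Set}$; for a simplicial set $K$ and a simplicial presheaf $F$, let $K\otimes F$ be the simplicial presheaf $(K\otimes F)(Y)=K\times F(Y)$. An object $X$ of $\mathcal C$ is regarded as the discrete simplicial presheaf $Y\mapsto \mathrm{Hom}(Y,X)$. A map $F\to G$ of simplicial presheaves is a local fibration if for all $n\ge 1$, $0\le k\le n$, every object $X$ and every commutative square from $\Lambda^{n,k}\otimes X\to\Delta^n\otimes X$ to $F\to G$, there is a covering sieve of $X$ such that for every $U\to X$ in it the square restricted to $U$ has a lifting $\Delta^n\otimes U\to F$. It is a local weak equivalence if it induces isomorphisms on all sheaves of homotopy groups: on the sheaf associated with $\pi_0$ and, for all $n\geq 1$, all $X$ and all vertices $x\in F(X)_0$, on the sheaf on $\mathcal C/X$ associated with $(U\to X)\mapsto\pi_n(F(U),x|_U)$. (Homotopy groups of an arbitrary simplicial set are those of its fibrant replacement $\mathrm{Ex}^\infty$.) It is a local acyclic fibration if it is both. A hypercover of $X$ is a map $U\to X$ of simplicial presheaves which is a local acyclic fibration and such that each presheaf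 $U_n$ is a coproduct of representables. Proposition. Let $p\colon F\to G$ be a local acyclic fibration of simplicial presheaves on $\mathcal C$, and let $i\colon K\to L$ be a cofibration (that is, a monomorphism) of finite simplicial sets. Let $X$ be an object of $\mathcal C$, let $U\to X$ be a hypercover, and let $a\colon K\otimes U\to F$ and $b\colon L\otimes U\to G$ be maps with $p\circ a=b\circ(i\otimes U)$. Then there exist a map of simplicial presheaves $v\colon V\to U$ such that the composite $V\to U\to X$ is a hypercover, and a map $\ell\colon L\otimes V\to F$ such that $\ell\circ(i\otimes V)=a\circ(K\otimes v)$ and $p\circ\ell=b\circ(L\otimes v)$. -/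

import Mathlib

open CategoryTheory Opposite Simplicial MonoidalCategory

universe u

namespace LocalLift

noncomputable section

/-! ### The functor `Ex^∞` and homotopy groups of simplicial sets -/

/-- The largest element of a nonempty chain of `{0, ..., n}`. -/
def chainMax {n : SimplexCategory}
    (A : PartialOrder.NonemptyFiniteChains (ULift.{u} (Fin (n.len + 1)))) : Fin (n.len + 1) :=
  (A.finset.image ULift.down).max' (A.nonempty.image _)

theorem chainMax_mono {n : SimplexCategory}
    {A B : PartialOrder.NonemptyFiniteChains (ULift.{u} (Fin (n.len + 1)))} (h : A ≤ B) :
    chainMax A ≤ chainMax B :=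
  Finset.max'_subset _ (Finset.image_subset_image h)

theorem chainMax_map {n m : SimplexCategory} (f : n ⟶ m)
    (A : PartialOrder.NonemptyFiniteChains (ULift.{u} (Fin (n.len + 1))))
    (B : PartialOrder.NonemptyFiniteChains (ULift.{u} (Fin (m.len + 1))))
    (h : ∀ y, y ∈ B.finset ↔ ∃ x ∈ A.finset, ULift.up (f.toOrderHom x.down) = y) :
    chainMax B = f.toOrderHom (chainMax A) := by
  apply le_antisymm
  · refine Finset.max'_le _ _ _ fun y hy ↦ ?_
    obtain ⟨z, hz, rfl⟩ := Finset.mem_image.1 hy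
    obtain ⟨x, hx, rfl⟩ := (h _).1 hz
    exact f.toOrderHom.monotone (Finset.le_max' _ _ (Finset.mem_image_of_mem _ hx))
  · obtain ⟨x, hx, hxA⟩ := Finset.mem_image.1
      (Finset.max'_mem (A.finset.image ULift.down) (A.nonempty.image _))
    refine Finset.le_max' _ _ (Finset.mem_image.2 ⟨_, (h _).2 ⟨x, hx, rfl⟩, ?_⟩)
    change f.toOrderHom x.down = f.toOrderHom (chainMax A)
    rw [hxA]; rfl

/-- The last vertex map `sd Δ[n] ⟶ Δ[n]`, sending a vertex of `sd Δ[n]`, that is, a nonempty subset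
of `{0, ..., n}`, to its largest element. -/
def lastVertex (n : SimplexCategory) :
    SimplexCategory.sd.{u}.obj n ⟶ SSet.stdSimplex.{u}.obj n where
  app d := ↾fun s ↦ SSet.stdSimplex.objEquiv.symm (SimplexCategory.Hom.mk
    { toFun := fun i ↦ chainMax.{u}
        ((s : ComposableArrows (PartialOrder.NonemptyFiniteChains
          (ULift.{u} (Fin (n.len + 1)))) d.unop.len).obj i)
      monotone' := fun _ _ h ↦ chainMax_mono (leOfHom
        ((s : ComposableArrows (PartialOrder.NonemptyFiniteChains
          (ULift.{u} (Fin (n.len + 1)))) d.unop.len).map (homOfLE h))) })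
  naturality _ _ _ := rfl

theorem lastVertex_naturality {n m : SimplexCategory} (f : n ⟶ m) :
    SimplexCategory.sd.{u}.map f ≫ lastVertex m = lastVertex n ≫ SSet.stdSimplex.map f := by
  ext d s
  refine SSet.stdSimplex.objEquiv.injective (SimplexCategory.Hom.ext _ _ (OrderHom.ext _ _ ?_))
  funext i
  refine chainMax_map f _ _ fun y ↦ ?_
  exact PartialOrder.NonemptyFiniteChains.mem_map_iff _ _ y

/-- The natural map `K ⟶ Ex K`, given on simplices by composing `Δ[n] ⟶ K` with the last vertex
map `sd Δ[n] ⟶ Δ[n]`. -/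
def toEx : 𝟭 SSet.{u} ⟶ SSet.ex.{u} where
  app K :=
    { app := fun n ↦ ↾fun s ↦ ULift.up (lastVertex n.unop ≫ SSet.yonedaEquiv.symm s)
      naturality := fun n m f ↦ by
        ext s
        refine ULift.down_injective ?_
        change lastVertex m.unop ≫ SSet.yonedaEquiv.symm (K.map f s) =
          SimplexCategory.sd.map f.unop ≫ lastVertex n.unop ≫ SSet.yonedaEquiv.symm s
        rw [← Category.assoc, lastVertex_naturality, Category.assoc]
        congr 1
        exact SSet.yonedaEquiv.injective (by
          rw [Equiv.apply_symm_apply, SSet.yonedaEquiv_comp, SSet.yonedaEquiv_map]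
          rfl) }
  naturality K L f := by
    ext n s
    refine ULift.down_injective ?_
    change lastVertex n.unop ≫ SSet.yonedaEquiv.symm (f.app n s) =
      (lastVertex n.unop ≫ SSet.yonedaEquiv.symm s) ≫ f
    rw [Category.assoc]
    congr 1
    exact (SSet.yonedaEquiv_symm_comp s f).symm

/-- The iterates `Ex^k`. -/
def exIter (k : ℕ) : SSet.{u} ⥤ SSet.{u} :=
  Nat.rec (𝟭 _) (fun _ G ↦ G ⋙ SSet.ex) k

/-- The sequence `id ⟶ Ex ⟶ Ex² ⟶ ⋯`. -/
def exSequence : ℕ ⥤ (SSet.{u} ⥤ SSet.{u}) :=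
  Functor.ofSequence (X := exIter.{u}) fun k ↦ Functor.whiskerLeft (exIter k) toEx

/-- Kan's fibrant replacement functor `Ex^∞ = colim (id ⟶ Ex ⟶ Ex² ⟶ ⋯)`. -/
def exInfty : SSet.{u} ⥤ SSet.{u} := Limits.colimit exSequence

/-- The natural map `K ⟶ Ex^∞ K`. -/
def toExInfty : 𝟭 SSet.{u} ⟶ exInfty.{u} := Limits.colimit.ι exSequence.{u} 0

/-- The vertex of `Ex^∞ K` given by a vertex of `K`. -/
abbrev exVertex {K : SSet.{u}} (x : K _⦋0⦌) : (exInfty.obj K) _⦋0⦌ := (toExInfty.app K).app _ x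

/-- The homotopy group (a set, as the group law plays no role here) `π_n(K, x)` of a simplicial set
`K` that is not necessarily a Kan complex: homotopy classes rel boundary of maps
`(Δ[n], ∂Δ[n]) ⟶ (Ex^∞ K, x)`. -/
def HomotopyPi (n : ℕ) (K : SSet.{u}) (x : K _⦋0⦌) : Type u :=
  SSet.RelativeMorphism.HomotopyClass (SSet.boundary n) (SSet.Subcomplex.ofSimplex (exVertex x))
    (SSet.const ⟨exVertex x, SSet.Subcomplex.mem_ofSimplex_obj _⟩)

/-- The map `π_n(K, x) → π_n(L, y)` induced by a map `f : K ⟶ L` with `f x = y`. -/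
def mapHomotopyPi (n : ℕ) {K L : SSet.{u}} (f : K ⟶ L) (x : K _⦋0⦌) (y : L _⦋0⦌)
    (h : f.app _ x = y) : HomotopyPi n K x → HomotopyPi n L y := fun c ↦
  SSet.RelativeMorphism.HomotopyClass.postcomp c
    (SSet.RelativeMorphism.ofSimplex₀ (exInfty.map f) (exVertex x) (exVertex y) (by
      subst h
      exact (congr_fun (congr_arg (fun g ↦ (g.app (op ⦋0⦌)).hom)
        (toExInfty.naturality f)) x).symm)) (SSet.comp_const _ _)

theorem mapHomotopyPi_id (n : ℕ) {K : SSet.{u}} {f : K ⟶ K} (hf : f = 𝟙 K) (x : K _⦋0⦌)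
    (h : f.app _ x = x) (c : HomotopyPi n K x) : mapHomotopyPi n f x x h c = c := by
  subst hf
  obtain ⟨s, rfl⟩ := c.eq_homotopyClass
  refine congr_arg SSet.RelativeMorphism.homotopyClass (SSet.RelativeMorphism.ext ?_)
  change s.map ≫ exInfty.map (𝟙 K) = s.map
  rw [exInfty.map_id, Category.comp_id]

theorem mapHomotopyPi_comp (n : ℕ) {K L M : SSet.{u}} {f : K ⟶ L} {g : L ⟶ M} {k : K ⟶ M}
    (e : k = f ≫ g) {x : K _⦋0⦌} {y : L _⦋0⦌} {z : M _⦋0⦌} (hf : f.app _ x = y)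
    (hg : g.app _ y = z) (hk : k.app _ x = z) (c : HomotopyPi n K x) :
    mapHomotopyPi n k x z hk c = mapHomotopyPi n g y z hg (mapHomotopyPi n f x y hf c) := by
  subst e
  obtain ⟨s, rfl⟩ := c.eq_homotopyClass
  refine congr_arg SSet.RelativeMorphism.homotopyClass (SSet.RelativeMorphism.ext ?_)
  change s.map ≫ exInfty.map (f ≫ g) = (s.map ≫ exInfty.map f) ≫ exInfty.map g
  rw [exInfty.map_comp, Category.assoc]

/-! ### Simplicial presheaves -/

variable {C : Type u} [SmallCategory C]

/-- The representable (discrete) simplicial presheaf `rX`, with `rX(Y) = Hom(Y, X)`. -/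
abbrev rObj (X : C) : Cᵒᵖ ⥤ SSet.{u} := yoneda.obj X ⋙ SimplicialObject.const (Type u)

/-- The presheaf of sets `F_n` of `n`-simplices of a simplicial presheaf `F`. -/
abbrev level (F : Cᵒᵖ ⥤ SSet.{u}) (n : ℕ) : Cᵒᵖ ⥤ Type u :=
  F ⋙ SSet.evaluation.obj (op ⦋n⦌)

/-- The tensor `K ⊗ F` of a simplicial set and a simplicial presheaf: `(K ⊗ F)(X) = K × F(X)`. -/
abbrev tensor (K : SSet.{u}) (F : Cᵒᵖ ⥤ SSet.{u}) : Cᵒᵖ ⥤ SSet.{u} := F ⋙ tensorLeft K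

/-- The map `K ⊗ F ⟶ L ⊗ F` induced by a map `K ⟶ L` of simplicial sets. -/
abbrev tensorMapLeft {K L : SSet.{u}} (i : K ⟶ L) (F : Cᵒᵖ ⥤ SSet.{u}) : tensor K F ⟶ tensor L F :=
  Functor.whiskerLeft F ((curriedTensor SSet.{u}).map i)

/-- The map `K ⊗ F ⟶ K ⊗ G` induced by a map `F ⟶ G` of simplicial presheaves. -/
abbrev tensorMapRight (K : SSet.{u}) {F G : Cᵒᵖ ⥤ SSet.{u}} (p : F ⟶ G) : tensor K F ⟶ tensor K G :=
  Functor.whiskerRight p (tensorLeft K)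

/-- The map `rU ⟶ rX` induced by a map `U ⟶ X`. -/
abbrev rMap {U X : C} (f : U ⟶ X) : rObj U ⟶ rObj X :=
  Functor.whiskerRight (yoneda.map f) _

/-- `p : F ⟶ G` has local liftings with respect to `A ⊗ X ⟶ B ⊗ X` for all objects `X`: for every
commutative square from `A ⊗ X ⟶ B ⊗ X` to `F ⟶ G` there is a covering sieve of `X` such that for
every map `U ⟶ X` in it, the square obtained by restricting from `X` to `U` has a lifting. -/
def HasLocalLiftings (J : GrothendieckTopology C) {A B : SSet.{u}} (i : A ⟶ B)
    {F G : Cᵒᵖ ⥤ SSet.{u}} (p : F ⟶ G) : Prop :=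
  ∀ (X : C) (a : tensor A (rObj X) ⟶ F) (b : tensor B (rObj X) ⟶ G),
    a ≫ p = tensorMapLeft i (rObj X) ≫ b →
    ∃ R ∈ J X, ∀ ⦃U : C⦄ (f : U ⟶ X), R f →
      ∃ l : tensor B (rObj U) ⟶ F,
        tensorMapLeft i (rObj U) ≫ l = tensorMapRight A (rMap f) ≫ a ∧
        l ≫ p = tensorMapRight B (rMap f) ≫ b

/-- Local fibrations: local liftings with respect to all horn inclusions `Λ[n, k] ⟶ Δ[n]`, `1 ≤ n`,
`0 ≤ k ≤ n`. -/
def IsLocalFibration (J : GrothendieckTopology C) {F G : Cᵒᵖ ⥤ SSet.{u}} (p : F ⟶ G) : Prop :=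
  ∀ (n : ℕ) (k : Fin (n + 2)), HasLocalLiftings J (SSet.horn.{u} (n + 1) k).ι p

/-- The restriction `x|_U` of a vertex `x` of `F(X)` along `U ⟶ X`. -/
abbrev vertexRes (F : Cᵒᵖ ⥤ SSet.{u}) {X : C} (x : (F.obj (op X)) _⦋0⦌) (U : Over X) :
    (F.obj (op U.left)) _⦋0⦌ :=
  (F.map U.hom.op).app _ x

theorem vertexRes_map (F : Cᵒᵖ ⥤ SSet.{u}) {X : C} (x : (F.obj (op X)) _⦋0⦌) {U V : Over X}
    (g : V ⟶ U) : (F.map g.left.op).app _ (vertexRes F x U) = vertexRes F x V := by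
  change ((F.map U.hom.op) ≫ (F.map g.left.op)).app _ x = _
  rw [← F.map_comp, ← op_comp, Over.w]

theorem app_vertexRes {F G : Cᵒᵖ ⥤ SSet.{u}} (p : F ⟶ G) {X : C} (x : (F.obj (op X)) _⦋0⦌)
    (U : Over X) :
    (p.app (op U.left)).app _ (vertexRes F x U) = vertexRes G ((p.app (op X)).app _ x) U := by
  change ((F.map U.hom.op) ≫ p.app _).app _ x = _
  rw [p.naturality]
  rfl

/-- For a vertex `x` of `F(X)`, the presheaf on the slice category `C/X` sending `U ⟶ X` to
`π_n(F(U), x|_U)`. -/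
def piPresheaf (n : ℕ) (F : Cᵒᵖ ⥤ SSet.{u}) {X : C} (x : (F.obj (op X)) _⦋0⦌) :
    (Over X)ᵒᵖ ⥤ Type u where
  obj U := HomotopyPi n (F.obj (op U.unop.left)) (vertexRes F x U.unop)
  map g := ↾mapHomotopyPi n (F.map g.unop.left.op) _ _ (vertexRes_map F x g.unop)
  map_id U := by
    ext c
    exact mapHomotopyPi_id n (F.map_id _) _ (vertexRes_map F x (𝟙 U.unop)) c
  map_comp g h := by
    ext c
    exact mapHomotopyPi_comp n (F.map_comp g.unop.left.op h.unop.left.op)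
      (vertexRes_map F x g.unop) (vertexRes_map F x h.unop) (vertexRes_map F x (g ≫ h).unop) c

/-- The map of presheaves `π_n(F, x) ⟶ π_n(G, p x)` on `C/X` induced by `p : F ⟶ G`. -/
def piPresheafMap (n : ℕ) {F G : Cᵒᵖ ⥤ SSet.{u}} (p : F ⟶ G) {X : C} (x : (F.obj (op X)) _⦋0⦌) :
    piPresheaf n F x ⟶ piPresheaf n G ((p.app (op X)).app _ x) where
  app U := ↾mapHomotopyPi n (p.app (op U.unop.left)) _ _ (app_vertexRes p x U.unop)
  naturality U V g := by
    ext c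
    have h : (F.map g.unop.left.op ≫ p.app (op V.unop.left)).app _ (vertexRes F x U.unop) =
        vertexRes G ((p.app (op X)).app _ x) V.unop :=
      (congr_arg ((p.app (op V.unop.left)).app _) (vertexRes_map F x g.unop)).trans
        (app_vertexRes p x V.unop)
    exact (mapHomotopyPi_comp n rfl (vertexRes_map F x g.unop) (app_vertexRes p x V.unop)
      h c).symm.trans (mapHomotopyPi_comp n (p.naturality g.unop.left.op)
        (app_vertexRes p x U.unop) (vertexRes_map G _ g.unop) h c)

/-- Local weak equivalences: maps inducing isomorphisms on all sheaves of homotopy groups, that is,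
on the sheaf associated with `π₀` and, for all `n ≥ 1`, all objects `X` and all vertices `x` of
`F(X)`, on the sheaf on `C/X` associated with `π_n(F, x)`. -/
def IsLocalWeakEquivalence (J : GrothendieckTopology C) {F G : Cᵒᵖ ⥤ SSet.{u}} (p : F ⟶ G) : Prop :=
  IsIso ((presheafToSheaf J (Type u)).map (Functor.whiskerRight p SSet.π₀Functor.{u})) ∧
  ∀ (n : ℕ), 1 ≤ n → ∀ (X : C) (x : (F.obj (op X)) _⦋0⦌),
    IsIso ((presheafToSheaf (J.over X) (Type u)).map (piPresheafMap n p x))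

/-- Local acyclic fibrations. -/
def IsLocalAcyclicFibration (J : GrothendieckTopology C) {F G : Cᵒᵖ ⥤ SSet.{u}} (p : F ⟶ G) :
    Prop :=
  IsLocalFibration J p ∧ IsLocalWeakEquivalence J p

/-- A presheaf of sets is a coproduct of (a possibly empty family of) representables. -/
def IsCoproductOfRepresentables (P : Cᵒᵖ ⥤ Type u) : Prop :=
  ∃ (ι : Type u) (Y : ι → C), Nonempty (P ≅ ∐ fun i ↦ yoneda.obj (Y i))

/-- An augmented simplicial presheaf `U ⟶ X` is a hypercover of `X` if each `U_n` is a coproduct of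
representables and `U ⟶ X` is a local acyclic fibration. -/
structure IsHypercover (J : GrothendieckTopology C) {X : C} {U : Cᵒᵖ ⥤ SSet.{u}}
    (q : U ⟶ rObj X) : Prop where
  isCoproductOfRepresentables (n : ℕ) : IsCoproductOfRepresentables (level U n)
  isLocalAcyclicFibration : IsLocalAcyclicFibration J q

end

end LocalLift

/-! The solutions of the lifting problem form a simplicial presheaf `P` over `U` (`liftPresheaf`): a
simplex of `P(Y)` is a simplex `Δ[n] ⟶ U(Y)` together with a lifting `L × Δ[n] ⟶ F(Y)` of the
problem it defines. In other words, `P` is the pullback to `U` of `F^L ⟶ F^K ×_{G^K} G^L`, and it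
carries a tautological lifting. Lifting `∂Δ[n] ⟶ Δ[n]` against `P ⟶ U` amounts to lifting the
pushout product `K × Δ[n] ∪ L × ∂Δ[n] ⟶ L × Δ[n]` against `p`. This is a monomorphism of finite
simplicial sets, so `P ⟶ U` has local liftings against boundary inclusions whenever `p` has them
(`LocalRLP.liftPresheafπ`).

The levels of `P` need not be coproducts of representables. The small object argument, started at
the empty presheaf and attaching cells `∂Δ[n] ⊗ Y ⟶ Δ[n] ⊗ Y`, gives `V ⟶ P` with liftings in every
section. Each `V_k` is a disjoint union of representables, one for every cell and every `k`-simplex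
of `Δ[n]` outside `∂Δ[n]`. The composite `V ⟶ P ⟶ U ⟶ X` is then the required hypercover.

All this uses that local acyclic fibrations are exactly the maps with local liftings against all
`∂Δ[n] ⟶ Δ[n]` (`isLocalAcyclicFibration_iff`), which takes most of the work, since weak
equivalences are defined by sheaves of homotopy groups of `Ex^∞`. Given a local acyclic fibration
`p`, the map `Ex^∞ p` is again a local fibration, because subdivided horn inclusions are built from
horns; it is a map between presheaves of Kan complexes, by Kan's lemma; the classical argument with
homotopy groups, carried out over coverings, shows that `Ex^∞ p` lifts locally against boundaries
(`LocalRLP.boundary_of_pi`); and these liftings descend to `p` through the mapping cylinder of the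
last vertex map `sd Δ[n] ⟶ Δ[n]` (`LocalRLP.boundary_of_exInfty`). Conversely, liftings against
boundaries pass to `Ex^∞` and give local bijectivity on homotopy sets directly.

The combinatorial input is that two inclusions of nerves of finite posets are finite composites of
pushouts of horn inclusions. Both follow from acyclic matchings of chains
(`LocalRLP.of_toggleMatching`). Finiteness matters throughout: only finite intersections of covering
sieves need be covering. -/

namespace LocalLift

/-! ### The local right lifting property and its closure properties. -/

section

variable {C : Type u} [SmallCategory C]

/-- The sieve of all maps `U ⟶ X` over which a square from `A ⟶ B` to `F(X) ⟶ G(X)` has a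
lifting. -/
def liftSieve {A B : SSet.{u}} (i : A ⟶ B) {F G : Cᵒᵖ ⥤ SSet.{u}} (p : F ⟶ G) {X : C}
    (a : A ⟶ F.obj (op X)) (b : B ⟶ G.obj (op X)) : Sieve X where
  arrows U f := ∃ l : B ⟶ F.obj (op U), i ≫ l = a ≫ F.map f.op ∧
    l ≫ p.app (op U) = b ≫ G.map f.op
  downward_closed := by
    rintro U V f ⟨l, h₁, h₂⟩ g
    refine ⟨l ≫ F.map g.op, ?_, ?_⟩
    · rw [reassoc_of% h₁, op_comp, F.map_comp]
    · rw [Category.assoc, p.naturality, reassoc_of% h₂, op_comp, G.map_comp]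

theorem liftSieve_apply {A B : SSet.{u}} (i : A ⟶ B) {F G : Cᵒᵖ ⥤ SSet.{u}} (p : F ⟶ G) {X : C}
    (a : A ⟶ F.obj (op X)) (b : B ⟶ G.obj (op X)) {U : C} (f : U ⟶ X) :
    liftSieve i p a b f ↔ ∃ l : B ⟶ F.obj (op U), i ≫ l = a ≫ F.map f.op ∧
      l ≫ p.app (op U) = b ≫ G.map f.op := Iff.rfl

theorem liftSieve_pullback {A B : SSet.{u}} (i : A ⟶ B) {F G : Cᵒᵖ ⥤ SSet.{u}} (p : F ⟶ G) {X : C}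
    (a : A ⟶ F.obj (op X)) (b : B ⟶ G.obj (op X)) {U : C} (f : U ⟶ X) :
    (liftSieve i p a b).pullback f = liftSieve i p (a ≫ F.map f.op) (b ≫ G.map f.op) := by
  ext V g
  simp only [Sieve.pullback_apply, liftSieve_apply, op_comp, Functor.map_comp, Category.assoc]

/-- `p : F ⟶ G` has the local right lifting property with respect to `i : A ⟶ B`. -/
def LocalRLP (J : GrothendieckTopology C) {A B : SSet.{u}} (i : A ⟶ B)
    {F G : Cᵒᵖ ⥤ SSet.{u}} (p : F ⟶ G) : Prop :=
  ∀ (X : C) (a : A ⟶ F.obj (op X)) (b : B ⟶ G.obj (op X)),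
    a ≫ p.app (op X) = i ≫ b → liftSieve i p a b ∈ J X

variable {J : GrothendieckTopology C} {F G H : Cᵒᵖ ⥤ SSet.{u}} {p : F ⟶ G} {q : G ⟶ H}

theorem restrict_square {A B : SSet.{u}} {i : A ⟶ B} {X U : C} (f : U ⟶ X)
    {a : A ⟶ F.obj (op X)} {b : B ⟶ G.obj (op X)} (h : a ≫ p.app (op X) = i ≫ b) :
    (a ≫ F.map f.op) ≫ p.app (op U) = i ≫ b ≫ G.map f.op := by
  rw [Category.assoc, p.naturality, reassoc_of% h]

/-- To show that a square has local liftings, one may restrict to a covering sieve. -/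
theorem liftSieve_mem_of_cover {A B : SSet.{u}} {i : A ⟶ B} {X : C} {a : A ⟶ F.obj (op X)}
    {b : B ⟶ G.obj (op X)} {R : Sieve X} (hR : R ∈ J X)
    (h : ∀ ⦃U : C⦄ (f : U ⟶ X), R f →
      liftSieve i p (a ≫ F.map f.op) (b ≫ G.map f.op) ∈ J U) : liftSieve i p a b ∈ J X :=
  J.transitive hR _ fun U f hf ↦ by rw [liftSieve_pullback]; exact h f hf

theorem liftSieve_mem_of_lift {A B : SSet.{u}} {i : A ⟶ B} {X : C} {a : A ⟶ F.obj (op X)}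
    {b : B ⟶ G.obj (op X)} (l : B ⟶ F.obj (op X)) (h₁ : i ≫ l = a)
    (h₂ : l ≫ p.app (op X) = b) : liftSieve i p a b ∈ J X := by
  refine J.superset_covering ?_ (J.top_mem X)
  rintro U f -
  refine ⟨l ≫ F.map f.op, ?_, ?_⟩
  · rw [reassoc_of% h₁]
  · rw [Category.assoc, p.naturality, reassoc_of% h₂]

theorem LocalRLP.of_isIso {A B : SSet.{u}} (i : A ⟶ B) [IsIso i] : LocalRLP J i p :=
  fun X a b h ↦ liftSieve_mem_of_lift (inv i ≫ a) (by simp) (by simp [h])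

/-- A local lifting along `i` is extended along `j` on a covering of each member of the first
covering; transitivity of the topology combines the two. -/
theorem LocalRLP.comp {A B D : SSet.{u}} {i : A ⟶ B} {j : B ⟶ D} (hi : LocalRLP J i p)
    (hj : LocalRLP J j p) : LocalRLP J (i ≫ j) p := by
  intro X a b h
  refine liftSieve_mem_of_cover (hi X a (j ≫ b) (by simpa using h)) fun U f ⟨l, h₁, h₂⟩ ↦ ?_
  refine J.superset_covering ?_ (hj U l (b ≫ G.map f.op) (by simpa using h₂))
  rintro V g ⟨m, h₃, h₄⟩
  exact ⟨m, by rw [Category.assoc, h₃, reassoc_of% h₁, Category.assoc], h₄⟩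

theorem LocalRLP.comp_map {A B : SSet.{u}} {i : A ⟶ B} (hp : LocalRLP J i p)
    (hq : LocalRLP J i q) : LocalRLP J i (p ≫ q) := by
  intro X a b h
  refine liftSieve_mem_of_cover (hq X (a ≫ p.app _) b (by simpa using h)) fun U f ⟨l, h₁, h₂⟩ ↦ ?_
  refine J.superset_covering ?_ (hp U (a ≫ F.map f.op) l
    (by rw [h₁, Category.assoc, Category.assoc, p.naturality]))
  rintro V g ⟨m, h₃, h₄⟩
  refine ⟨m, h₃, ?_⟩
  rw [NatTrans.comp_app, reassoc_of% h₄, q.naturality, reassoc_of% h₂, Category.assoc]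

theorem LocalRLP.of_isPushout {A B A' B' : SSet.{u}} {t : A ⟶ A'} {i : A ⟶ B} {i' : A' ⟶ B'}
    {b' : B ⟶ B'} (sq : IsPushout t i i' b') (hi : LocalRLP J i p) : LocalRLP J i' p := by
  intro X a b h
  refine J.superset_covering ?_ (hi X (t ≫ a) (b' ≫ b)
    (by rw [Category.assoc, h, sq.w_assoc]))
  rintro U f ⟨l, h₁, h₂⟩
  refine ⟨sq.desc (a ≫ F.map f.op) l (by rw [h₁, Category.assoc]), by simp, ?_⟩
  apply sq.hom_ext
  · rw [sq.inl_desc_assoc, Category.assoc, p.naturality, reassoc_of% h]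
  · rw [sq.inr_desc_assoc, h₂, Category.assoc]

theorem LocalRLP.of_arrow_iso {A B A' B' : SSet.{u}} {i : A ⟶ B} {i' : A' ⟶ B'}
    (e₁ : A ≅ A') (e₂ : B ≅ B') (w : i ≫ e₂.hom = e₁.hom ≫ i') (hi : LocalRLP J i p) :
    LocalRLP J i' p :=
  hi.of_isPushout (IsPushout.of_horiz_isIso ⟨w.symm⟩)

/-- The summands are lifted on different coverings, which have to be intersected; this is why the
index type is finite. -/
theorem LocalRLP.of_isColimit_cofan {ι : Type*} [Finite ι] {A B : ι → SSet.{u}}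
    {g : ∀ k, A k ⟶ B k} (hg : ∀ k, LocalRLP J (g k) p) {c₁ : Limits.Cofan A} {c₂ : Limits.Cofan B}
    (h₁ : Limits.IsColimit c₁) (h₂ : Limits.IsColimit c₂) (m : c₁.pt ⟶ c₂.pt)
    (hm : ∀ k, c₁.inj k ≫ m = g k ≫ c₂.inj k) : LocalRLP J m p := by
  intro X a b h
  have key : ∀ s : Set ι, s.Finite →
      ∃ R ∈ J X, ∀ ⦃U⦄ (f : U ⟶ X), R f → ∀ k ∈ s,
        liftSieve (g k) p (c₁.inj k ≫ a) (c₂.inj k ≫ b) f := by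
    intro s hs
    induction s, hs using Set.Finite.induction_on with
    | empty => exact ⟨⊤, J.top_mem X, by simp⟩
    | @insert k s _ _ ih =>
      obtain ⟨R, hR, hR'⟩ := ih
      refine ⟨R ⊓ liftSieve (g k) p (c₁.inj k ≫ a) (c₂.inj k ≫ b), J.intersection_covering hR
        (hg k X _ _ (by rw [Category.assoc, h, reassoc_of% hm k])), ?_⟩
      rintro U f ⟨hf₁, hf₂⟩ k' (rfl | hk')
      · exact hf₂
      · exact hR' f hf₁ k' hk'
  obtain ⟨R, hR, hR'⟩ := key Set.univ Set.finite_univ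
  refine J.superset_covering ?_ hR
  intro U f hf
  choose l hl₁ hl₂ using fun k ↦ hR' f hf k (Set.mem_univ k)
  refine ⟨Limits.Cofan.IsColimit.desc h₂ l, ?_, ?_⟩
  · refine Limits.Cofan.IsColimit.hom_ext h₁ _ _ fun k ↦ ?_
    rw [reassoc_of% hm k, Limits.Cofan.IsColimit.fac, hl₁, Category.assoc]
  · refine Limits.Cofan.IsColimit.hom_ext h₂ _ _ fun k ↦ ?_
    rw [Limits.Cofan.IsColimit.fac_assoc, hl₂, Category.assoc]

/-! ### Comparison with liftings of simplicial presheaves -/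

/-- The map `A ⟶ F(X)` corresponding to a map `A ⊗ X ⟶ F`. -/
def ofTensor {A : SSet.{u}} {X : C} (a : tensor A (rObj X) ⟶ F) : A ⟶ F.obj (op X) where
  app n := ↾fun s ↦ (a.app (op X)).app n (s, 𝟙 X)
  naturality n m f := by
    ext s
    exact ConcreteCategory.congr_hom ((a.app (op X)).naturality f)
      ((s, 𝟙 X) : A.obj n × (X ⟶ X))

/-- The map `A ⊗ X ⟶ F` corresponding to a map `A ⟶ F(X)`. -/
def toTensor {A : SSet.{u}} {X : C} (a : A ⟶ F.obj (op X)) : tensor A (rObj X) ⟶ F where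
  app Y :=
    { app n := ↾fun (s : A.obj n × (Y.unop ⟶ X)) ↦ (F.map s.2.op).app n (a.app n s.1)
      naturality n m f := by
        ext ⟨s, g⟩
        exact (congr_arg _ (ConcreteCategory.congr_hom (a.naturality f) s)).trans
          (ConcreteCategory.congr_hom ((F.map g.op).naturality f) (a.app n s)) }
  naturality Y Z f := by
    ext n ⟨s, g⟩
    change (F.map (f.unop ≫ g).op).app n (a.app n s) =
      (F.map f).app n ((F.map g.op).app n (a.app n s))
    rw [op_comp, F.map_comp]
    rfl

theorem ofTensor_toTensor {A : SSet.{u}} {X : C} (a : A ⟶ F.obj (op X)) :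
    ofTensor (toTensor a) = a := by
  ext n s
  change (F.map (𝟙 X).op).app n (a.app n s) = _
  rw [op_id, F.map_id]
  rfl

theorem toTensor_ofTensor {A : SSet.{u}} {X : C} (a : tensor A (rObj X) ⟶ F) :
    toTensor (ofTensor a) = a := by
  ext Y n ⟨s, g⟩
  refine (ConcreteCategory.congr_hom (congr_app (a.naturality (g : Y.unop ⟶ X).op) n)
    ((s, 𝟙 X) : A.obj n × (X ⟶ X))).symm.trans ?_
  change (a.app _).app n (s, g ≫ 𝟙 X) = _
  rw [Category.comp_id]
  rfl

theorem ofTensor_injective {A : SSet.{u}} {X : C} :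
    Function.Injective (ofTensor (F := F) (A := A) (X := X)) :=
  Function.LeftInverse.injective toTensor_ofTensor

theorem ofTensor_comp {A : SSet.{u}} {X : C} (a : tensor A (rObj X) ⟶ F) (p : F ⟶ G) :
    ofTensor (a ≫ p) = ofTensor a ≫ p.app (op X) := rfl

theorem ofTensor_mapLeft {A B : SSet.{u}} {X : C} (i : A ⟶ B) (b : tensor B (rObj X) ⟶ F) :
    ofTensor (tensorMapLeft i (rObj X) ≫ b) = i ≫ ofTensor b := rfl

theorem ofTensor_mapRight {A : SSet.{u}} {X U : C} (f : U ⟶ X) (a : tensor A (rObj X) ⟶ F) :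
    ofTensor (tensorMapRight A (rMap f) ≫ a) = ofTensor a ≫ F.map f.op := by
  ext n s
  refine Eq.trans ?_ (ConcreteCategory.congr_hom (congr_app (a.naturality f.op) n)
    ((s, 𝟙 X) : A.obj n × (X ⟶ X)))
  change (a.app _).app n (s, 𝟙 U ≫ f) = (a.app _).app n (s, f ≫ 𝟙 X)
  rw [Category.id_comp, Category.comp_id]

/-- By the Yoneda lemma, maps `A ⊗ X ⟶ F` are maps `A ⟶ F(X)`. From here on all lifting problems are
problems for simplicial sets of sections. -/
theorem hasLocalLiftings_iff {A B : SSet.{u}} (i : A ⟶ B) :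
    HasLocalLiftings J i p ↔ LocalRLP J i p := by
  constructor
  · intro h X a b hab
    obtain ⟨R, hR, hR'⟩ := h X (toTensor a) (toTensor b) (ofTensor_injective (by
      rw [ofTensor_comp, ofTensor_mapLeft, ofTensor_toTensor, ofTensor_toTensor, hab]))
    refine J.superset_covering (fun U f hf ↦ ?_) hR
    obtain ⟨l, h₁, h₂⟩ := hR' f hf
    refine ⟨ofTensor l, ?_, ?_⟩
    · rw [← ofTensor_mapLeft, h₁, ofTensor_mapRight, ofTensor_toTensor]
    · rw [← ofTensor_comp, h₂, ofTensor_mapRight, ofTensor_toTensor]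
  · intro h X a b hab
    refine ⟨_, h X (ofTensor a) (ofTensor b) ?_, ?_⟩
    · rw [← ofTensor_comp, hab, ofTensor_mapLeft]
    · rintro U f ⟨l, h₁, h₂⟩
      refine ⟨toTensor l, ofTensor_injective ?_, ofTensor_injective ?_⟩
      · rw [ofTensor_mapLeft, ofTensor_toTensor, ofTensor_mapRight, h₁]
      · rw [ofTensor_comp, ofTensor_toTensor, ofTensor_mapRight, h₂]

end

end LocalLift

namespace LocalLift

/-! ### Finite cell complexes. -/

section

/-- A map from a finite simplicial set to a sequential colimit factors through a finite stage. -/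
theorem exists_hom_of_isColimit_nat {D : ℕ ⥤ SSet.{u}} {c : Limits.Cocone D}
    (hc : Limits.IsColimit c) {A : SSet.{u}} [A.Finite] (f : A ⟶ c.pt) :
    ∃ (n : ℕ) (g : A ⟶ D.obj n), g ≫ c.ι.app n = f := by
  have := Cardinal.fact_isRegular_aleph0.{u}
  have := isCardinalFiltered_aleph0_iff.{u} ℕ |>.2 inferInstance
  exact IsCardinalPresentable.exists_hom_of_isColimit Cardinal.aleph0.{u} hc f

theorem exists_eq_of_isColimit_nat {D : ℕ ⥤ SSet.{u}} {c : Limits.Cocone D}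
    (hc : Limits.IsColimit c) {A : SSet.{u}} [A.Finite] {n : ℕ} (f g : A ⟶ D.obj n)
    (h : f ≫ c.ι.app n = g ≫ c.ι.app n) :
    ∃ (m : ℕ) (hm : n ≤ m), f ≫ D.map (homOfLE hm) = g ≫ D.map (homOfLE hm) := by
  have := Cardinal.fact_isRegular_aleph0.{u}
  have := isCardinalFiltered_aleph0_iff.{u} ℕ |>.2 inferInstance
  obtain ⟨m, v, hv⟩ := IsCardinalPresentable.exists_eq_of_isColimit' Cardinal.aleph0.{u} hc f g h
  exact ⟨m, leOfHom v, hv⟩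

variable {C : Type u} [SmallCategory C] {J : GrothendieckTopology C} {F G H : Cᵒᵖ ⥤ SSet.{u}}
  {p : F ⟶ G}

/-- The map from `S` to each finite stage is a finite composite of pushouts of finite coproducts of
the `g j k`. As `T` is finite, its identity factors through some stage by a map `s`, and as `S` is
finite, `f ≫ s` becomes the cellular inclusion at a later stage. So `f` is a retract of the
inclusion into a finite stage. -/
theorem LocalRLP.of_relativeCellComplex {α : ℕ → Type*} {A B : (j : ℕ) → α j → SSet.{u}}
    {g : (j : ℕ) → (k : α j) → A j k ⟶ B j k} {S T : SSet.{u}} [S.Finite] [T.Finite] {f : S ⟶ T}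
    (c : HomotopicalAlgebra.RelativeCellComplex g f)
    (hc : ∀ j hj, Finite (c.attachCells j hj).ι)
    (hg : ∀ j k, LocalRLP J (g j k) p) : LocalRLP J f p := by
  have key (n : ℕ) : LocalRLP J (c.isoBot.inv ≫ c.F.map (homOfLE (Nat.zero_le n))) p := by
    induction n with
    | zero =>
      have : IsIso (c.F.map (homOfLE (Nat.zero_le 0))) := by
        rw [show homOfLE (Nat.zero_le 0) = 𝟙 _ from rfl, c.F.map_id]; infer_instance
      exact .of_isIso (c.isoBot.inv ≫ c.F.map (homOfLE (Nat.zero_le 0)))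
    | succ n ih =>
      rw [← homOfLE_comp (Nat.zero_le n) (Nat.le_succ n), c.F.map_comp, ← Category.assoc]
      have hn : ¬ IsMax n := not_isMax n
      let a := c.attachCells n hn
      have := hc n hn
      exact ih.comp (.of_isPushout a.isPushout
        (.of_isColimit_cofan (fun k ↦ hg n (a.π k)) a.isColimit₁ a.isColimit₂ a.m a.hm))
  have h0 (m : ℕ) : c.isoBot.inv ≫ c.F.map (homOfLE (Nat.zero_le m)) ≫ c.incl.app m = f :=
    (congr_arg (c.isoBot.inv ≫ ·) (Limits.Cocone.w ⟨T, c.incl⟩ _)).trans c.fac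
  obtain ⟨n, s, hs⟩ := exists_hom_of_isColimit_nat c.isColimit (𝟙 T)
  obtain ⟨m, hm, hm'⟩ := exists_eq_of_isColimit_nat c.isColimit (f ≫ s)
    (c.isoBot.inv ≫ c.F.map (homOfLE (Nat.zero_le n))) (by
      rw [Category.assoc, hs, Category.assoc]
      exact (Category.comp_id f).trans (h0 n).symm)
  have hs' : (s ≫ c.F.map (homOfLE hm)) ≫ c.incl.app m = 𝟙 T := by
    rw [Category.assoc]; exact (s ≫= Limits.Cocone.w ⟨T, c.incl⟩ _).trans hs
  rw [Category.assoc, Category.assoc, ← c.F.map_comp, homOfLE_comp] at hm'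
  intro X a b h
  refine J.superset_covering ?_ (key m X a (c.incl.app m ≫ b) (by
    rw [h, Category.assoc, reassoc_of% (h0 m)]))
  rintro U k ⟨l, h₁, h₂⟩
  refine ⟨(s ≫ c.F.map (homOfLE hm)) ≫ l, ?_, ?_⟩
  · rw [← h₁, ← hm']; simp
  · rw [Category.assoc, h₂, Category.assoc]; simpa using hs' =≫ (b ≫ G.map k.op)

/-- Local trivial fibrations lift against all monomorphisms of finite simplicial sets. -/
theorem LocalRLP.of_mono (hp : ∀ n : ℕ, LocalRLP J (SSet.boundary.{u} n).ι p) {A B : SSet.{u}}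
    [A.Finite] [B.Finite] (i : A ⟶ B) [Mono i] : LocalRLP J i p := by
  refine .of_relativeCellComplex (SSet.relativeCellComplexOfMono i) (fun j hj ↦ ?_)
    fun n _ ↦ hp n
  exact Finite.of_injective (β := B.nonDegenerate j)
    (fun c : SSet.relativeCellComplexOfMono.Cell i j ↦ ⟨c.simplex, c.nonDegenerate⟩)
    (fun c d h ↦ by cases c; cases d; cases h; rfl)

/-- Local fibrations lift against inclusions with a regular pairing. -/
theorem LocalRLP.of_pairing (hp : ∀ (n : ℕ) (k : Fin (n + 2)),
    LocalRLP J (SSet.horn.{u} (n + 1) k).ι p) {B : SSet.{u}} [B.Finite] {A : B.Subcomplex}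
    (P : A.Pairing) [P.IsRegular] : LocalRLP J A.ι p := by
  refine .of_relativeCellComplex P.rankFunction.relativeCellComplex (fun j hj ↦ ?_)
    fun n c ↦ hp _ _
  -- The cells of a given rank inject into `A.N`, which is finite because `B` is.
  have : Finite A.N := Finite.of_injective (fun s : A.N ↦ s.toN) fun s t h ↦ by
    rwa [SSet.Subcomplex.N.ext_iff]
  exact Finite.of_injective (β := A.N) (fun c : P.rankFunction.Cell j ↦ c.s.1)
    (fun c d h ↦ by cases c; cases d; cases Subtype.ext h; rfl)

theorem LocalRLP.of_bicartSq {B : SSet.{u}} {A₁ A₂ A₃ A₄ : B.Subcomplex}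
    (sq : SSet.Subcomplex.BicartSq A₁ A₂ A₃ A₄)
    (h : LocalRLP J (SSet.Subcomplex.homOfLE sq.le₁₃) p) :
    LocalRLP J (SSet.Subcomplex.homOfLE sq.le₂₄) p :=
  h.of_isPushout sq.isPushout

end

end LocalLift

namespace LocalLift

section

/-! ### Subcomplexes of the nerve of a partially ordered set -/

variable {Q : Type u} [PartialOrder Q]

/-- The simplex of the nerve of a partially ordered set given by a monotone map. -/
abbrev nerveMk {n : ℕ} (f : Fin (n + 1) →o Q) : (nerve Q) _⦋n⦌ := f.monotone.functor

/-- The subcomplex of the nerve of `Q` of all simplices whose set of vertices belongs to `K`. -/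
def chainSub (K : LowerSet (Set Q)) : (nerve Q).Subcomplex where
  obj n := {s | Set.range s.obj ∈ K}
  map {n m} f s hs := K.lower (by rintro _ ⟨i, rfl⟩; exact ⟨_, rfl⟩) hs

theorem chainSub_mono {K L : LowerSet (Set Q)} (h : K ≤ L) : chainSub K ≤ chainSub L :=
  fun _ _ hs ↦ h hs

/-- The simplex of the nerve spanned by a finite chain. -/
theorem exists_simplex_of_isChain {τ : Set Q} (hτ : IsChain (· ≤ ·) τ) {n : ℕ}
    (hn : τ.ncard = n + 1) : ∃ e : Fin (n + 1) ↪o Q, Set.range e = τ := by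
  classical
  let : LinearOrder τ :=
    { (inferInstance : PartialOrder τ) with
      le_total := fun a b ↦ hτ.total a.2 b.2
      toDecidableLE := Classical.decRel _ }
  have : Fintype τ := (Set.finite_of_ncard_ne_zero (by lia)).fintype
  have e := Fintype.orderIsoFinOfCardEq τ (k := n + 1)
    (by rw [← hn, Set.ncard_eq_toFinset_card', Set.toFinset_card])
  refine ⟨e.toOrderEmbedding.trans (OrderEmbedding.subtype _), ?_⟩
  ext x
  constructor
  · rintro ⟨i, rfl⟩; exact (e i).2
  · intro hx; exact ⟨e.symm ⟨x, hx⟩, by simp⟩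

/-! ### Attaching chains along acyclic matchings. -/

variable {C : Type u} [SmallCategory C] {J : GrothendieckTopology C} {F G : Cᵒᵖ ⥤ SSet.{u}}
  {p : F ⟶ G}

/-- Adjoining the image of a monomorphism `g` to `A` is a pushout of the inclusion of the part of
`D` that `g` already sends into `A`. -/
theorem LocalRLP.sup_range {B D : SSet.{u}} (g : D ⟶ B) [Mono g] (A : B.Subcomplex)
    {A' : B.Subcomplex} (h : A ⊔ SSet.Subcomplex.range g = A')
    (hp : LocalRLP J (A.preimage g).ι p) :
    LocalRLP J (SSet.Subcomplex.homOfLE (show A ≤ A' from h ▸ le_sup_left)) p := by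
  subst h
  refine LocalRLP.of_bicartSq (A₁ := A ⊓ SSet.Subcomplex.range g)
    (A₃ := SSet.Subcomplex.range g) ⟨rfl, rfl⟩ ?_
  let t : ((A.preimage g : D.Subcomplex) : SSet) ⟶
      ((A ⊓ SSet.Subcomplex.range g : B.Subcomplex) : SSet) :=
    SSet.Subcomplex.lift ((A.preimage g).ι ≫ g) (by
      rintro n _ ⟨x, rfl⟩
      exact ⟨x.2, x.1, rfl⟩)
  have : Mono t := by
    have : Mono (t ≫ SSet.Subcomplex.ι _) := by
      exact inferInstanceAs (Mono ((A.preimage g).ι ≫ g))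
    exact mono_of_mono t (SSet.Subcomplex.ι _)
  have : Epi t := by
    rw [← SSet.Subcomplex.range_eq_top_iff, ← top_le_iff]
    rintro n ⟨_, hx, y, rfl⟩ -
    exact ⟨⟨y, hx⟩, rfl⟩
  have : IsIso t := isIso_of_mono_of_epi t
  exact hp.of_arrow_iso (asIso t) (asIso (SSet.Subcomplex.toRange g)) rfl

/-- Attaching one pair of chains to a family of chains is a pushout of a horn inclusion. -/
theorem LocalRLP.attach_chain
    (hp : ∀ (n : ℕ) (k : Fin (n + 2)), LocalRLP J (SSet.horn.{u} (n + 1) k).ι p)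
    {K K' : LowerSet (Set Q)} {τ : Set Q} (hτ : IsChain (· ≤ ·) τ) (hfin : τ.Finite) {v : Q}
    (hv : v ∈ τ) (hne : (τ \ {v}).Nonempty) (hK : τ \ {v} ∉ K)
    (hw : ∀ w ∈ τ, w ≠ v → τ \ {w} ∈ K) (hK' : ∀ σ, σ ∈ K' ↔ σ ∈ K ∨ σ = τ ∨ σ = τ \ {v}) :
    LocalRLP J (SSet.Subcomplex.homOfLE
      (chainSub_mono (show K ≤ K' from fun _ h ↦ (hK' _).2 (Or.inl h)))) p := by
  -- Since `τ \ {v}` is nonempty, `τ` spans a simplex of positive dimension, so it has horns.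
  obtain ⟨n, hn⟩ : ∃ n, τ.ncard = n + 2 := by
    have h1 : (τ \ {v}).ncard + 1 = τ.ncard := Set.ncard_sdiff_singleton_add_one hv hfin
    have h2 : 0 < (τ \ {v}).ncard := (Set.ncard_pos (hfin.subset Set.sdiff_subset)).2 hne
    exact ⟨τ.ncard - 2, by lia⟩
  obtain ⟨e, rfl⟩ := exists_simplex_of_isChain hτ hn
  obtain ⟨k, rfl⟩ := hv
  let g : Δ[n + 1] ⟶ nerve Q := SSet.yonedaEquiv.symm (nerveMk e.toOrderHom)
  have hg {d : ℕ} (x : Δ[n + 1] _⦋d⦌) (i : Fin (d + 1)) :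
      (g.app _ x).obj i = e (x i) := rfl
  have hg' {d : ℕ} (x : Δ[n + 1] _⦋d⦌) : Set.range (g.app _ x).obj = e '' Set.range x := by
    rw [← Set.range_comp]; rfl
  have : Mono g := by
    refine (NatTrans.mono_iff_mono_app g).2 fun ⟨d⟩ ↦ (mono_iff_injective _).2 fun x y h ↦ ?_
    induction d using SimplexCategory.rec with | _ d
    ext i : 1
    apply e.injective
    rw [← hg, ← hg]
    exact congr_arg (fun s : (nerve Q) _⦋d⦌ ↦ s.obj i) h
  refine LocalRLP.sup_range g (chainSub K) ?_ ?_
  · apply le_antisymm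
    · rw [sup_le_iff]
      refine ⟨chainSub_mono fun _ h ↦ (hK' _).2 (Or.inl h), ?_⟩
      rintro ⟨d⟩ _ ⟨x, rfl⟩
      induction d using SimplexCategory.rec with | _ d
      refine K'.lower (?_ : _ ≤ Set.range e) ((hK' _).2 (Or.inr (Or.inl rfl)))
      rw [hg']
      exact Set.image_subset_range _ _
    · rintro ⟨d⟩ s hs
      induction d using SimplexCategory.rec with | _ d
      have hs' : s ∈ (chainSub K).obj _ ∨ Set.range s.obj ⊆ Set.range e := by
        obtain h | h | h := (hK' _).1 hs
        · exact Or.inl h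
        · exact Or.inr h.subset
        · exact Or.inr (h.subset.trans Set.sdiff_subset)
      obtain h | h := hs'
      · exact Or.inl h
      · right
        choose j hj using fun i ↦ h (Set.mem_range_self i)
        refine ⟨SSet.stdSimplex.objMk ⟨j, fun a b hab ↦ ?_⟩, ?_⟩
        · rw [← e.le_iff_le]
          exact (hj a).trans_le ((s.monotone hab).trans (hj b).ge)
        · exact nerve.ext_of_isThin (funext hj)
  -- The face of `τ` opposite `v` is missing from `K` by `hK`, and all other facets are present by
  -- `hw`: the part of the simplex already in `K` is exactly the horn at `v`.
  · have hpre : (chainSub K).preimage g = SSet.horn.{u} (n + 1) k := by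
      ext ⟨d⟩ x
      induction d using SimplexCategory.rec with | _ d
      rw [SSet.mem_horn_iff_notMem_range]
      change Set.range (g.app _ x).obj ∈ K ↔ _
      rw [hg']
      constructor
      · intro h
        by_contra! hx
        refine hK (K.lower ?_ h)
        rintro _ ⟨⟨j, rfl⟩, hj⟩
        exact Set.mem_image_of_mem _ (hx j (by rintro rfl; exact hj rfl))
      · rintro ⟨j, hj, hjx⟩
        refine K.lower ?_ (hw (e j) ⟨j, rfl⟩ (by simpa using hj))
        rintro _ ⟨i, hi, rfl⟩
        refine ⟨⟨i, rfl⟩, fun h ↦ hjx ?_⟩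
        rw [← e.injective h]; exact hi
    rw [hpre]
    exact hp n k

/-- A matching, given by toggling an element `v σ`, of the chains which belong to `L` but not to
`K`, that is acyclic because of the rank function `ρ`. -/
structure ToggleMatching {α : Type*} [LinearOrder α] (K L : LowerSet (Set Q)) (v : Set Q → Q)
    (ρ : Set Q → α) : Prop where
  le : K ≤ L
  empty_mem : ∅ ∈ K
  isChain : ∀ σ ∈ L, IsChain (· ≤ ·) σ
  insert_mem : ∀ σ ∈ L, σ ∉ K → v σ ∉ σ → insert (v σ) σ ∈ L
  erase_notMem : ∀ σ ∈ L, σ ∉ K → v σ ∈ σ → σ \ {v σ} ∉ K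
  v_insert : ∀ σ ∈ L, σ ∉ K → v σ ∉ σ → v (insert (v σ) σ) = v σ
  v_erase : ∀ σ ∈ L, σ ∉ K → v σ ∈ σ → v (σ \ {v σ}) = v σ
  -- This rules out cycles: descending to a facet outside `K`, and then to its partner if that is
  -- the larger one, never raises the rank, and lowers it in the second case.
  rank : ∀ τ ∈ L, τ ∉ K → v τ ∈ τ → ∀ w ∈ τ, w ≠ v τ → τ \ {w} ∉ K →
    (v (τ \ {w}) ∈ τ \ {w} ∧ ρ (τ \ {w}) ≤ ρ τ) ∨
    (v (τ \ {w}) ∉ τ \ {w} ∧ ρ (insert (v (τ \ {w})) (τ \ {w})) < ρ τ)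

theorem LocalRLP.of_toggleMatching [Finite Q]
    (hp : ∀ (n : ℕ) (k : Fin (n + 2)), LocalRLP J (SSet.horn.{u} (n + 1) k).ι p)
    {α : Type*} [LinearOrder α] {K L : LowerSet (Set Q)} {v : Set Q → Q} {ρ : Set Q → α}
    (h : ToggleMatching K L v ρ) :
    LocalRLP J (SSet.Subcomplex.homOfLE (chainSub_mono h.le)) p := by
  -- Induction on the number of chains of `L` still missing from `K`; each step attaches one matched
  -- pair.
  obtain ⟨N, hN⟩ : ∃ N, ((L : Set (Set Q)) \ K).ncard = N := ⟨_, rfl⟩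
  induction N using Nat.strong_induction_on generalizing K with
  | _ N ih =>
  by_cases hne : ∃ σ ∈ L, σ ∉ K
  swap
  · push Not at hne
    obtain rfl : K = L := le_antisymm h.le hne
    exact .of_isIso (𝟙 _)
  let T : Set (Set Q) := {τ | τ ∈ L ∧ τ ∉ K ∧ v τ ∈ τ}
  have hT : T.Nonempty := by
    obtain ⟨σ, hσ, hσ'⟩ := hne
    by_cases hv : v σ ∈ σ
    · exact ⟨σ, hσ, hσ', hv⟩
    · refine ⟨insert (v σ) σ, h.insert_mem σ hσ hσ' hv,
        fun h' ↦ hσ' (K.lower (Set.subset_insert _ _) h'), ?_⟩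
      rw [h.v_insert σ hσ hσ' hv]
      exact Set.mem_insert _ _
  -- Cardinality breaks ties of `ρ`, which is why a weak inequality suffices for facets that contain
  -- their own toggle element. Minimality forces every facet of `τ` except `τ \ {v τ}` to lie in `K`
  -- already.
  obtain ⟨τ, ⟨hτL, hτK, hvτ⟩, hmin⟩ := T.toFinite.exists_minimalFor
    (fun τ ↦ toLex (ρ τ, τ.ncard)) T hT
  have hw : ∀ w ∈ τ, w ≠ v τ → τ \ {w} ∈ K := by
    intro w hw hwv
    by_contra hwK
    have hwL : τ \ {w} ∈ L := L.lower Set.sdiff_subset hτL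
    obtain ⟨h₁, h₂⟩ | ⟨h₁, h₂⟩ := h.rank τ hτL hτK hvτ w hw hwv hwK
    · have hlt : toLex (ρ (τ \ {w}), (τ \ {w}).ncard) < toLex (ρ τ, τ.ncard) := by
        rw [Prod.Lex.toLex_lt_toLex']
        exact ⟨h₂, fun _ ↦ Set.ncard_sdiff_singleton_lt_of_mem hw⟩
      exact hlt.not_ge (hmin (j := τ \ {w}) ⟨hwL, hwK, h₁⟩ hlt.le)
    · have hlt : toLex (ρ (insert (v (τ \ {w})) (τ \ {w})),
          (insert (v (τ \ {w})) (τ \ {w})).ncard) < toLex (ρ τ, τ.ncard) := by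
        rw [Prod.Lex.toLex_lt_toLex]
        exact Or.inl h₂
      refine hlt.not_ge (hmin (j := insert (v (τ \ {w})) (τ \ {w}))
        ⟨h.insert_mem _ hwL hwK h₁, fun h' ↦ hwK (K.lower (Set.subset_insert _ _) h'), ?_⟩ hlt.le)
      rw [h.v_insert _ hwL hwK h₁]
      exact Set.mem_insert _ _
  have hvK := h.erase_notMem τ hτL hτK hvτ
  let K' : LowerSet (Set Q) :=
    { carrier := {σ | σ ∈ K ∨ σ = τ ∨ σ = τ \ {v τ}}
      lower' := by
        -- A subset of `τ` that misses some `w ≠ v τ` lies in `K` by `hw`; the only other subsets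
        -- are the two being attached.
        have key : ∀ s : Set Q, s ⊆ τ → s ∈ K ∨ s = τ ∨ s = τ \ {v τ} := by
          intro s hs
          by_cases hs' : ∃ w ∈ τ, w ≠ v τ ∧ w ∉ s
          · obtain ⟨w, hwτ, hwv, hws⟩ := hs'
            exact Or.inl (K.lower (a := τ \ {w}) (fun x hx ↦ ⟨hs hx, by rintro rfl; exact hws hx⟩)
              (hw w hwτ hwv))
          · push Not at hs'
            by_cases hvs : v τ ∈ s
            · right; left
              refine hs.antisymm fun x hx ↦ ?_
              by_cases hxv : x = v τ
              · rwa [hxv]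
              · exact hs' x hx hxv
            · right; right
              refine Set.Subset.antisymm (fun x hx ↦ ⟨hs hx, by rintro rfl; exact hvs hx⟩)
                fun x hx ↦ hs' x hx.1 hx.2
        rintro σ s hs (hσ | rfl | rfl)
        · exact Or.inl (K.lower hs hσ)
        · exact key s hs
        · exact key s (hs.trans Set.sdiff_subset) }
  have hK' : ∀ σ, σ ∈ K' ↔ σ ∈ K ∨ σ = τ ∨ σ = τ \ {v τ} := fun _ ↦ Iff.rfl
  have hKK' : K ≤ K' := fun _ h ↦ Or.inl h
  have hK'L : K' ≤ L := by
    rintro σ (hσ | rfl | rfl)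
    · exact h.le hσ
    · exact hτL
    · exact L.lower Set.sdiff_subset hτL
  have step := LocalRLP.attach_chain hp (K := K) (K' := K') (h.isChain τ hτL) τ.toFinite hvτ
    (Set.nonempty_iff_ne_empty.2 fun h0 ↦ hvK (h0 ▸ h.empty_mem)) hvK hw hK'
  have h' : ToggleMatching K' L v ρ :=
    { le := hK'L
      empty_mem := hKK' h.empty_mem
      isChain := h.isChain
      insert_mem := fun σ hσ hσ' ↦ h.insert_mem σ hσ fun hK ↦ hσ' (hKK' hK)
      -- The two attached chains are partners of each other, because toggling does not change `v`.
      -- Hence a chain that is still missing cannot have either of them as its partner.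
      erase_notMem := by
        intro σ hσ hσK' hv
        have hσK : σ ∉ K := fun hK ↦ hσK' (hKK' hK)
        have hve := h.v_erase σ hσ hσK hv
        rintro (h₁ | h₁ | h₁)
        · exact h.erase_notMem σ hσ hσK hv h₁
        · rw [h₁] at hve
          rw [hve, ← h₁] at hvτ
          exact hvτ.2 rfl
        · rw [h₁, h.v_erase τ hτL hτK hvτ] at hve
          refine hσK' (Or.inr (Or.inl ?_))
          rw [← Set.insert_sdiff_self_of_mem hv, h₁, ← hve, Set.insert_sdiff_self_of_mem hvτ]
      v_insert := fun σ hσ hσ' ↦ h.v_insert σ hσ fun hK ↦ hσ' (hKK' hK)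
      v_erase := fun σ hσ hσ' ↦ h.v_erase σ hσ fun hK ↦ hσ' (hKK' hK)
      rank := fun τ hτ hτ' hv w hw hwv hwK ↦ h.rank τ hτ (fun hK ↦ hτ' (hKK' hK)) hv w hw hwv
        fun hK ↦ hwK (hKK' hK) }
  have hlt : ((L : Set (Set Q)) \ K').ncard < N := by
    rw [← hN]
    refine Set.ncard_lt_ncard ⟨fun σ hσ ↦ ⟨hσ.1, fun hK ↦ hσ.2 (hKK' hK)⟩, fun hle ↦ ?_⟩
      (Set.toFinite _)
    exact (hle ⟨hτL, hτK⟩).2 (Or.inr (Or.inl rfl))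
  exact step.comp (ih _ hlt h' rfl)

end

end LocalLift

namespace LocalLift

section

/-! ### Chains of nonempty finite sets -/

open PartialOrder (NonemptyFiniteChains)

variable {X : Type u} [LinearOrder X] [Fintype X]

open Classical in
/-- A nonempty set, as a nonempty finite chain. -/
noncomputable def chainOfSet (s : Set X) (hs : s.Nonempty) : NonemptyFiniteChains X where
  finset := s.toFinset
  nonempty := by simpa using hs
  comparable _ _ := le_total _ _

@[simp]
theorem mem_chainOfSet {s : Set X} {hs : s.Nonempty} {x : X} :
    x ∈ (chainOfSet s hs).finset ↔ x ∈ s := by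
  simp [chainOfSet]

instance : Finite (NonemptyFiniteChains X) :=
  Finite.of_injective NonemptyFiniteChains.finset fun _ _ h ↦ NonemptyFiniteChains.ext h

/-- The chains of a partially ordered set. -/
def allChains (Q : Type*) [PartialOrder Q] : LowerSet (Set Q) where
  carrier := {σ | IsChain (· ≤ ·) σ}
  lower' _ _ h hσ := hσ.mono h

/-- The chains of nonempty subsets of `X` whose elements all miss a common element
different from `k`. -/
def hornChains (k : X) : LowerSet (Set (NonemptyFiniteChains X)) where
  carrier := {σ | IsChain (· ≤ ·) σ ∧ ∃ i ≠ k, ∀ S ∈ σ, i ∉ S.finset}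
  lower' _ _ h := fun ⟨h₁, i, hi, h₂⟩ ↦ ⟨h₁.mono h, i, hi, fun S hS ↦ h₂ S (h hS)⟩

/-- The set obtained by adding `k` to the largest element of the chain `σ` that does not
contain `k`. -/
noncomputable def hornToggle (k : X) (σ : Set (NonemptyFiniteChains X)) :
    NonemptyFiniteChains X :=
  chainOfSet {i | i = k ∨ ∃ S ∈ σ, k ∉ S.finset ∧ i ∈ S.finset} ⟨k, Or.inl rfl⟩

theorem mem_hornToggle {k i : X} {σ : Set (NonemptyFiniteChains X)} :
    i ∈ (hornToggle k σ).finset ↔ i = k ∨ ∃ S ∈ σ, k ∉ S.finset ∧ i ∈ S.finset :=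
  mem_chainOfSet

theorem hornToggle_congr {k : X} {σ τ : Set (NonemptyFiniteChains X)}
    (h : ∀ S : NonemptyFiniteChains X, k ∉ S.finset → (S ∈ σ ↔ S ∈ τ)) :
    hornToggle k σ = hornToggle k τ := by
  refine NonemptyFiniteChains.ext (Finset.ext fun i ↦ ?_)
  rw [mem_hornToggle, mem_hornToggle]
  exact or_congr_right (exists_congr fun S ↦
    ⟨fun ⟨a, b, c⟩ ↦ ⟨(h S b).1 a, b, c⟩, fun ⟨a, b, c⟩ ↦ ⟨(h S b).2 a, b, c⟩⟩)

theorem mem_hornToggle_self (k : X) (σ : Set (NonemptyFiniteChains X)) :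
    k ∈ (hornToggle k σ).finset :=
  mem_hornToggle.2 (Or.inl rfl)

/-- The toggle element depends only on the members of the chain that miss `k`, and itself contains
`k`, so it is unchanged by toggling. Removing it does not move a chain into `hornChains k`: apart
from `k`, its elements already occur in a smaller member. The rank counts members missing `k`.
Deleting a member that contains `k` leaves the toggle element alone, while deleting one that misses
`k` and then inserting a toggle element lowers the count. -/
theorem hornToggle_toggleMatching [Nontrivial X] (k : X) :
    ToggleMatching (hornChains k) (allChains _) (hornToggle k)
      (fun σ ↦ {S | S ∈ σ ∧ k ∉ S.finset}.ncard) where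
  le _ h := h.1
  empty_mem := by
    obtain ⟨i, hi⟩ := exists_ne k
    exact ⟨Set.subsingleton_empty.isChain, i, hi, by simp⟩
  isChain _ h := h
  insert_mem σ hσ _ _ := by
    refine hσ.insert fun T hT _ ↦ ?_
    by_cases hk : k ∈ T.finset
    · left
      intro i hi
      obtain rfl | ⟨S, hS, hkS, hi⟩ := mem_hornToggle.1 hi
      · exact hk
      · obtain h | h := hσ.total hS hT
        · exact h hi
        · exact (hkS (h hk)).elim
    · right
      intro i hi
      exact mem_hornToggle.2 (Or.inr ⟨T, hT, hk, hi⟩)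
  erase_notMem σ hσ hσK _ := by
    rintro ⟨-, i, hi, h⟩
    refine hσK ⟨hσ, i, hi, fun S hS hiS ↦ ?_⟩
    by_cases hSv : S = hornToggle k σ
    · subst hSv
      obtain rfl | ⟨T, hT, hkT, hiT⟩ := mem_hornToggle.1 hiS
      · exact hi rfl
      · exact h T ⟨hT, fun h' ↦ hkT (h' ▸ mem_hornToggle_self k σ)⟩ hiT
    · exact h S ⟨hS, hSv⟩ hiS
  v_insert σ _ _ _ := hornToggle_congr fun S hS ↦ by
    simp only [Set.mem_insert_iff, or_iff_right_iff_imp]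
    rintro rfl
    exact (hS (mem_hornToggle_self k σ)).elim
  v_erase σ _ _ _ := hornToggle_congr fun S hS ↦ by
    simp only [Set.mem_sdiff, Set.mem_singleton_iff, and_iff_left_iff_imp]
    rintro - rfl
    exact hS (mem_hornToggle_self k σ)
  rank τ _ _ hv w hw hwv _ := by
    by_cases hkw : k ∈ w.finset
    · left
      have : hornToggle k (τ \ {w}) = hornToggle k τ := hornToggle_congr fun S hS ↦ by
        simp only [Set.mem_sdiff, Set.mem_singleton_iff, and_iff_left_iff_imp]
        rintro - rfl
        exact hS hkw
      rw [this]
      exact ⟨⟨hv, hwv.symm⟩, Set.ncard_le_ncard (fun S hS ↦ ⟨hS.1.1, hS.2⟩) (Set.toFinite _)⟩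
    · by_cases hv' : hornToggle k (τ \ {w}) ∈ τ \ {w}
      · exact Or.inl ⟨hv', Set.ncard_le_ncard (fun S hS ↦ ⟨hS.1.1, hS.2⟩) (Set.toFinite _)⟩
      · refine Or.inr ⟨hv', Set.ncard_lt_ncard ⟨?_, fun h ↦ ?_⟩ (Set.toFinite _)⟩
        · rintro S ⟨rfl | hS, hkS⟩
          · exact (hkS (mem_hornToggle_self k _)).elim
          · exact ⟨hS.1, hkS⟩
        · obtain ⟨h' | h', -⟩ := h ⟨hw, hkw⟩
          · exact hkw (h' ▸ mem_hornToggle_self k _)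
          · exact h'.2 rfl

/-! ### The mapping cylinder of the last vertex map -/

/-- The partially ordered set whose nerve is the mapping cylinder of the last vertex map. -/
def LastVertexCylinder (X : Type u) [LinearOrder X] : Type u := NonemptyFiniteChains X ⊕ X

namespace LastVertexCylinder

section

variable {X : Type u} [LinearOrder X]

/-- The element of the cylinder given by a nonempty set. -/
def set : NonemptyFiniteChains X → LastVertexCylinder X := Sum.inl

/-- The element of the cylinder given by a point. -/
def pt : X → LastVertexCylinder X := Sum.inr

@[elab_as_elim]
theorem cases {motive : LastVertexCylinder X → Prop} (h₁ : ∀ S, motive (set S))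
    (h₂ : ∀ x, motive (pt x)) (q : LastVertexCylinder X) : motive q := by
  obtain S | x := q
  exacts [h₁ S, h₂ x]

/-- Sending a set `S` to `(S, ⊥)` and a point `x` to `(Iic x, x)` makes `S` lie below `x` exactly
when its maximum does, and the second coordinate keeps points from lying below sets. -/
instance : PartialOrder (LastVertexCylinder X) :=
  PartialOrder.lift (Sum.elim (fun S ↦ ((S.finset : Set X), (⊥ : WithBot X)))
    (fun x ↦ (Set.Iic x, (x : WithBot X)))) (by
      rintro (S | x) (T | y) h
      · simp only [Sum.elim_inl, Prod.mk.injEq, Finset.coe_inj, and_true] at h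
        rw [NonemptyFiniteChains.ext h]
      · simp at h
      · simp at h
      · simp only [Sum.elim_inr, Prod.mk.injEq, WithBot.coe_inj] at h
        rw [h.2])

theorem set_le_set {S T : NonemptyFiniteChains X} : set S ≤ set T ↔ S ≤ T := by
  change ((S.finset : Set X), (⊥ : WithBot X)) ≤ ((T.finset : Set X), (⊥ : WithBot X)) ↔ _
  simp
theorem set_le_pt {S : NonemptyFiniteChains X} {x : X} :
    set S ≤ pt x ↔ ∀ i ∈ S.finset, i ≤ x := by
  change ((S.finset : Set X), (⊥ : WithBot X)) ≤ (Set.Iic x, (x : WithBot X)) ↔ _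
  simp [Set.subset_def]
theorem pt_le_pt {x y : X} : pt x ≤ pt y ↔ x ≤ y := by
  change (Set.Iic x, (x : WithBot X)) ≤ (Set.Iic y, (y : WithBot X)) ↔ _
  simp
theorem not_pt_le_set {S : NonemptyFiniteChains X} {x : X} : ¬ pt x ≤ set S := by
  change ¬ (Set.Iic x, (x : WithBot X)) ≤ ((S.finset : Set X), (⊥ : WithBot X))
  simp

theorem set_injective : Function.Injective (set (X := X)) := Sum.inl_injective

theorem set_ne_pt {S : NonemptyFiniteChains X} {x : X} : set S ≠ pt x := Sum.inl_ne_inr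

instance [Fintype X] : Finite (LastVertexCylinder X) :=
  inferInstanceAs (Finite (NonemptyFiniteChains X ⊕ X))

/-- The elements of `X` that occur in an element of the cylinder. -/
def support : LastVertexCylinder X → Set X := Sum.elim (fun S ↦ S.finset) (fun x ↦ {x})

@[simp]
theorem mem_support_pt {x i : X} : i ∈ support (pt x) ↔ i = x := Iff.rfl

/-- The chains of the cylinder without points or whose elements all miss a common element. -/
def boundaryChains (X : Type u) [LinearOrder X] :
    LowerSet (Set (LastVertexCylinder X)) where
  carrier := {σ | IsChain (· ≤ ·) σ ∧ ((∀ x, pt x ∉ σ) ∨ ∃ i, ∀ S ∈ σ, i ∉ S.support)}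
  lower' _ _ h := by
    rintro ⟨h₁, h₂ | ⟨i, h₂⟩⟩
    · exact ⟨h₁.mono h, Or.inl fun x hx ↦ h₂ x (h hx)⟩
    · exact ⟨h₁.mono h, Or.inr ⟨i, fun S hS ↦ h₂ S (h hS)⟩⟩

/-- The first point of a chain of the cylinder. -/
abbrev IsFirst (σ : Set (LastVertexCylinder X)) (s : X) : Prop := IsLeast {x | pt x ∈ σ} s

theorem isFirst_congr {σ τ : Set (LastVertexCylinder X)} (h : ∀ x, pt x ∈ σ ↔ pt x ∈ τ) :
    IsFirst σ = IsFirst τ := by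
  have : {x | pt x ∈ σ} = {x | pt x ∈ τ} := Set.ext h
  funext s
  rw [IsFirst, this]

theorem le_of_isFirst {σ : Set (LastVertexCylinder X)} (hσ : IsChain (· ≤ ·) σ) {s : X}
    (hs : IsFirst σ s) {S : NonemptyFiniteChains X} (hS : set S ∈ σ) :
    ∀ i ∈ S.finset, i ≤ s :=
  set_le_pt.1 ((hσ.total hS hs.1).resolve_right not_pt_le_set)

theorem isFirst_insert {σ : Set (LastVertexCylinder X)} {S : NonemptyFiniteChains X} :
    IsFirst (insert (set S) σ) = IsFirst σ :=
  isFirst_congr fun x ↦ by simp [set_ne_pt.symm]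

theorem isFirst_erase {σ : Set (LastVertexCylinder X)} {S : NonemptyFiniteChains X} :
    IsFirst (σ \ {set S}) = IsFirst σ :=
  isFirst_congr fun x ↦ by simp [set_ne_pt.symm]

end

theorem exists_isFirst {σ : Set (LastVertexCylinder X)} {x : X} (h : pt x ∈ σ) :
    ∃ s, IsFirst σ s := by
  obtain ⟨s, h₁, h₂⟩ := Set.exists_min_image {x | pt x ∈ σ} id (Set.toFinite _) ⟨x, h⟩
  exact ⟨s, h₁, fun y hy ↦ h₂ y hy⟩

/-- The set obtained by adding `s` to the largest set in a chain that does not contain `s`. -/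
noncomputable def toggleAt (σ : Set (LastVertexCylinder X)) (s : X) : NonemptyFiniteChains X :=
  chainOfSet {i | i = s ∨ ∃ S, set S ∈ σ ∧ s ∉ S.finset ∧ i ∈ S.finset} ⟨s, Or.inl rfl⟩

theorem mem_toggleAt {σ : Set (LastVertexCylinder X)} {s i : X} :
    i ∈ (toggleAt σ s).finset ↔ i = s ∨ ∃ S, set S ∈ σ ∧ s ∉ S.finset ∧ i ∈ S.finset :=
  mem_chainOfSet

theorem toggleAt_congr {s : X} {σ τ : Set (LastVertexCylinder X)}
    (h : ∀ S : NonemptyFiniteChains X, s ∉ S.finset → (set S ∈ σ ↔ set S ∈ τ)) :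
    toggleAt σ s = toggleAt τ s := by
  refine NonemptyFiniteChains.ext (Finset.ext fun i ↦ ?_)
  rw [mem_toggleAt, mem_toggleAt]
  exact or_congr_right (exists_congr fun S ↦
    ⟨fun ⟨a, b, c⟩ ↦ ⟨(h S b).1 a, b, c⟩, fun ⟨a, b, c⟩ ↦ ⟨(h S b).2 a, b, c⟩⟩)

open Classical in
/-- The set obtained by adding the first point `s` of a chain to the largest set in it that does
not contain `s`. -/
noncomputable def toggle [Nonempty X] (σ : Set (LastVertexCylinder X)) : LastVertexCylinder X :=
  -- The default value plays no role: chains without a point lie in `boundaryChains`.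
  set (toggleAt σ (if h : ∃ s, IsFirst σ s then h.choose else Classical.arbitrary X))

theorem toggle_eq [Nonempty X] {σ : Set (LastVertexCylinder X)} {s : X} (h : IsFirst σ s) :
    toggle σ = set (toggleAt σ s) := by
  have h' : ∃ s, IsFirst σ s := ⟨s, h⟩
  rw [toggle, dite_cond_eq_true (eq_true h'), h'.choose_spec.unique h]

theorem exists_isFirst_of_notMem {σ : Set (LastVertexCylinder X)} (hσ : IsChain (· ≤ ·) σ)
    (h : σ ∉ boundaryChains X) :
    (∃ s, IsFirst σ s) ∧ ∀ i, ∃ S ∈ σ, i ∈ S.support := by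
  constructor
  · by_contra h'
    exact h ⟨hσ, Or.inl fun x hx ↦ h' (exists_isFirst hx)⟩
  · by_contra! h'
    exact h ⟨hσ, Or.inr h'⟩

-- Let `s` be the first point of the chain. All its sets lie below `s`, so adjoining `s` to the
-- largest set that misses it yields a chain again. Removing that set uncovers nothing, since `s` is
-- still covered by the point `s` and the other elements by a smaller set. The rank compares first
-- the number of points, which matters when a point is deleted, and then the number of sets missing
-- `s`, as in the horn case.
open Classical in
theorem toggle_toggleMatching [Nonempty X] :
    ToggleMatching (boundaryChains X) (allChains _) toggle
      (fun σ ↦ toLex ({x | pt x ∈ σ}.ncard,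
        {S | set S ∈ σ ∧ ∃ s, IsFirst σ s ∧ s ∉ S.finset}.ncard)) where
  le _ h := h.1
  empty_mem := ⟨Set.subsingleton_empty.isChain, Or.inl (by simp)⟩
  isChain _ h := h
  insert_mem σ hσ hσK _ := by
    obtain ⟨⟨s, hs⟩, -⟩ := exists_isFirst_of_notMem hσ hσK
    rw [toggle_eq hs]
    refine hσ.insert fun T hT _ ↦ ?_
    induction T using LastVertexCylinder.cases with
    | h₁ T =>
      rw [set_le_set, set_le_set]
      by_cases hk : s ∈ T.finset
      · left
        intro i hi
        obtain rfl | ⟨S, hS, hkS, hi⟩ := mem_toggleAt.1 hi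
        · exact hk
        · obtain h | h := hσ.total hS hT
          · exact set_le_set.1 h hi
          · exact (hkS (set_le_set.1 h hk)).elim
      · right
        intro i hi
        exact mem_toggleAt.2 (Or.inr ⟨T, hT, hk, hi⟩)
    | h₂ x =>
      left
      rw [set_le_pt]
      intro i hi
      obtain rfl | ⟨S, hS, hkS, hi⟩ := mem_toggleAt.1 hi
      · exact hs.2 hT
      · exact (le_of_isFirst hσ hs hS i hi).trans (hs.2 hT)
  erase_notMem σ hσ hσK _ := by
    obtain ⟨⟨s, hs⟩, hcov⟩ := exists_isFirst_of_notMem hσ hσK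
    rw [toggle_eq hs]
    rintro ⟨-, h | ⟨i, h⟩⟩
    · exact h s ⟨hs.1, set_ne_pt.symm⟩
    · obtain ⟨S, hS, hiS⟩ := hcov i
      by_cases hSv : S = set (toggleAt σ s)
      · subst hSv
        obtain rfl | ⟨T, hT, hkT, hiT⟩ := mem_toggleAt.1 hiS
        · exact h (pt i) ⟨hs.1, set_ne_pt.symm⟩ rfl
        · exact h (set T) ⟨hT, fun h' ↦ hkT
            (set_injective h' ▸ mem_toggleAt.2 (Or.inl rfl))⟩ hiT
      · exact h S ⟨hS, hSv⟩ hiS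
  v_insert σ hσ hσK _ := by
    obtain ⟨⟨s, hs⟩, -⟩ := exists_isFirst_of_notMem hσ hσK
    rw [toggle_eq hs, toggle_eq (by rwa [isFirst_insert] : IsFirst _ s)]
    refine congr_arg _ (toggleAt_congr fun S hS ↦ ?_)
    simp only [Set.mem_insert_iff, or_iff_right_iff_imp]
    intro h
    exact (hS (set_injective h ▸ mem_toggleAt.2 (Or.inl rfl))).elim
  v_erase σ hσ hσK _ := by
    obtain ⟨⟨s, hs⟩, -⟩ := exists_isFirst_of_notMem hσ hσK
    rw [toggle_eq hs, toggle_eq (by rwa [isFirst_erase] : IsFirst _ s)]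
    refine congr_arg _ (toggleAt_congr fun S hS ↦ ?_)
    simp only [Set.mem_sdiff, Set.mem_singleton_iff, and_iff_left_iff_imp]
    intro _ h
    exact hS (set_injective h ▸ mem_toggleAt.2 (Or.inl rfl))
  rank τ hτ hτK hv w hw hwv hwK := by
    obtain ⟨⟨s, hs⟩, -⟩ := exists_isFirst_of_notMem hτ hτK
    obtain ⟨⟨t, ht⟩, hcov⟩ := exists_isFirst_of_notMem (hτ.mono Set.sdiff_subset) hwK
    induction w using LastVertexCylinder.cases with
    | h₁ T =>
      obtain rfl : s = t := by rw [isFirst_erase] at ht; exact hs.unique ht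
      have h1 : {x | pt x ∈ τ \ {set T}} = {x | pt x ∈ τ} := by
        ext x; simp [set_ne_pt.symm]
      have h2 : {S | set S ∈ τ \ {set T} ∧ ∃ s, IsFirst (τ \ {set T}) s ∧ s ∉ S.finset} ⊆
          {S | set S ∈ τ ∧ ∃ s, IsFirst τ s ∧ s ∉ S.finset} := by
        rw [isFirst_erase]
        exact fun S hS ↦ ⟨hS.1.1, hS.2⟩
      by_cases hk : s ∈ T.finset
      · left
        have : toggle (τ \ {set T}) = toggle τ := by
          rw [toggle_eq hs, toggle_eq ht]
          refine congr_arg _ (toggleAt_congr fun S hS ↦ ?_)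
          simp only [Set.mem_sdiff, Set.mem_singleton_iff, and_iff_left_iff_imp]
          intro _ h
          exact hS (set_injective h ▸ hk)
        rw [this, h1, Prod.Lex.toLex_le_toLex']
        exact ⟨⟨hv, hwv.symm⟩, le_rfl, fun _ ↦ Set.ncard_le_ncard h2 (Set.toFinite _)⟩
      · by_cases hv' : toggle (τ \ {set T}) ∈ τ \ {set T}
        · left
          rw [h1, Prod.Lex.toLex_le_toLex']
          exact ⟨hv', le_rfl, fun _ ↦ Set.ncard_le_ncard h2 (Set.toFinite _)⟩
        · refine Or.inr ⟨hv', ?_⟩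
          rw [toggle_eq ht, isFirst_insert]
          have h3 : {x | pt x ∈ insert (set (toggleAt (τ \ {set T}) s)) (τ \ {set T})} =
              {x | pt x ∈ τ} := by
            ext x; simp [set_ne_pt.symm]
          rw [h3, Prod.Lex.toLex_lt_toLex']
          refine ⟨le_rfl, fun _ ↦ Set.ncard_lt_ncard ⟨?_, fun h ↦ ?_⟩ (Set.toFinite _)⟩
          · rintro S ⟨h4 | hS, s', hs', hkS⟩
            · obtain rfl := hs'.unique ht
              exact (hkS (set_injective h4 ▸ mem_toggleAt.2 (Or.inl rfl))).elim
            · exact h2 ⟨hS, s', hs', hkS⟩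
          · obtain ⟨h4 | h', -⟩ := h ⟨hw, s, hs, hk⟩
            · exact hk (set_injective h4 ▸ mem_toggleAt.2 (Or.inl rfl))
            · exact h'.2 rfl
    | h₂ x =>
      right
      obtain ⟨R, hR, hxR⟩ := hcov x
      -- Only the first point can be deleted without entering `boundaryChains`: an element `x > s`
      -- occurs in no set of the chain, so deleting the point `x` would uncover it. The new first
      -- point `t` then lies in no set, so its toggle element is absent, and inserting it gives a
      -- chain with fewer points.
      have hst : s < t := by
        have hst' : s ≤ t := hs.2 ht.1.1
        refine lt_of_le_of_ne hst' ?_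
        rintro rfl
        induction R using LastVertexCylinder.cases with
        | h₁ R =>
          have h1 : x ≤ s := le_of_isFirst hτ hs hR.1 x hxR
          exact ht.1.2 (congr_arg pt (le_antisymm (hs.2 hw) h1))
        | h₂ y => exact hR.2 (congr_arg pt (mem_support_pt.1 hxR).symm)
      have hnot : ∀ S, set S ∈ τ → t ∉ S.finset := fun S hS h ↦
        (le_of_isFirst hτ hs hS t h).not_gt hst
      rw [toggle_eq ht]
      refine ⟨fun h ↦ hnot _ h.1 (mem_toggleAt.2 (Or.inl rfl)), ?_⟩
      rw [Prod.Lex.toLex_lt_toLex]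
      refine Or.inl (Set.ncard_lt_ncard ⟨?_, fun h ↦ ?_⟩ (Set.toFinite _))
      · rintro y (hy | hy)
        · exact (set_ne_pt hy.symm).elim
        · exact hy.1
      · obtain h' | h' := h hw
        · exact set_ne_pt h'.symm
        · exact h'.2 rfl

end LastVertexCylinder

end

end LocalLift

namespace LocalLift

section

/-! ### Simplices of subdivided simplices -/

open PartialOrder (NonemptyFiniteChains)

/-- The partially ordered set of nonempty subsets of `{0, ..., n}`. -/
abbrev Faces (n : SimplexCategory) : Type u := NonemptyFiniteChains (ULift.{u} (Fin (n.len + 1)))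

variable {n m : SimplexCategory} {d e : SimplexCategoryᵒᵖ}

/-- The vertices of a simplex of the subdivision of `Δ[n]`. -/
abbrev sdVertex (s : (SimplexCategory.sd.{u}.obj n).obj d) (i : Fin (d.unop.len + 1)) :
    Faces.{u} n :=
  ((s : ComposableArrows (Faces.{u} n) d.unop.len)).obj i

theorem sdVertex_mono (s : (SimplexCategory.sd.{u}.obj n).obj d) : Monotone (sdVertex s) :=
  (s : ComposableArrows (Faces.{u} n) d.unop.len).monotone

theorem sd_ext {s t : (SimplexCategory.sd.{u}.obj n).obj d}
    (h : ∀ i, sdVertex s i = sdVertex t i) : s = t := by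
  have : (s : (nerve (Faces.{u} n)).obj d) = t := nerve.ext_of_isThin (funext h)
  exact this

theorem mem_sdVertex_map (φ : n ⟶ m) (s : (SimplexCategory.sd.{u}.obj n).obj d)
    (i : Fin (d.unop.len + 1)) (y : ULift.{u} (Fin (m.len + 1))) :
    y ∈ (sdVertex ((SimplexCategory.sd.map φ).app d s) i).finset ↔
      ∃ x ∈ (sdVertex s i).finset, ULift.up (φ.toOrderHom x.down) = y :=
  NonemptyFiniteChains.mem_map_iff _ _ y

/-- The simplex of the subdivision of `Δ[n]` with given vertices. -/
def sdMk (f : Fin (d.unop.len + 1) → Faces.{u} n) (hf : Monotone f) :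
    (SimplexCategory.sd.{u}.obj n).obj d :=
  show ComposableArrows (Faces.{u} n) d.unop.len from hf.functor

theorem exists_hom_of_face (S : Faces.{u} n) :
    ∃ (m : SimplexCategory) (ε : m ⟶ n), Function.Injective ε.toOrderHom ∧
      ∀ i, ULift.up i ∈ S.finset ↔ i ∈ Set.range ε.toOrderHom := by
  obtain ⟨k, hk⟩ : ∃ k, (S.finset.map Equiv.ulift.toEmbedding).card = k + 1 :=
    Nat.exists_eq_succ_of_ne_zero (by simpa using S.nonempty.ne_empty)
  let ε := (S.finset.map Equiv.ulift.toEmbedding).orderEmbOfFin hk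
  refine ⟨⦋k⦌, SimplexCategory.Hom.mk ε.toOrderHom, ε.injective, fun i ↦ ?_⟩
  have : Set.range ε = (S.finset.map Equiv.ulift.toEmbedding : Finset (Fin (n.len + 1))) :=
    Finset.range_orderEmbOfFin _ hk
  change _ ↔ i ∈ Set.range ε
  rw [this]
  simp

theorem exists_factor {k : SimplexCategory} {ε : m ⟶ n}
    (hε : Function.Injective ε.toOrderHom) (φ : k ⟶ n)
    (h : ∀ i, φ.toOrderHom i ∈ Set.range ε.toOrderHom) : ∃ ψ : k ⟶ m, ψ ≫ ε = φ := by
  choose f hf using h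
  have hs : StrictMono ε.toOrderHom := ε.toOrderHom.monotone.strictMono_of_injective hε
  refine ⟨SimplexCategory.Hom.mk ⟨f, fun a b hab ↦ ?_⟩, ?_⟩
  · rw [← hs.le_iff_le, hf, hf]
    exact φ.toOrderHom.monotone hab
  · exact SimplexCategory.Hom.ext _ _ (OrderHom.ext _ _ (funext hf))

theorem sd_map_injective {ε : m ⟶ n} (hε : Function.Injective ε.toOrderHom) :
    Function.Injective ((SimplexCategory.sd.{u}.map ε).app d) := by
  intro s t hst
  have key : ∀ s t : (SimplexCategory.sd.{u}.obj m).obj d,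
      (SimplexCategory.sd.map ε).app d s = (SimplexCategory.sd.map ε).app d t →
      ∀ i, (sdVertex s i).finset ⊆ (sdVertex t i).finset := by
    intro s t hst i x hx
    have := (mem_sdVertex_map ε s i _).2 ⟨x, hx, rfl⟩
    rw [hst] at this
    obtain ⟨y, hy, hxy⟩ := (mem_sdVertex_map ε t i _).1 this
    have h := hε (ULift.up_injective hxy)
    rwa [← ULift.down_injective h]
  exact sd_ext fun i ↦ NonemptyFiniteChains.ext
    (Finset.Subset.antisymm (key s t hst i) (key t s hst.symm i))

open Classical in
theorem exists_sd_map_eq {ε : m ⟶ n}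
    (s : (SimplexCategory.sd.{u}.obj n).obj d)
    (h : ∀ i, ∀ x ∈ (sdVertex s i).finset, x.down ∈ Set.range ε.toOrderHom) :
    ∃ t, (SimplexCategory.sd.map ε).app d t = s := by
  let f (i : Fin (d.unop.len + 1)) : Faces.{u} m :=
    chainOfSet {x | ULift.up (ε.toOrderHom x.down) ∈ (sdVertex s i).finset} (by
      obtain ⟨x, hx⟩ := (sdVertex s i).nonempty
      obtain ⟨y, hy⟩ := h i x hx
      exact ⟨ULift.up y, by rw [Set.mem_ofPred_eq, hy]; exact hx⟩)
  have hf (i) (x) : x ∈ (f i).finset ↔ ULift.up (ε.toOrderHom x.down) ∈ (sdVertex s i).finset :=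
    mem_chainOfSet
  refine ⟨sdMk f fun i j hij x hx ↦ ?_, ?_⟩
  · exact (hf _ _).2 (sdVertex_mono s hij ((hf _ _).1 hx))
  · refine sd_ext fun i ↦ NonemptyFiniteChains.ext (Finset.ext fun y ↦ ?_)
    refine (mem_sdVertex_map _ _ _ _).trans ?_
    constructor
    · rintro ⟨x, hx, rfl⟩
      exact (hf _ _).1 hx
    · intro hy
      obtain ⟨x, hx⟩ := h i y hy
      exact ⟨ULift.up x, (hf _ _).2 (by rw [hx]; exact hy),
        ULift.down_injective hx⟩

/-! ### Subdivision of subcomplexes of a simplex and maps to `Ex` -/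

/-- The simplex of `Δ[n]` given by a map in the simplex category. -/
abbrev simplexOf (φ : m ⟶ n) : (SSet.stdSimplex.{u}.obj n).obj (op m) :=
  SSet.stdSimplex.objEquiv.symm φ

/-- The subdivision of a subcomplex of `Δ[n]`, as a subcomplex of the subdivision of `Δ[n]`. -/
def sdSub (A : (SSet.stdSimplex.{u}.obj n).Subcomplex) :
    (SimplexCategory.sd.{u}.obj n).Subcomplex where
  obj _ := {s | ∀ i (m : SimplexCategory) (φ : m ⟶ n),
    (∀ j, ULift.up (φ.toOrderHom j) ∈ (sdVertex s i).finset) → simplexOf φ ∈ A.obj (op m)}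
  map g _ hs i := hs (g.unop.toOrderHom i)

theorem sd_map_mem_sdSub {A : (SSet.stdSimplex.{u}.obj n).Subcomplex} {φ : m ⟶ n}
    (h : simplexOf φ ∈ A.obj (op m)) (s : (SimplexCategory.sd.{u}.obj m).obj d) :
    (SimplexCategory.sd.map φ).app d s ∈ (sdSub A).obj d := by
  intro i k ψ hψ
  obtain ⟨r, ε, hε, hε'⟩ := exists_hom_of_face (sdVertex s i)
  have h' : ∀ j, ∃ x, φ.toOrderHom x = ψ.toOrderHom j := fun j ↦ by
    obtain ⟨x, -, hx⟩ := (mem_sdVertex_map φ s i _).1 (hψ j)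
    exact ⟨x.down, ULift.up_injective hx⟩
  -- The least preimage under `φ` is a monotone choice, so `ψ`, whose values are all values of `φ`,
  -- factors through `φ` in the simplex category.
  let f (j : Fin (k.len + 1)) : Fin (m.len + 1) :=
    (Finset.univ.filter fun x ↦ φ.toOrderHom x = ψ.toOrderHom j).min'
      (by obtain ⟨x, hx⟩ := h' j; exact ⟨x, by simpa using hx⟩)
  have hf (j) : φ.toOrderHom (f j) = ψ.toOrderHom j := by
    have := Finset.min'_mem (Finset.univ.filter fun x ↦ φ.toOrderHom x = ψ.toOrderHom j)
      (by obtain ⟨x, hx⟩ := h' j; exact ⟨x, by simpa using hx⟩)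
    simpa using this
  have hmono : Monotone f := by
    intro a b hab
    by_contra! hlt
    have h1 := φ.toOrderHom.monotone hlt.le
    rw [hf, hf] at h1
    have h2 := le_antisymm (ψ.toOrderHom.monotone hab) h1
    simp only [f, h2] at hlt
    exact lt_irrefl _ hlt
  have : SimplexCategory.Hom.mk ⟨f, hmono⟩ ≫ φ = ψ :=
    SimplexCategory.Hom.ext _ _ (OrderHom.ext _ _ (funext hf))
  rw [← this]
  exact A.map (Quiver.Hom.op (SimplexCategory.Hom.mk ⟨f, hmono⟩ : k ⟶ m)) h

/-- The vertices of a simplex of the subdivision increase, so the whole simplex lies in the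
subdivision of the face given by its last vertex. -/
theorem exists_sd_map_of_mem_sdSub {A : (SSet.stdSimplex.{u}.obj n).Subcomplex}
    {s : (SimplexCategory.sd.{u}.obj n).obj d} (hs : s ∈ (sdSub A).obj d) :
    ∃ (m : SimplexCategory) (ε : m ⟶ n) (_ : simplexOf ε ∈ A.obj (op m))
      (t : (SimplexCategory.sd.{u}.obj m).obj d), (SimplexCategory.sd.map ε).app d t = s := by
  obtain ⟨m, ε, hε, hε'⟩ := exists_hom_of_face (sdVertex s (Fin.last _))
  obtain ⟨t, ht⟩ := exists_sd_map_eq s fun i x hx ↦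
    (hε' _).1 (sdVertex_mono s (Fin.le_last i) hx)
  exact ⟨m, ε, hs (Fin.last _) m ε fun j ↦ (hε' _).2 ⟨j, rfl⟩, t, ht⟩

variable {Z : SSet.{u}} {A : (SSet.stdSimplex.{u}.obj n).Subcomplex}

/-- The map `sd Δ[m] ⟶ Z` corresponding to the image of a simplex under a map to `Ex Z`. -/
abbrev exApp (f : (A : SSet.{u}) ⟶ SSet.ex.obj Z) {φ : m ⟶ n} (h : simplexOf φ ∈ A.obj (op m)) :
    SimplexCategory.sd.obj m ⟶ Z :=
  ULift.down (f.app (op m) ⟨simplexOf φ, h⟩)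

theorem exApp_comp (f : (A : SSet.{u}) ⟶ SSet.ex.obj Z) {k : SimplexCategory} (ψ : k ⟶ m)
    {φ : m ⟶ n} (h : simplexOf φ ∈ A.obj (op m)) (h' : simplexOf (ψ ≫ φ) ∈ A.obj (op k)) :
    exApp f h' = SimplexCategory.sd.map ψ ≫ exApp f h :=
  congr_arg ULift.down (ConcreteCategory.congr_hom (f.naturality ψ.op) ⟨simplexOf φ, h⟩)

/-- This is the well-definedness needed to glue the maps `exApp f` along the simplices of `A`. The
last vertex of the common image is the image of an injective `ε`; both values are compared with
`exApp` at `ε`, and `SimplexCategory.sd.map ε` is injective. -/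
theorem exApp_app_eq (f : (A : SSet.{u}) ⟶ SSet.ex.obj Z) {m' : SimplexCategory} {φ : m ⟶ n}
    (h : simplexOf φ ∈ A.obj (op m)) {φ' : m' ⟶ n} (h' : simplexOf φ' ∈ A.obj (op m'))
    (s : (SimplexCategory.sd.{u}.obj m).obj d) (s' : (SimplexCategory.sd.{u}.obj m').obj d)
    (hs : (SimplexCategory.sd.map φ).app d s = (SimplexCategory.sd.map φ').app d s') :
    (exApp f h).app d s = (exApp f h').app d s' := by
  obtain ⟨r, ε, hε, hε'⟩ :=
    exists_hom_of_face (sdVertex ((SimplexCategory.sd.map φ).app d s) (Fin.last _))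
  have key : ∀ (m : SimplexCategory) (φ : m ⟶ n) (h : simplexOf φ ∈ A.obj (op m))
      (s : (SimplexCategory.sd.{u}.obj m).obj d),
      (∀ i, ULift.up i ∈ (sdVertex ((SimplexCategory.sd.map φ).app d s) (Fin.last _)).finset ↔
        i ∈ Set.range ε.toOrderHom) →
      ∃ (t : (SimplexCategory.sd.{u}.obj r).obj d) (h' : simplexOf ε ∈ A.obj (op r)),
        (SimplexCategory.sd.map ε).app d t = (SimplexCategory.sd.map φ).app d s ∧
        (exApp f h).app d s = (exApp f h').app d t := by
    intro m φ h s hs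
    have hεA : simplexOf ε ∈ A.obj (op r) :=
      sd_map_mem_sdSub h s (Fin.last _) _ ε fun j ↦ (hs _).2 ⟨j, rfl⟩
    obtain ⟨k, δ, hδ, hδ'⟩ := exists_hom_of_face (sdVertex s (Fin.last _))
    obtain ⟨s, rfl⟩ := exists_sd_map_eq s fun i x hx ↦
      (hδ' _).1 (sdVertex_mono s (Fin.le_last i) hx)
    obtain ⟨ψ, hψ⟩ := exists_factor hε (δ ≫ φ) (fun i ↦ (hs _).1 ((mem_sdVertex_map _ _ _ _).2
      ⟨ULift.up (δ.toOrderHom i), (hδ' _).2 ⟨i, rfl⟩, rfl⟩))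
    have h₁ : simplexOf (δ ≫ φ) ∈ A.obj (op k) := A.map δ.op h
    have h₂ : simplexOf (ψ ≫ ε) ∈ A.obj (op k) := A.map ψ.op hεA
    refine ⟨(SimplexCategory.sd.map ψ).app d s, hεA, ?_, ?_⟩
    · have := congr_arg (fun g ↦ (SimplexCategory.sd.{u}.map g).app d s) hψ
      rw [Functor.map_comp, Functor.map_comp] at this
      exact this
    · have e₁ := exApp_comp f δ h h₁
      have e₂ := exApp_comp f ψ hεA h₂
      have e₃ : exApp f h₁ = exApp f h₂ := by simp only [hψ]
      rw [e₁, e₂] at e₃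
      exact congr_arg (fun g : SimplexCategory.sd.obj k ⟶ Z ↦ g.app d s) e₃
  obtain ⟨t, hε₁, h₁, h₂⟩ := key m φ h s hε'
  obtain ⟨t', hε₂, h₃, h₄⟩ := key m' φ' h' s' (by rwa [← hs])
  rw [h₂, h₄]
  rw [sd_map_injective hε (h₁.trans (hs.trans h₃.symm))]

/-- A map from a subcomplex `A` of `Δ[n]` to `Ex Z` induces a map from the subdivision of `A`
to `Z`. -/
theorem exists_sdSub_hom (f : (A : SSet.{u}) ⟶ SSet.ex.obj Z) :
    ∃ g : (sdSub A : SSet.{u}) ⟶ Z, ∀ ⦃m : SimplexCategory⦄ (φ : m ⟶ n)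
      (h : simplexOf φ ∈ A.obj (op m)) (d : SimplexCategoryᵒᵖ)
      (s : (SimplexCategory.sd.{u}.obj m).obj d),
      g.app d ⟨(SimplexCategory.sd.map φ).app d s, sd_map_mem_sdSub h s⟩ =
        (exApp f h).app d s := by
  choose m ε hε t ht using fun (d : SimplexCategoryᵒᵖ) (s : (sdSub A).obj d) ↦
    exists_sd_map_of_mem_sdSub s.2
  refine ⟨{ app := fun d ↦ ↾fun s ↦ (exApp f (hε d s)).app d (t d s), naturality := ?_ }, ?_⟩
  · intro d e g
    ext s
    refine Eq.trans ?_ (ConcreteCategory.congr_hom ((exApp f (hε d s)).naturality g) (t d s))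
    refine exApp_app_eq f _ _ _ _ ?_
    refine (ht _ _).trans ?_
    refine Eq.trans ?_ (ConcreteCategory.congr_hom
      ((SimplexCategory.sd.map (ε d s)).naturality g) (t d s)).symm
    exact congr_arg ((SimplexCategory.sd.obj n).map g) (ht d s).symm
  · intro m φ h d s
    exact exApp_app_eq f _ _ _ _ (ht _ _)

end

end LocalLift

namespace LocalLift

section

/-! ### Local liftings for `Ex` and `Ex^∞` -/

open PartialOrder (NonemptyFiniteChains)

instance finite_nerve {Q : Type u} [PartialOrder Q] [Finite Q] : SSet.Finite (nerve Q) := by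
  have : (nerve Q).HasDimensionLT (Nat.card Q) := by
    refine ⟨fun n hn ↦ Set.eq_univ_iff_forall.2 fun s ↦ ?_⟩
    by_contra hs
    rw [SSet.mem_degenerate_iff_notMem_nonDegenerate, not_not,
      PartialOrder.mem_nerve_nonDegenerate_iff_injective] at hs
    have := Nat.card_le_card_of_injective _ hs
    rw [Nat.card_fin] at this
    lia
  refine SSet.finite_of_hasDimensionLT _ (Nat.card Q) fun i _ ↦ ?_
  exact Finite.of_injective (β := Fin (i + 1) → Q) (fun s ↦ s.1.obj)
    fun s t h ↦ Subtype.ext (nerve.ext_of_isThin h)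

instance finite_sd (n : SimplexCategory) : SSet.Finite (SimplexCategory.sd.{u}.obj n) :=
  inferInstanceAs (SSet.Finite (nerve (Faces.{u} n)))

variable {C : Type u} [SmallCategory C] {J : GrothendieckTopology C} {F G : Cᵒᵖ ⥤ SSet.{u}}
  {p : F ⟶ G}

theorem LocalRLP.ι_of_homOfLE {B : SSet.{u}} {A A' : B.Subcomplex} (h : A ≤ A') (h' : A' = ⊤)
    (hA : LocalRLP J (SSet.Subcomplex.homOfLE h) p) : LocalRLP J A.ι p := by
  subst h'
  exact hA.of_arrow_iso (Iso.refl _) (SSet.Subcomplex.topIso B) rfl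

theorem allChains_eq_top {Q : Type u} [PartialOrder Q] : chainSub (allChains Q) = ⊤ := by
  refine top_le_iff.1 fun d s _ ↦ ?_
  exact s.monotone.isChain_range

theorem mem_sdSub_horn {n : ℕ} {k : Fin (n + 2)} {d : SimplexCategoryᵒᵖ}
    {s : (SimplexCategory.sd.{u}.obj ⦋n + 1⦌).obj d} :
    s ∈ (sdSub (SSet.horn.{u} (n + 1) k)).obj d ↔
      ∃ i ≠ k, ∀ j, ULift.up i ∉ (sdVertex s j).finset := by
  constructor
  · intro h
    obtain ⟨m, ε, hε, hε'⟩ := exists_hom_of_face (sdVertex s (Fin.last _))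
    have := h (Fin.last _) m ε fun j ↦ (hε' _).2 ⟨j, rfl⟩
    induction m using SimplexCategory.rec with | _ m
    obtain ⟨i, hi, hi'⟩ := (SSet.mem_horn_iff_notMem_range _ _).1 this
    refine ⟨i, hi, fun j hj ↦ hi' ?_⟩
    exact (hε' i).1 (sdVertex_mono s (Fin.le_last j) hj)
  · rintro ⟨i, hi, h⟩ j m φ hφ
    induction m using SimplexCategory.rec with | _ m
    refine (SSet.mem_horn_iff_notMem_range _ _).2 ⟨i, hi, ?_⟩
    rintro ⟨l, rfl⟩
    exact h j (hφ l)

/-- The subdivided horn consists of the chains of faces in `hornChains`, and the subdivided simplex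
of all chains, so the matching by `hornToggle` applies. -/
theorem LocalRLP.sdSub_horn
    (hp : ∀ (n : ℕ) (k : Fin (n + 2)), LocalRLP J (SSet.horn.{u} (n + 1) k).ι p)
    (n : ℕ) (k : Fin (n + 2)) : LocalRLP J (sdSub (SSet.horn.{u} (n + 1) k)).ι p := by
  have : Nontrivial (ULift.{u} (Fin (⦋n + 1⦌.len + 1))) :=
    inferInstanceAs (Nontrivial (ULift.{u} (Fin (n + 2))))
  have h := LocalRLP.of_toggleMatching hp
    (hornToggle_toggleMatching (X := ULift.{u} (Fin (⦋n + 1⦌.len + 1))) (ULift.up k))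
  have e : (sdSub (SSet.horn.{u} (n + 1) k)) =
      chainSub (hornChains (X := ULift.{u} (Fin (⦋n + 1⦌.len + 1))) (ULift.up k)) := by
    ext d s
    refine mem_sdSub_horn.trans ?_
    constructor
    · rintro ⟨i, hi, h⟩
      refine ⟨(sdVertex_mono s).isChain_range, ULift.up i, fun h' ↦ hi (ULift.up_injective h'), ?_⟩
      rintro _ ⟨j, rfl⟩
      exact h j
    · rintro ⟨-, i, hi, h⟩
      exact ⟨i.down, fun h' ↦ hi (ULift.down_injective h'), fun j ↦ h _ ⟨j, rfl⟩⟩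
  have h₂ := LocalRLP.ι_of_homOfLE _ allChains_eq_top h
  rw [← e] at h₂
  exact h₂

/-- This is the adjunction between subdivision and `Ex`: squares from `A ⟶ Δ[n]` to `Ex p`
correspond to squares from `sd A ⟶ sd Δ[n]` to `p`. -/
theorem LocalRLP.ex {n : SimplexCategory} {A : (SSet.stdSimplex.{u}.obj n).Subcomplex}
    (hp : LocalRLP J (sdSub A).ι p) : LocalRLP J A.ι (Functor.whiskerRight p SSet.ex) := by
  intro X a b h
  obtain ⟨g, hg⟩ := exists_sdSub_hom a
  let b' : SimplexCategory.sd.obj n ⟶ G.obj (op X) := (SSet.yonedaEquiv b).down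
  have hb {m : SimplexCategory} (φ : m ⟶ n) :
      ULift.down (b.app (op m) (simplexOf φ)) = SimplexCategory.sd.map φ ≫ b' := by
    have := ConcreteCategory.congr_hom (b.naturality φ.op) (simplexOf (𝟙 n))
    refine Eq.trans (congr_arg (fun x ↦ ULift.down (b.app (op m) x)) ?_) (congr_arg ULift.down this)
    exact SSet.stdSimplex.objEquiv.injective (Category.comp_id φ).symm
  have hgb : g ≫ p.app (op X) = (sdSub A).ι ≫ b' := by
    ext d ⟨s, hs⟩
    obtain ⟨m, ε, hε, t, rfl⟩ := exists_sd_map_of_mem_sdSub hs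
    have h₁ : exApp a hε ≫ p.app (op X) = SimplexCategory.sd.map ε ≫ b' := by
      rw [← hb ε]
      exact congr_arg ULift.down (ConcreteCategory.congr_hom (congr_app h (op m)) ⟨_, hε⟩)
    refine (congr_arg ((p.app (op X)).app d) (hg ε hε d t)).trans ?_
    exact congr_arg (fun f : SimplexCategory.sd.obj m ⟶ G.obj (op X) ↦ f.app d t) h₁
  refine J.superset_covering ?_ (hp X g b' hgb)
  rintro U f ⟨l, hl₁, hl₂⟩
  refine ⟨SSet.yonedaEquiv.symm (ULift.up l), ?_, ?_⟩
  · ext ⟨m⟩ ⟨x, hx⟩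
    obtain ⟨φ, rfl⟩ := SSet.stdSimplex.objEquiv.symm.surjective x
    refine ULift.down_injective ?_
    change SimplexCategory.sd.map φ ≫ l = exApp a hx ≫ F.map f.op
    ext d s
    have h₁ := congr_arg ((F.map f.op).app d) (hg φ hx d s)
    exact (ConcreteCategory.congr_hom (congr_app hl₁ d)
      ⟨_, sd_map_mem_sdSub hx s⟩).trans h₁
  · refine SSet.yonedaEquiv.injective (ULift.down_injective ?_)
    change SimplexCategory.sd.map (𝟙 n) ≫ l ≫ p.app (op U) = _
    refine Eq.trans ?_ hl₂
    exact congr_arg (· ≫ l ≫ p.app (op U)) (SimplexCategory.sd.map_id n)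

theorem LocalRLP.ex_horn
    (hp : ∀ (n : ℕ) (k : Fin (n + 2)), LocalRLP J (SSet.horn.{u} (n + 1) k).ι p)
    (n : ℕ) (k : Fin (n + 2)) :
    LocalRLP J (SSet.horn.{u} (n + 1) k).ι (Functor.whiskerRight p SSet.ex) :=
  .ex (.sdSub_horn hp n k)

/-- Unlike for horns, no matching is needed: the subdivided boundary inclusion is a monomorphism of
finite simplicial sets. -/
theorem LocalRLP.ex_boundary (hp : ∀ n : ℕ, LocalRLP J (SSet.boundary.{u} n).ι p) (n : ℕ) :
    LocalRLP J (SSet.boundary.{u} n).ι (Functor.whiskerRight p SSet.ex) :=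
  .ex (.of_mono hp _)

theorem LocalRLP.exIter_horn
    (hp : ∀ (n : ℕ) (k : Fin (n + 2)), LocalRLP J (SSet.horn.{u} (n + 1) k).ι p)
    (m : ℕ) : ∀ (n : ℕ) (k : Fin (n + 2)),
    LocalRLP J (SSet.horn.{u} (n + 1) k).ι (Functor.whiskerRight p (exIter m)) := by
  induction m with
  | zero => exact hp
  | succ m ih => exact LocalRLP.ex_horn ih

theorem LocalRLP.exIter_boundary (hp : ∀ n : ℕ, LocalRLP J (SSet.boundary.{u} n).ι p)
    (m : ℕ) : ∀ n : ℕ, LocalRLP J (SSet.boundary.{u} n).ι (Functor.whiskerRight p (exIter m)) := by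
  induction m with
  | zero => exact hp
  | succ m ih => exact LocalRLP.ex_boundary ih

/-- By compactness both legs of a square come from a finite stage. There the square may commute only
after passing to the colimit, hence already at some later stage, where it can be lifted locally. -/
theorem LocalRLP.whiskerRight_of_isColimit {S : ℕ ⥤ SSet.{u} ⥤ SSet.{u}} {E : SSet.{u} ⥤ SSet.{u}}
    (t : ∀ m, S.obj m ⟶ E) (ht : ∀ {m n : ℕ} (h : m ⟶ n), S.map h ≫ t n = t m)
    {A B : SSet.{u}} {i : A ⟶ B}
    (hA : ∀ {K : SSet.{u}} (f : A ⟶ E.obj K), ∃ m g, f = g ≫ (t m).app K)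
    (hB : ∀ {K : SSet.{u}} (f : B ⟶ E.obj K), ∃ m g, f = g ≫ (t m).app K)
    (hA' : ∀ {K : SSet.{u}} {m} (f g : A ⟶ (S.obj m).obj K),
      f ≫ (t m).app K = g ≫ (t m).app K →
      ∃ (n : ℕ) (h : m ⟶ n), f ≫ (S.map h).app K = g ≫ (S.map h).app K)
    (h : ∀ m, LocalRLP J i (Functor.whiskerRight p (S.obj m))) :
    LocalRLP J i (Functor.whiskerRight p E) := by
  have ht' {K : SSet.{u}} {m n : ℕ} (h : m ⟶ n) :
      (S.map h).app K ≫ (t n).app K = (t m).app K := by rw [← NatTrans.comp_app, ht]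
  intro X a b hab
  obtain ⟨m₁, a, rfl⟩ := hA a
  obtain ⟨m₂, b, rfl⟩ := hB b
  let m := max m₁ m₂
  let u₁ : m₁ ⟶ m := homOfLE (le_max_left _ _)
  let u₂ : m₂ ⟶ m := homOfLE (le_max_right _ _)
  obtain ⟨a', ha'⟩ : ∃ a', a' = a ≫ (S.map u₁).app _ := ⟨_, rfl⟩
  obtain ⟨b', hb'⟩ : ∃ b', b' = b ≫ (S.map u₂).app _ := ⟨_, rfl⟩
  have ha : a ≫ (t m₁).app _ = a' ≫ (t m).app _ := by rw [ha', Category.assoc, ht']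
  have hb : b ≫ (t m₂).app _ = b' ≫ (t m).app _ := by rw [hb', Category.assoc, ht']
  simp only [ha, hb] at hab ⊢
  simp only [Functor.whiskerRight_app, Category.assoc, ← NatTrans.naturality] at hab
  obtain ⟨n, v, hv⟩ := hA' (a' ≫ (S.obj m).map (p.app (op X))) (i ≫ b') (by simpa using hab)
  have ha : a' ≫ (t m).app _ = (a' ≫ (S.map v).app _) ≫ (t n).app _ := by rw [Category.assoc, ht']
  have hb : b' ≫ (t m).app _ = (b' ≫ (S.map v).app _) ≫ (t n).app _ := by rw [Category.assoc, ht']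
  simp only [ha, hb]
  refine J.superset_covering ?_ (h n X (a' ≫ (S.map v).app _) (b' ≫ (S.map v).app _) (by
    simpa using hv))
  rintro U f ⟨l, h₁, h₂⟩
  refine ⟨l ≫ (t n).app _, ?_, ?_⟩
  · rw [reassoc_of% h₁]
    simp
  · simp only [Functor.whiskerRight_app, Category.assoc, Functor.comp_map] at h₂ ⊢
    rw [← NatTrans.naturality, reassoc_of% h₂, NatTrans.naturality]

/-- `Ex^∞ K` is a colimit. -/
noncomputable def isColimitExInfty (K : SSet.{u}) :
    Limits.IsColimit (((evaluation _ _).obj K).mapCocone (Limits.colimit.cocone exSequence.{u})) :=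
  Limits.isColimitOfPreserves _ (Limits.colimit.isColimit _)

/-- The map `Ex^m ⟶ Ex^n` for `m ≤ n`. -/
noncomputable def exMap {m n : ℕ} (h : m ⟶ n) : exIter.{u} m ⟶ exIter.{u} n := exSequence.map h

theorem exMap_id (m : ℕ) : exMap.{u} (𝟙 m) = 𝟙 _ := exSequence.map_id m

theorem exMap_comp {m n k : ℕ} (h : m ⟶ n) (h' : n ⟶ k) :
    exMap.{u} (h ≫ h') = exMap h ≫ exMap h' := exSequence.map_comp h h'

theorem exMap_succ (k : ℕ) : exMap.{u} (homOfLE (Nat.le_succ k)) =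
    Functor.whiskerLeft (exIter k) toEx :=
  Functor.ofSequence_map_homOfLE_succ (X := exIter.{u})
    (fun k ↦ Functor.whiskerLeft (exIter k) toEx) k

/-- The canonical map `Ex^m ⟶ Ex^∞`. -/
noncomputable def exι (m : ℕ) : exIter.{u} m ⟶ exInfty.{u} :=
  Limits.colimit.ι exSequence.{u} m

theorem exι_w {m n : ℕ} (h : m ⟶ n) : exMap.{u} h ≫ exι n = exι m :=
  Limits.colimit.w exSequence.{u} h

theorem exι_w_app {m n : ℕ} (h : m ⟶ n) (K : SSet.{u}) :
    (exMap.{u} h).app K ≫ (exι n).app K = (exι m).app K :=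
  congr_app (exι_w h) K

theorem exists_exι {A K : SSet.{u}} [A.Finite] (f : A ⟶ exInfty.obj K) :
    ∃ (m : ℕ) (g : A ⟶ (exIter m).obj K), f = g ≫ (exι m).app K := by
  obtain ⟨m, g, h⟩ := exists_hom_of_isColimit_nat (isColimitExInfty K) f
  exact ⟨m, g, h.symm⟩

theorem exists_exι_eq {A K : SSet.{u}} [A.Finite] {m : ℕ} (f g : A ⟶ (exIter m).obj K)
    (h : f ≫ (exι m).app K = g ≫ (exι m).app K) :
    ∃ (n : ℕ) (h : m ⟶ n), f ≫ (exMap h).app K = g ≫ (exMap h).app K := by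
  obtain ⟨n, hn, hn'⟩ := exists_eq_of_isColimit_nat (isColimitExInfty K) f g h
  exact ⟨n, homOfLE hn, hn'⟩

theorem LocalRLP.exInfty {A B : SSet.{u}} [A.Finite] [B.Finite] {i : A ⟶ B}
    (h : ∀ m, LocalRLP J i (Functor.whiskerRight p (exIter m))) :
    LocalRLP J i (Functor.whiskerRight p LocalLift.exInfty) :=
  .whiskerRight_of_isColimit (S := exSequence) exι exι_w exists_exι exists_exι exists_exι_eq h

theorem LocalRLP.exInfty_horn
    (hp : ∀ (n : ℕ) (k : Fin (n + 2)), LocalRLP J (SSet.horn.{u} (n + 1) k).ι p)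
    (n : ℕ) (k : Fin (n + 2)) :
    LocalRLP J (SSet.horn.{u} (n + 1) k).ι (Functor.whiskerRight p LocalLift.exInfty) :=
  .exInfty fun m ↦ exIter_horn hp m n k

theorem LocalRLP.exInfty_boundary (hp : ∀ n : ℕ, LocalRLP J (SSet.boundary.{u} n).ι p) (n : ℕ) :
    LocalRLP J (SSet.boundary.{u} n).ι (Functor.whiskerRight p LocalLift.exInfty) :=
  .exInfty fun m ↦ exIter_boundary hp m n

end

end LocalLift

namespace LocalLift

/-! ### Descent of liftings along `K ⟶ Ex K` and `K ⟶ Ex^∞ K`. -/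

section

open PartialOrder (NonemptyFiniteChains)

theorem exists_glue {Y Z : SSet.{u}} {A B D : Y.Subcomplex} (hD : A ⊔ B = D)
    (f : (A : SSet.{u}) ⟶ Z) (g : (B : SSet.{u}) ⟶ Z)
    (h : ∀ (d : SimplexCategoryᵒᵖ) (x : Y.obj d) (hA : x ∈ A.obj d) (hB : x ∈ B.obj d),
      f.app d ⟨x, hA⟩ = g.app d ⟨x, hB⟩) :
    ∃ w : (D : SSet.{u}) ⟶ Z,
      SSet.Subcomplex.homOfLE (show A ≤ D from hD ▸ le_sup_left) ≫ w = f ∧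
      SSet.Subcomplex.homOfLE (show B ≤ D from hD ▸ le_sup_right) ≫ w = g := by
  have sq : SSet.Subcomplex.BicartSq (A ⊓ B) A B D := ⟨hD, rfl⟩
  refine ⟨sq.isPushout.desc f g ?_, sq.isPushout.inl_desc _ _ _, sq.isPushout.inr_desc _ _ _⟩
  ext d ⟨x, hA, hB⟩
  exact h d x hA hB

theorem glue_hom_ext {Y Z : SSet.{u}} {A B D : Y.Subcomplex} (hD : A ⊔ B = D)
    {f g : (D : SSet.{u}) ⟶ Z}
    (hA : SSet.Subcomplex.homOfLE (show A ≤ D from hD ▸ le_sup_left) ≫ f =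
      SSet.Subcomplex.homOfLE (show A ≤ D from hD ▸ le_sup_left) ≫ g)
    (hB : SSet.Subcomplex.homOfLE (show B ≤ D from hD ▸ le_sup_right) ≫ f =
      SSet.Subcomplex.homOfLE (show B ≤ D from hD ▸ le_sup_right) ≫ g) : f = g :=
  have sq : SSet.Subcomplex.BicartSq (A ⊓ B) A B D := ⟨hD, rfl⟩
  sq.isPushout.hom_ext hA hB

theorem mem_sdSub_boundary {n : ℕ} {d : SimplexCategoryᵒᵖ}
    {s : (SimplexCategory.sd.{u}.obj ⦋n⦌).obj d} :
    s ∈ (sdSub (SSet.boundary.{u} n)).obj d ↔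
      ∃ i : Fin (n + 1), ∀ j, ULift.up i ∉ (sdVertex s j).finset := by
  constructor
  · intro h
    obtain ⟨m, ε, hε, hε'⟩ := exists_hom_of_face (sdVertex s (Fin.last _))
    have := h (Fin.last _) m ε fun j ↦ (hε' _).2 ⟨j, rfl⟩
    induction m using SimplexCategory.rec with | _ m
    obtain ⟨i, hi'⟩ := (SSet.mem_boundary_iff_notMem_range _).1 this
    refine ⟨i, fun j hj ↦ hi' ?_⟩
    exact (hε' i).1 (sdVertex_mono s (Fin.le_last j) hj)
  · rintro ⟨i, h⟩ j m φ hφ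
    induction m using SimplexCategory.rec with | _ m
    refine (SSet.mem_boundary_iff_notMem_range _).2 ⟨i, ?_⟩
    rintro ⟨l, rfl⟩
    exact h j (hφ l)

/-! ### The mapping cylinder of `sd Δ[n] ⟶ Δ[n]` -/

/-- The partially ordered set whose nerve is the mapping cylinder of `sd Δ[n] ⟶ Δ[n]`. -/
abbrev CylSet (n : ℕ) : Type u := LastVertexCylinder (ULift.{u} (Fin (n + 1)))

theorem up_chainMax_mem {n : SimplexCategory} (S : Faces.{u} n) :
    ULift.up (chainMax S) ∈ S.finset := by
  obtain ⟨x, hx, hx'⟩ := Finset.mem_image.1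
    (Finset.max'_mem (S.finset.image ULift.down) (S.nonempty.image _))
  rwa [chainMax, ← hx']

/-- The projection of the mapping cylinder. -/
def cylProjFun (n : ℕ) : CylSet.{u} n →o Fin (n + 1) where
  toFun := Sum.elim (chainMax (n := ⦋n⦌)) ULift.down
  monotone' x y h := by
    induction x using LastVertexCylinder.cases with
    | h₁ S =>
      induction y using LastVertexCylinder.cases with
      | h₁ T => exact chainMax_mono (LastVertexCylinder.set_le_set.1 h)
      | h₂ y => exact LastVertexCylinder.set_le_pt.1 h _ (up_chainMax_mem (n := ⦋n⦌) S)
    | h₂ x =>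
      induction y using LastVertexCylinder.cases with
      | h₁ T => exact (LastVertexCylinder.not_pt_le_set h).elim
      | h₂ y =>
        have : x ≤ y := LastVertexCylinder.pt_le_pt.1 h
        exact this

theorem cylProjFun_mem_support {n : ℕ} (x : CylSet.{u} n) :
    ULift.up (cylProjFun n x) ∈ x.support := by
  induction x using LastVertexCylinder.cases with
  | h₁ S => exact up_chainMax_mem (n := ⦋n⦌) S
  | h₂ x => rfl

/-- The projection of the mapping cylinder. -/
def cylProj (n : ℕ) : nerve (CylSet.{u} n) ⟶ Δ[n] where
  app _ := ↾fun s ↦ SSet.stdSimplex.objEquiv.symm (SimplexCategory.Hom.mk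
    { toFun := fun i ↦ cylProjFun n (s.obj i)
      monotone' := (cylProjFun n).monotone.comp s.monotone })
  naturality _ _ _ := rfl

/-- The inclusion of the source of the mapping cylinder. -/
def cylSource (n : ℕ) : SimplexCategory.sd.{u}.obj ⦋n⦌ ⟶ nerve (CylSet.{u} n) where
  app _ := ↾fun s ↦ Monotone.functor (f := fun i ↦ LastVertexCylinder.set (sdVertex s i))
    fun _ _ h ↦ LastVertexCylinder.set_le_set.2 (sdVertex_mono s h)
  naturality _ _ _ := rfl

/-- The inclusion of the target of the mapping cylinder. -/
def cylTarget (n : ℕ) : Δ[n] ⟶ nerve (CylSet.{u} n) where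
  app _ := ↾fun s ↦ Monotone.functor
    (f := fun i ↦ LastVertexCylinder.pt
      (ULift.up ((SSet.stdSimplex.objEquiv s).toOrderHom i)))
    fun _ _ h ↦ LastVertexCylinder.pt_le_pt.2 ((SSet.stdSimplex.objEquiv s).toOrderHom.monotone h)
  naturality _ _ _ := rfl

theorem cylTarget_proj (n : ℕ) : cylTarget.{u} n ≫ cylProj n = 𝟙 _ := by
  ext d s
  exact SSet.stdSimplex.objEquiv.injective (SimplexCategory.Hom.ext _ _ (OrderHom.ext _ _ rfl))

instance (n : ℕ) : Mono (cylSource.{u} n) := by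
  refine (NatTrans.mono_iff_mono_app _).2 fun d ↦ (mono_iff_injective _).2 fun s t h ↦ sd_ext ?_
  intro i
  exact LastVertexCylinder.set_injective
    (congr_arg (fun s : (nerve (CylSet.{u} n)).obj d ↦ s.obj i) h)

/-- The chains of the cylinder whose elements all miss a common element. -/
def cylBoundary (n : ℕ) : LowerSet (Set (CylSet.{u} n)) where
  carrier := {σ | ∃ i, ∀ S ∈ σ, i ∉ S.support}
  lower' _ _ h := fun ⟨i, hi⟩ ↦ ⟨i, fun S hS ↦ hi S (h hS)⟩

theorem cylProj_mem_boundary {n : ℕ} {d : SimplexCategoryᵒᵖ} {s : (nerve (CylSet.{u} n)).obj d}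
    (hs : s ∈ (chainSub (cylBoundary n)).obj d) :
    (cylProj n).app d s ∈ (SSet.boundary.{u} n).obj d := by
  obtain ⟨d⟩ := d
  induction d using SimplexCategory.rec with | _ d
  obtain ⟨i, hi⟩ := hs
  refine (SSet.mem_boundary_iff_notMem_range _).2 ⟨i.down, ?_⟩
  rintro ⟨j, hj⟩
  refine hi _ ⟨j, rfl⟩ ?_
  have : i = ULift.up (cylProjFun n (s.obj j)) := ULift.down_injective hj.symm
  rw [this]
  exact cylProjFun_mem_support _

theorem cylTarget_mem_boundary {n : ℕ} {d : SimplexCategoryᵒᵖ} {s : Δ[n].obj d}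
    (hs : s ∈ (SSet.boundary.{u} n).obj d) :
    (cylTarget n).app d s ∈ (chainSub (cylBoundary n)).obj d := by
  obtain ⟨d⟩ := d
  induction d using SimplexCategory.rec with | _ d
  obtain ⟨i, hi⟩ := (SSet.mem_boundary_iff_notMem_range _).1 hs
  refine ⟨ULift.up i, ?_⟩
  rintro _ ⟨j, rfl⟩ h
  exact hi ⟨j, (congr_arg ULift.down h).symm⟩

theorem chainSub_boundaryChains (n : ℕ) :
    SSet.Subcomplex.range (cylSource.{u} n) ⊔ chainSub (cylBoundary n) =
      chainSub (LastVertexCylinder.boundaryChains (ULift.{u} (Fin (n + 1)))) := by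
  apply le_antisymm
  · refine sup_le ?_ ?_
    · rintro d _ ⟨s, rfl⟩
      refine ⟨Monotone.isChain_range (Functor.monotone _), Or.inl ?_⟩
      rintro x ⟨j, hj⟩
      exact LastVertexCylinder.set_ne_pt hj
    · rintro d s hs
      exact ⟨s.monotone.isChain_range, Or.inr hs⟩
  · rintro d s ⟨-, hs | hs⟩
    · left
      have : ∀ j, ∃ S, LastVertexCylinder.set S = s.obj j := by
        intro j
        obtain ⟨q, hq⟩ : ∃ q, q = s.obj j := ⟨_, rfl⟩
        induction q using LastVertexCylinder.cases with
        | h₁ S => exact ⟨S, hq⟩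
        | h₂ x => exact (hs x ⟨j, hq.symm⟩).elim
      choose S hS using this
      refine ⟨sdMk (n := ⦋n⦌) S fun i j hij ↦ ?_, nerve.ext_of_isThin (funext hS)⟩
      rw [← LastVertexCylinder.set_le_set, hS, hS]
      exact s.monotone hij
    · exact Or.inr hs

variable {C : Type u} [SmallCategory C] {J : GrothendieckTopology C} {F G : Cᵒᵖ ⥤ SSet.{u}}
  {p : F ⟶ G}

/-- If a square has a lifting after applying `Ex`, then it has local liftings. -/
theorem liftSieve_boundary_mem_of_ex
    (hp : ∀ (n : ℕ) (k : Fin (n + 2)), LocalRLP J (SSet.horn.{u} (n + 1) k).ι p)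
    {n : ℕ} {X : C} {a : (SSet.boundary.{u} n : SSet.{u}) ⟶ F.obj (op X)}
    {b : Δ[n] ⟶ G.obj (op X)} (h : a ≫ p.app (op X) = (SSet.boundary n).ι ≫ b)
    (l : Δ[n] ⟶ SSet.ex.obj (F.obj (op X)))
    (h₁ : (SSet.boundary n).ι ≫ l = a ≫ toEx.app _)
    (h₂ : l ≫ SSet.ex.map (p.app (op X)) = b ≫ toEx.app _) :
    liftSieve (SSet.boundary n).ι p a b ∈ J X := by
  let l' : SimplexCategory.sd.obj ⦋n⦌ ⟶ F.obj (op X) := (SSet.yonedaEquiv l).down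
  have hl {m : SimplexCategory} (φ : m ⟶ ⦋n⦌) :
      ULift.down (l.app (op m) (simplexOf φ)) = SimplexCategory.sd.map φ ≫ l' := by
    have := ConcreteCategory.congr_hom (l.naturality φ.op) (simplexOf (𝟙 ⦋n⦌))
    refine Eq.trans (congr_arg (fun x ↦ ULift.down (l.app (op m) x)) ?_) (congr_arg ULift.down this)
    exact SSet.stdSimplex.objEquiv.injective (Category.comp_id φ).symm
  have hl₁ {m : SimplexCategory} (φ : m ⟶ ⦋n⦌) (hφ : simplexOf φ ∈ (SSet.boundary n).obj (op m)) :
      SimplexCategory.sd.map φ ≫ l' =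
        lastVertex m ≫ SSet.yonedaEquiv.symm (a.app (op m) ⟨_, hφ⟩) := by
    rw [← hl φ]
    exact congr_arg ULift.down (ConcreteCategory.congr_hom (congr_app h₁ (op m)) ⟨_, hφ⟩)
  have hl₂ : l' ≫ p.app (op X) = lastVertex ⦋n⦌ ≫ b := by
    have := congr_arg (fun g ↦ ULift.down (SSet.yonedaEquiv g)) h₂
    refine this.trans ?_
    change lastVertex ⦋n⦌ ≫ SSet.yonedaEquiv.symm (SSet.yonedaEquiv b) = _
    rw [Equiv.symm_apply_apply]
  -- A lifting after `Ex` is a map `l'` on `sd Δ[n]` that restricts on the subdivided boundary to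
  -- `a` composed with last vertex maps. It therefore glues with `a` composed with the projection of
  -- the cylinder over `∂Δ[n]`.
  let aT : (chainSub (cylBoundary.{u} n) : SSet.{u}) ⟶ F.obj (op X) :=
    SSet.Subcomplex.lift ((chainSub (cylBoundary.{u} n)).ι ≫ cylProj n)
      (by rintro d _ ⟨s, rfl⟩; exact cylProj_mem_boundary s.2) ≫ a
  have haT {d : SimplexCategoryᵒᵖ} {s : (nerve (CylSet.{u} n)).obj d}
      (hs : s ∈ (chainSub (cylBoundary n)).obj d) :
      aT.app d ⟨s, hs⟩ = a.app d ⟨(cylProj n).app d s, cylProj_mem_boundary hs⟩ := rfl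
  let e := asIso (SSet.Subcomplex.toRange (cylSource.{u} n))
  have he : SSet.Subcomplex.toRange (cylSource.{u} n) ≫ e.inv = 𝟙 _ := e.hom_inv_id
  obtain ⟨w, hw₁, hw₂⟩ := exists_glue (chainSub_boundaryChains n) (e.inv ≫ l') aT (by
    rintro d _ ⟨s, rfl⟩ hT
    have hs : s ∈ (sdSub (SSet.boundary.{u} n)).obj d := by
      obtain ⟨i, hi⟩ := hT
      exact mem_sdSub_boundary.2 ⟨i.down, fun j ↦ hi _ ⟨j, rfl⟩⟩
    obtain ⟨m, ε, hε, t, rfl⟩ := exists_sd_map_of_mem_sdSub hs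
    refine (congr_arg (l'.app d) (ConcreteCategory.congr_hom (congr_app he d)
      ((SimplexCategory.sd.map ε).app d t))).trans ?_
    refine (congr_arg (fun f : SimplexCategory.sd.obj m ⟶ _ ↦ f.app d t) (hl₁ ε hε)).trans ?_
    refine Eq.trans ?_ (haT hT).symm
    have h₃ := ConcreteCategory.congr_hom (a.naturality
      (SSet.stdSimplex.objEquiv ((lastVertex m).app d t)).op) ⟨_, hε⟩
    refine h₃.symm.trans (congr_arg (a.app d) (Subtype.ext ?_))
    exact (ConcreteCategory.congr_hom (congr_app (lastVertex_naturality ε) d) t).symm)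
  have hwp : w ≫ p.app (op X) = (chainSub (LastVertexCylinder.boundaryChains
      (ULift.{u} (Fin (n + 1))))).ι ≫ cylProj n ≫ b := by
    refine glue_hom_ext (chainSub_boundaryChains n) ?_ ?_
    · rw [reassoc_of% hw₁, ← cancel_epi e.hom, e.hom_inv_id_assoc, hl₂]
      rfl
    · rw [reassoc_of% hw₂]
      ext d ⟨s, hs⟩
      exact ConcreteCategory.congr_hom (congr_app h d)
        ⟨(cylProj n).app d s, cylProj_mem_boundary hs⟩
  -- The glued map extends locally to the whole cylinder, compatibly with `cylProj n ≫ b`.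
  -- Restricting the extension to the target end `Δ[n]` solves the original problem.
  have := LocalRLP.ι_of_homOfLE _ allChains_eq_top (LocalRLP.of_toggleMatching hp
    (LastVertexCylinder.toggle_toggleMatching (X := ULift.{u} (Fin (n + 1)))))
  refine J.superset_covering ?_ (this X w (cylProj n ≫ b) hwp)
  rintro U f ⟨k, hk₁, hk₂⟩
  refine ⟨cylTarget n ≫ k, ?_, ?_⟩
  · ext d ⟨s, hs⟩
    have h₁ := ConcreteCategory.congr_hom (congr_app hk₁ d)
      ⟨(cylTarget n).app d s, (chainSub_boundaryChains n).le _
        (Or.inr (cylTarget_mem_boundary hs))⟩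
    refine h₁.trans (congr_arg ((F.map f.op).app d) ?_)
    refine (ConcreteCategory.congr_hom (congr_app hw₂ d) ⟨_, cylTarget_mem_boundary hs⟩).trans ?_
    refine congr_arg (a.app d) (Subtype.ext ?_)
    exact ConcreteCategory.congr_hom (congr_app (cylTarget_proj n) d) s
  · rw [Category.assoc, hk₂, Category.assoc, ← Category.assoc, cylTarget_proj, Category.id_comp]

/-- The natural map `K ⟶ Ex^k K`. -/
noncomputable def toExIter (k : ℕ) : 𝟭 SSet.{u} ⟶ exIter.{u} k := exMap (homOfLE (Nat.zero_le k))

theorem toExIter_zero (K : SSet.{u}) : (toExIter 0).app K = 𝟙 K :=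
  congr_app (exMap_id 0) K

theorem toExIter_succ (k : ℕ) (K : SSet.{u}) :
    (toExIter (k + 1)).app K = (toExIter k).app K ≫ toEx.app ((exIter k).obj K) := by
  have h : exMap.{u} (homOfLE (Nat.zero_le (k + 1))) =
      exMap (homOfLE (Nat.zero_le k)) ≫ exMap (homOfLE (Nat.le_succ k)) := by
    rw [← exMap_comp, homOfLE_comp]
  refine (congr_app h K).trans ?_
  exact congr_arg (fun g ↦ (toExIter k).app K ≫ g) (congr_app (exMap_succ k) K)

theorem toExIter_naturality (k : ℕ) {K L : SSet.{u}} (f : K ⟶ L) :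
    (toExIter k).app K ≫ (exIter k).map f = f ≫ (toExIter k).app L :=
  ((toExIter k).naturality f).symm

theorem toExIter_map {m n : ℕ} (h : m ⟶ n) (K : SSet.{u}) :
    (toExIter m).app K ≫ (exMap h).app K = (toExIter n).app K :=
  congr_app (exMap_comp (homOfLE (Nat.zero_le m)) h).symm K

theorem toExIter_exι (m : ℕ) (K : SSet.{u}) :
    (toExIter m).app K ≫ (exι m).app K = toExInfty.app K :=
  exι_w_app (homOfLE (Nat.zero_le m)) K

theorem toExInfty_naturality {K L : SSet.{u}} (f : K ⟶ L) :
    toExInfty.app K ≫ exInfty.map f = f ≫ toExInfty.app L :=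
  (toExInfty.naturality f).symm

/-- Squares from `i` to `Ex^k p` that have a lifting after applying `Ex` have local liftings. -/
def ExDescent (J : GrothendieckTopology C) {A B : SSet.{u}} (i : A ⟶ B) (p : F ⟶ G) : Prop :=
  ∀ (k : ℕ) {X : C} {a : A ⟶ (exIter k).obj (F.obj (op X))}
    {b : B ⟶ (exIter k).obj (G.obj (op X))},
    a ≫ (exIter k).map (p.app (op X)) = i ≫ b →
    ∀ (l : B ⟶ SSet.ex.obj ((exIter k).obj (F.obj (op X)))),
      i ≫ l = a ≫ toEx.app ((exIter k).obj (F.obj (op X))) →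
      l ≫ SSet.ex.map ((exIter k).map (p.app (op X))) =
        b ≫ toEx.app ((exIter k).obj (G.obj (op X))) →
      liftSieve i (Functor.whiskerRight p (exIter k)) a b ∈ J X

variable {A B : SSet.{u}} {i : A ⟶ B}

/-- Each use of `step` trades a lifting in `Ex^(k+1)` for liftings in `Ex^k` over a covering; after
`k` uses the coverings are composed. -/
theorem liftSieve_mem_of_exIter (step : ExDescent J i p)
    (k : ℕ) {X : C} {a : A ⟶ F.obj (op X)} {b : B ⟶ G.obj (op X)}
    (h : a ≫ p.app (op X) = i ≫ b)
    (l : B ⟶ (exIter k).obj (F.obj (op X)))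
    (h₁ : i ≫ l = a ≫ (toExIter k).app _)
    (h₂ : l ≫ (exIter k).map (p.app (op X)) = b ≫ (toExIter k).app _) :
    liftSieve i p a b ∈ J X := by
  induction k generalizing X with
  | zero =>
    rw [toExIter_zero] at h₁ h₂
    exact liftSieve_mem_of_lift l (h₁.trans (Category.comp_id _)) (h₂.trans (Category.comp_id _))
  | succ k ih =>
    obtain ⟨l', hl'⟩ : ∃ l' : B ⟶ SSet.ex.obj ((exIter k).obj (F.obj (op X))), l' = l := ⟨l, rfl⟩
    have h₁' : i ≫ l' = a ≫ (toExIter k).app _ ≫ toEx.app _ := by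
      rw [hl']
      exact h₁.trans (congr_arg (a ≫ ·) (toExIter_succ _ _))
    have h₂' : l' ≫ SSet.ex.map ((exIter k).map (p.app (op X))) =
        b ≫ (toExIter k).app _ ≫ toEx.app _ := by
      rw [hl']
      exact h₂.trans (congr_arg (b ≫ ·) (toExIter_succ _ _))
    have h₃ := step k (a := a ≫ (toExIter k).app _) (b := b ≫ (toExIter k).app _) (by
      rw [Category.assoc, toExIter_naturality, reassoc_of% h]) l' (by rw [h₁', Category.assoc])
      (by rw [h₂', Category.assoc])
    refine liftSieve_mem_of_cover h₃ ?_
    rintro U f ⟨m, hm₁, hm₂⟩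
    refine ih (restrict_square f h) m ?_ ?_
    · rw [hm₁, Category.assoc, Category.assoc, ← toExIter_naturality]
      rfl
    · refine hm₂.trans ?_
      rw [Category.assoc, Category.assoc, ← toExIter_naturality]
      rfl

/-- A local lifting into `Ex^∞` factors through a finite stage because `B` is finite, and both
triangles commute at a common later stage because `A` and `B` are finite. The descent from a finite
stage then applies. -/
theorem LocalRLP.of_exInfty [A.Finite] [B.Finite] (step : ExDescent J i p)
    (hp' : LocalRLP J i (Functor.whiskerRight p LocalLift.exInfty)) : LocalRLP J i p := by
  intro X a b h
  have h' : (a ≫ toExInfty.app (F.obj (op X))) ≫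
      (Functor.whiskerRight p LocalLift.exInfty).app (op X) =
      i ≫ (b ≫ toExInfty.app (G.obj (op X))) := by
    rw [Functor.whiskerRight_app, Category.assoc, toExInfty_naturality, reassoc_of% h]
  refine liftSieve_mem_of_cover (hp' X _ _ h') ?_
  rintro U f ⟨l, h₁, h₂⟩
  obtain ⟨m, l, rfl⟩ := exists_exι l
  simp only [Functor.comp_map, Functor.whiskerRight_app, Category.assoc,
    toExInfty_naturality] at h₁ h₂
  obtain ⟨k₁, v₁, hv₁⟩ := exists_exι_eq (i ≫ l) (a ≫ F.map f.op ≫ (toExIter m).app _) (by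
    simp only [Category.assoc]
    rw [h₁, toExIter_exι m])
  obtain ⟨k₂, v₂, hv₂⟩ := exists_exι_eq (l ≫ (exIter m).map (p.app (op U)))
    (b ≫ G.map f.op ≫ (toExIter m).app _) (by
      simp only [Category.assoc]
      rw [NatTrans.naturality, h₂, toExIter_exι m])
  let w₁ : k₁ ⟶ max k₁ k₂ := homOfLE (le_max_left _ _)
  let w₂ : k₂ ⟶ max k₁ k₂ := homOfLE (le_max_right _ _)
  have hw : v₁ ≫ w₁ = v₂ ≫ w₂ := rfl
  refine liftSieve_mem_of_exIter step (max k₁ k₂) (restrict_square f h)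
    (l ≫ (exMap (v₁ ≫ w₁)).app _) ?_ ?_
  · rw [← toExIter_map (v₁ ≫ w₁), exMap_comp, NatTrans.comp_app]
    simpa only [Category.assoc] using hv₁ =≫ (exMap w₁).app _
  · rw [Category.assoc, ← NatTrans.naturality, hw, ← toExIter_map (v₂ ≫ w₂), exMap_comp,
      NatTrans.comp_app]
    simpa only [Category.assoc] using hv₂ =≫ (exMap w₂).app _

/-- A local fibration that is a local trivial fibration after applying `Ex^∞` is a local trivial
fibration. -/
theorem LocalRLP.boundary_of_exInfty
    (hp : ∀ (n : ℕ) (k : Fin (n + 2)), LocalRLP J (SSet.horn.{u} (n + 1) k).ι p)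
    (hp' : ∀ n : ℕ, LocalRLP J (SSet.boundary.{u} n).ι (Functor.whiskerRight p LocalLift.exInfty))
    (n : ℕ) : LocalRLP J (SSet.boundary.{u} n).ι p :=
  .of_exInfty (fun k _ _ _ h l h₁ h₂ ↦
    liftSieve_boundary_mem_of_ex (LocalRLP.exIter_horn hp k) h l h₁ h₂) (hp' n)

end

end LocalLift

namespace LocalLift

section

/-! ### `Ex^∞ K` is a Kan complex -/

open PartialOrder (NonemptyFiniteChains)

variable {n m : SimplexCategory} {d e : SimplexCategoryᵒᵖ}

open Classical in
/-- The image of a nonempty set. -/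
noncomputable def faceImage (f : Fin (n.len + 1) → Fin (m.len + 1)) (S : Faces.{u} n) :
    Faces.{u} m where
  finset := S.finset.image fun x ↦ ULift.up (f x.down)
  nonempty := S.nonempty.image _
  comparable _ _ := le_total _ _

theorem mem_faceImage {f : Fin (n.len + 1) → Fin (m.len + 1)} {S : Faces.{u} n}
    {y : ULift.{u} (Fin (m.len + 1))} :
    y ∈ (faceImage f S).finset ↔ ∃ x ∈ S.finset, ULift.up (f x.down) = y :=
  Finset.mem_image

/-- The map of subdivisions induced by a map, not necessarily monotone, of vertices. -/
noncomputable def sdMapOfFun (f : Fin (n.len + 1) → Fin (m.len + 1)) :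
    SimplexCategory.sd.{u}.obj n ⟶ SimplexCategory.sd.{u}.obj m where
  app d := ↾fun s ↦ sdMk (fun i ↦ faceImage f (sdVertex s i)) fun i j h y hy ↦ by
    obtain ⟨x, hx, rfl⟩ := mem_faceImage.1 hy
    exact mem_faceImage.2 ⟨x, sdVertex_mono s h hx, rfl⟩
  naturality _ _ _ := rfl

theorem sd_map_sdMapOfFun {k : SimplexCategory} (ψ : k ⟶ n)
    (f : Fin (n.len + 1) → Fin (m.len + 1)) :
    SimplexCategory.sd.{u}.map ψ ≫ sdMapOfFun f = sdMapOfFun (f ∘ ψ.toOrderHom) := by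
  ext d s
  refine sd_ext fun i ↦ NonemptyFiniteChains.ext (Finset.ext fun y ↦ ?_)
  refine mem_faceImage.trans (Iff.trans ?_ mem_faceImage.symm)
  constructor
  · rintro ⟨x, hx, rfl⟩
    obtain ⟨z, hz, rfl⟩ := (mem_sdVertex_map _ _ _ _).1 hx
    exact ⟨z, hz, rfl⟩
  · rintro ⟨x, hx, rfl⟩
    exact ⟨_, (mem_sdVertex_map _ _ _ _).2 ⟨x, hx, rfl⟩, rfl⟩

theorem sdMapOfFun_toOrderHom (ψ : n ⟶ m) :
    sdMapOfFun ψ.toOrderHom = SimplexCategory.sd.{u}.map ψ := by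
  ext d s
  refine sd_ext fun i ↦ NonemptyFiniteChains.ext (Finset.ext fun y ↦ ?_)
  exact mem_faceImage.trans (mem_sdVertex_map _ _ _ _).symm

open Classical in
/-- The vertex of a face used to extend maps from horns: the largest one if the face belongs
to the horn, and the vertex of the horn otherwise. -/
noncomputable def hornVertex {n : ℕ} (k : Fin (n + 2)) (S : Faces.{u} ⦋n + 1⦌) : Fin (n + 2) :=
  if ∃ i ≠ k, ULift.up i ∉ S.finset then chainMax S else k

theorem hornVertex_eq {n : ℕ} {k : Fin (n + 2)} {S : Faces.{u} ⦋n + 1⦌}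
    (h : ∃ i ≠ k, ULift.up i ∉ S.finset) : hornVertex k S = chainMax S := if_pos h

/-- Along an increasing sequence of faces, those belonging to the horn all miss a vertex `i ≠ k`
missed by the largest of them, so their maxima differ from `i`; the remaining faces are sent to `k`.
Hence the vertices chosen for a simplex of `sd Δ[n + 1]` all lie in one face of the horn. -/
theorem exists_ne_hornVertex {n l : ℕ} {k : Fin (n + 2)} {S : Fin (l + 1) → Faces.{u} ⦋n + 1⦌}
    (hS : Monotone S) : ∃ i ≠ k, ∀ j, hornVertex k (S j) ≠ i := by
  classical
  by_cases h : ∃ j, ∃ i ≠ k, ULift.up i ∉ (S j).finset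
  · obtain ⟨t, ⟨i, hi, hit⟩, ht⟩ := Set.exists_max_image
      {j | ∃ i ≠ k, ULift.up i ∉ (S j).finset} id (Set.toFinite _) h
    refine ⟨i, hi, fun j hj ↦ ?_⟩
    by_cases hjS : ∃ i ≠ k, ULift.up i ∉ (S j).finset
    · rw [hornVertex_eq hjS] at hj
      refine hit (hS (ht j hjS) ?_)
      rw [← hj]
      exact up_chainMax_mem _
    · rw [hornVertex, if_neg hjS] at hj
      exact hi hj.symm
  · obtain ⟨i, hi⟩ := exists_ne k
    refine ⟨i, hi, fun j hj ↦ hi ?_⟩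
    rw [← hj, hornVertex, if_neg fun h' ↦ h ⟨j, h'⟩]

/-- The family of maps `sd Δ[d] ⟶ sd Λ[n + 1, k]` indexed by the simplices of `sd Δ[n + 1]`. -/
noncomputable def sdHornRetraction {n : ℕ} (k : Fin (n + 2))
    (s : (SimplexCategory.sd.{u}.obj ⦋n + 1⦌).obj d) :
    SimplexCategory.sd.{u}.obj d.unop ⟶ (sdSub (SSet.horn.{u} (n + 1) k) : SSet.{u}) :=
  SSet.Subcomplex.lift (sdMapOfFun (m := ⦋n + 1⦌) fun i ↦ hornVertex k (sdVertex s i)) (by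
    rintro e _ ⟨t, rfl⟩
    refine mem_sdSub_horn.2 ?_
    obtain ⟨i, hi, h⟩ := exists_ne_hornVertex (k := k) (sdVertex_mono s)
    refine ⟨i, hi, fun j hj ↦ ?_⟩
    obtain ⟨x, -, hx⟩ := mem_faceImage.1 hj
    exact h x.down (ULift.up_injective hx))

theorem sdHornRetraction_map {n : ℕ} (k : Fin (n + 2)) (r : d ⟶ e)
    (s : (SimplexCategory.sd.{u}.obj ⦋n + 1⦌).obj d) :
    sdHornRetraction k ((SimplexCategory.sd.obj ⦋n + 1⦌).map r s) =
      SimplexCategory.sd.map r.unop ≫ sdHornRetraction k s := by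
  rw [← cancel_mono (sdSub (SSet.horn.{u} (n + 1) k)).ι]
  exact (sd_map_sdMapOfFun (m := ⦋n + 1⦌) r.unop fun i ↦ hornVertex k (sdVertex s i)).symm

/-- On faces of the horn `hornVertex` is the maximum, so there the retraction is induced by the last
vertex map. This is what makes the filler extend `f ≫ toEx`. -/
theorem sdHornRetraction_of_mem {n : ℕ} {k : Fin (n + 2)} {φ : m ⟶ ⦋n + 1⦌}
    (hφ : simplexOf φ ∈ (SSet.horn.{u} (n + 1) k).obj (op m))
    (t : (SimplexCategory.sd.{u}.obj m).obj d) :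
    sdHornRetraction k ((SimplexCategory.sd.map φ).app d t) ≫ SSet.Subcomplex.ι _ =
      SimplexCategory.sd.map (SSet.stdSimplex.objEquiv ((lastVertex m).app d t) ≫ φ) := by
  refine Eq.trans ?_ (sdMapOfFun_toOrderHom _)
  refine congr_arg (sdMapOfFun (n := d.unop) (m := ⦋n + 1⦌)) (funext fun i ↦ ?_)
  obtain ⟨j, hj, hj'⟩ := mem_sdSub_horn.1 (sd_map_mem_sdSub hφ t)
  refine (hornVertex_eq ⟨j, hj, hj' i⟩).trans ?_
  exact chainMax_map φ _ _ fun y ↦ mem_sdVertex_map _ _ _ _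

/-- Kan's lemma: maps from horns to `Ex Z` can be extended after composition with
`Ex Z ⟶ Ex (Ex Z)`. -/
theorem exists_ex_horn_filler {Z : SSet.{u}} {n : ℕ} {k : Fin (n + 2)}
    (f : (SSet.horn.{u} (n + 1) k : SSet.{u}) ⟶ SSet.ex.obj Z) :
    ∃ l : Δ[n + 1] ⟶ SSet.ex.obj (SSet.ex.obj Z),
      (SSet.horn.{u} (n + 1) k).ι ≫ l = f ≫ toEx.app (SSet.ex.obj Z) := by
  obtain ⟨g, hg⟩ := exists_sdSub_hom f
  -- The choice of vertices is not monotone, so it does not give a map `sd Δ[n + 1] ⟶ Λ[n + 1, k]`.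
  -- It does induce maps of subdivisions, compatible in `d`; this is a map from `sd Δ[n + 1]` to `Ex
  -- Z`, that is, a simplex of `Ex (Ex Z)`.
  let l' : SimplexCategory.sd.{u}.obj ⦋n + 1⦌ ⟶ SSet.ex.obj Z :=
    { app := fun d ↦ ↾fun s ↦ ULift.up (sdHornRetraction k s ≫ g)
      naturality := fun d e r ↦ by
        ext s
        refine ULift.down_injective ?_
        change sdHornRetraction k ((SimplexCategory.sd.obj ⦋n + 1⦌).map r s) ≫ g =
          SimplexCategory.sd.map r.unop ≫ sdHornRetraction k s ≫ g
        rw [sdHornRetraction_map, Category.assoc] }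
  refine ⟨SSet.yonedaEquiv.symm (ULift.up l'), ?_⟩
  ext ⟨m⟩ ⟨x, hx⟩
  obtain ⟨φ, rfl⟩ := SSet.stdSimplex.objEquiv.symm.surjective x
  refine ULift.down_injective ?_
  change SimplexCategory.sd.map φ ≫ l' = lastVertex m ≫ SSet.yonedaEquiv.symm (f.app _ ⟨_, hx⟩)
  ext d t
  refine ULift.down_injective ?_
  change sdHornRetraction k ((SimplexCategory.sd.map φ).app d t) ≫ g = _
  let lam := SSet.stdSimplex.objEquiv ((lastVertex m).app d t)
  have hlam : simplexOf (lam ≫ φ) ∈ (SSet.horn.{u} (n + 1) k).obj d :=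
    (SSet.horn.{u} (n + 1) k).map lam.op hx
  have h₁ : sdHornRetraction k ((SimplexCategory.sd.map φ).app d t) ≫ g = exApp f hlam := by
    ext e s
    refine (congr_arg (g.app e) (Subtype.ext ?_)).trans (hg (lam ≫ φ) hlam e s)
    exact ConcreteCategory.congr_hom (congr_app (sdHornRetraction_of_mem hx t) e) s
  rw [h₁]
  exact congr_arg ULift.down (ConcreteCategory.congr_hom (f.naturality lam.op) ⟨_, hx⟩)

theorem kanComplex_of_hornFilling {Z : SSet.{u}}
    (h : ∀ (n : ℕ) (k : Fin (n + 2)) (f : (SSet.horn.{u} (n + 1) k : SSet.{u}) ⟶ Z),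
      ∃ l : Δ[n + 1] ⟶ Z, (SSet.horn.{u} (n + 1) k).ι ≫ l = f) : SSet.KanComplex Z := by
  refine SSet.KanComplex.iff.2 fun n k f hf ↦ ?_
  obtain ⟨l, hl⟩ := h n k hf.desc
  refine ⟨l, fun j hj ↦ ?_⟩
  rw [← hf.ι_desc j hj, ← hl, SSet.horn.ι_ι_assoc]

/-- A horn comes from a stage `Ex^m K`. Kan's lemma needs a target of the form `Ex Z`, so the horn
is moved to stage `m + 1`, and the filler is found at stage `m + 2`. -/
instance kanComplex_exInfty (K : SSet.{u}) : SSet.KanComplex (exInfty.obj K) := by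
  refine kanComplex_of_hornFilling fun n k f ↦ ?_
  obtain ⟨m, f, rfl⟩ := exists_exι f
  let f' : (SSet.horn.{u} (n + 1) k : SSet.{u}) ⟶ SSet.ex.obj ((exIter m).obj K) :=
    f ≫ toEx.app _
  have hf' : f' ≫ (exι (m + 1)).app K = f ≫ (exι m).app K := by
    have := congr_arg (fun g ↦ f ≫ g) (exι_w_app (homOfLE (Nat.le_succ m)) K)
    rw [exMap_succ] at this
    exact (Category.assoc _ _ _).trans this
  obtain ⟨l, hl⟩ := exists_ex_horn_filler f'
  refine ⟨l ≫ (exι (m + 2)).app K, ?_⟩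
  rw [← hf']
  have h₂ := congr_arg (fun g ↦ f' ≫ g) (exι_w_app (homOfLE (Nat.le_succ (m + 1))) K)
  rw [exMap_succ] at h₂
  refine (Category.assoc _ _ _).symm.trans (Eq.trans ?_ h₂)
  exact (congr_arg (· ≫ (exι (m + 2)).app K) hl).trans (Category.assoc _ _ _)

end

end LocalLift

namespace LocalLift

section

/-! ### Homotopy extension -/

open CartesianMonoidalCategory

/-- The inclusion `Y ⟶ Y ⊗ Δ[1]` of one of the ends of the cylinder. -/
noncomputable def endIncl (k : Fin 2) (Y : SSet.{u}) : Y ⟶ Y ⊗ Δ[1] :=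
  lift (𝟙 Y) (SSet.const (SSet.stdSimplex.obj₀Equiv.{u}.symm k))

theorem endIncl_naturality_assoc (k : Fin 2) {Y Z W : SSet.{u}} (f : Y ⟶ Z) (g : Z ⊗ Δ[1] ⟶ W) :
    endIncl k Y ≫ f ▷ _ ≫ g = f ≫ endIncl k Z ≫ g := rfl

theorem endIncl_fst_assoc (k : Fin 2) (Y : SSet.{u}) {W : SSet.{u}} (g : Y ⟶ W) :
    endIncl k Y ≫ fst _ _ ≫ g = g := rfl

/-- Thus `Λ[1, k]` is the vertex `k`, and `unionProd` with it glues the end `k` of a cylinder to the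
sides. -/
theorem mem_horn_one_iff {m : ℕ} (k : Fin 2) (x : Δ[1] _⦋m⦌) :
    x ∈ (SSet.horn.{u} 1 k).obj (op ⦋m⦌) ↔
      x = SSet.stdSimplex.objMk ⟨fun _ ↦ k, fun _ _ _ ↦ le_rfl⟩ := by
  rw [SSet.mem_horn_iff_notMem_range]
  constructor
  · rintro ⟨j, hj, hjx⟩
    ext i
    change ((x i : Fin 2) : ℕ) = k
    have h1 : x i ≠ j := fun h ↦ hjx ⟨i, h⟩
    generalize x i = a at h1
    fin_cases k <;> fin_cases j <;> fin_cases a <;> simp_all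
  · rintro rfl
    obtain ⟨j, hj⟩ := exists_ne k
    exact ⟨j, hj, by rintro ⟨i, hi⟩; exact hj hi.symm⟩

variable {Y Z : SSet.{u}} (A : Y.Subcomplex) (k : Fin 2)

/-- The inclusion of one end in the domain of the homotopy extension problem. -/
noncomputable def endUnion : Y ⟶ (A.unionProd (SSet.horn.{u} 1 k) : SSet.{u}) :=
  SSet.Subcomplex.lift (endIncl k Y) (by
    rintro ⟨m⟩ _ ⟨y, rfl⟩
    induction m using SimplexCategory.rec with | _ m
    exact (SSet.Subcomplex.mem_unionProd_iff _ _ _).2 (Or.inl ((mem_horn_one_iff _ _).2 rfl)))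

theorem endUnion_ι : endUnion A k ≫ SSet.Subcomplex.ι _ = endIncl k Y := rfl

variable {A k}

theorem unionProd_hom_ext {f g : (A.unionProd (SSet.horn.{u} 1 k) : SSet.{u}) ⟶ Z}
    (h₁ : SSet.Subcomplex.unionProd.ι₂ A _ ≫ f = SSet.Subcomplex.unionProd.ι₂ A _ ≫ g)
    (h₂ : endUnion A k ≫ f = endUnion A k ≫ g) : f = g := by
  ext ⟨m⟩ ⟨⟨y, t⟩, h⟩
  induction m using SimplexCategory.rec with | _ m
  obtain h' | h' := (SSet.Subcomplex.mem_unionProd_iff _ _ _).1 h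
  · obtain rfl := (mem_horn_one_iff _ _).1 h'
    exact ConcreteCategory.congr_hom (congr_app h₂ _) y
  · exact ConcreteCategory.congr_hom (congr_app h₁ _)
      ((⟨y, h'⟩, t) : (A : SSet.{u}) _⦋m⦌ × Δ[1] _⦋m⦌)

theorem exists_unionProd_hom (f : (A : SSet.{u}) ⊗ Δ[1] ⟶ Z) (g : Y ⟶ Z)
    (h : endIncl k _ ≫ f = A.ι ≫ g) :
    ∃ w : (A.unionProd (SSet.horn.{u} 1 k) : SSet.{u}) ⟶ Z,
      SSet.Subcomplex.unionProd.ι₂ A _ ≫ w = f ∧ endUnion A k ≫ w = g := by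
  obtain ⟨w, hw₁, hw₂⟩ := exists_glue
    (A := (⊤ : Y.Subcomplex).prod (SSet.horn.{u} 1 k)) (B := A.prod ⊤)
    (D := A.unionProd (SSet.horn.{u} 1 k)) rfl
    (SSet.Subcomplex.ι _ ≫ fst _ _ ≫ g)
    ((A.prodIso ⊤).hom ≫ (A : SSet.{u}) ◁ (SSet.Subcomplex.topIso _).hom ≫ f) (by
      rintro ⟨m⟩ ⟨y, t⟩ ⟨-, hA⟩ ⟨hB, -⟩
      induction m using SimplexCategory.rec with | _ m
      obtain rfl := (mem_horn_one_iff _ _).1 hA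
      exact (ConcreteCategory.congr_hom (congr_app h _) ⟨y, hB⟩).symm)
  refine ⟨w, ?_, ?_⟩
  · ext m ⟨y, t⟩
    exact ConcreteCategory.congr_hom (congr_app hw₂ m) ⟨⟨y.1, t⟩, y.2, Set.mem_univ _⟩
  · ext ⟨m⟩ y
    induction m using SimplexCategory.rec with | _ m
    exact ConcreteCategory.congr_hom (congr_app hw₁ _)
      ⟨(endIncl k Y).app _ y, Set.mem_univ _, (mem_horn_one_iff _ _).2 rfl⟩

open SSet.modelCategoryQuillen in
/-- The homotopy extension property. -/
theorem exists_homotopy_extension [SSet.KanComplex Z] (k : Fin 2) (f : (A : SSet.{u}) ⊗ Δ[1] ⟶ Z)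
    (g : Y ⟶ Z) (h : endIncl k _ ≫ f = A.ι ≫ g) :
    ∃ w : Y ⊗ Δ[1] ⟶ Z, A.ι ▷ _ ≫ w = f ∧ endIncl k _ ≫ w = g := by
  obtain ⟨w, hw₁, hw₂⟩ := exists_unionProd_hom f g h
  have := SSet.anodyneExtensions_unionProd_ι A (SSet.horn.{u} 1 k)
    (SSet.anodyneExtensions.horn_ι k) (Limits.terminal.from Z)
    (HomotopicalAlgebra.mem_fibrations _)
  have sq : CommSq w (SSet.Subcomplex.ι _) (Limits.terminal.from Z) (Limits.terminal.from _) :=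
    ⟨by simp⟩
  refine ⟨sq.lift, ?_, ?_⟩
  · rw [← SSet.Subcomplex.unionProd.ι₂_ι, Category.assoc, sq.fac_left, hw₁]
  · rw [← endUnion_ι, Category.assoc, sq.fac_left, hw₂]

variable {C : Type u} [SmallCategory C] {J : GrothendieckTopology C} {F G : Cᵒᵖ ⥤ SSet.{u}}
  {p : F ⟶ G}

/-- A regular pairing of the simplices of the prism presents this inclusion as a finite sequence of
horn attachments. -/
theorem LocalRLP.unionProd_boundary
    (hp : ∀ (n : ℕ) (k : Fin (n + 2)), LocalRLP J (SSet.horn.{u} (n + 1) k).ι p)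
    (n : ℕ) (k : Fin 2) :
    LocalRLP J ((SSet.boundary.{u} n).unionProd (SSet.horn.{u} 1 k)).ι p := by
  have h := LocalRLP.of_pairing hp (SSet.prodStdSimplex.pairing.{u} k n)
  exact h.of_arrow_iso (SSet.Subcomplex.unionProd.symmIso _ _) (β_ _ _) rfl

/-- A lifting on one end together with the homotopy on the sides fills the prism locally; the other
end of the filling is the desired lifting. -/
theorem liftSieve_mem_of_homotopy
    (hp : ∀ (n : ℕ) (k : Fin (n + 2)), LocalRLP J (SSet.horn.{u} (n + 1) k).ι p)
    {n : ℕ} (k k' : Fin 2) {X : C} {a : (SSet.boundary.{u} n : SSet.{u}) ⊗ Δ[1] ⟶ F.obj (op X)}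
    {b : Δ[n] ⊗ Δ[1] ⟶ G.obj (op X)}
    (h : a ≫ p.app (op X) = (SSet.boundary.{u} n).ι ▷ _ ≫ b)
    (hk : liftSieve (SSet.boundary.{u} n).ι p (endIncl k _ ≫ a) (endIncl k _ ≫ b) ∈ J X) :
    liftSieve (SSet.boundary.{u} n).ι p (endIncl k' _ ≫ a) (endIncl k' _ ≫ b) ∈ J X := by
  refine liftSieve_mem_of_cover hk ?_
  rintro U f ⟨l, h₁, h₂⟩
  obtain ⟨w, hw₁, hw₂⟩ := exists_unionProd_hom (k := k) (a ≫ F.map f.op) l (by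
    rw [h₁, Category.assoc])
  refine J.superset_covering ?_ (LocalRLP.unionProd_boundary hp n k U w (b ≫ G.map f.op) ?_)
  · rintro V g ⟨m, hm₁, hm₂⟩
    refine ⟨endIncl k' _ ≫ m, ?_, ?_⟩
    · rw [← endIncl_naturality_assoc, ← SSet.Subcomplex.unionProd.ι₂_ι, Category.assoc, hm₁,
        reassoc_of% hw₁]
      simp only [Category.assoc]
    · rw [Category.assoc, hm₂]
      simp only [Category.assoc]
  · apply unionProd_hom_ext
    · rw [reassoc_of% hw₁, SSet.Subcomplex.unionProd.ι₂_ι_assoc, p.naturality, reassoc_of% h]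
    · rw [reassoc_of% hw₂, h₂, ← Category.assoc (endUnion _ _), endUnion_ι, Category.assoc]

end

end LocalLift

namespace LocalLift

section

/-! ### Lifting against boundaries from homotopy groups -/

open CartesianMonoidalCategory

/-- Two `n`-simplices with boundary `c` are homotopic relative to the boundary. -/
def BoundaryHomotopic {n : ℕ} {Z : SSet.{u}} (c : (SSet.boundary.{u} n : SSet.{u}) ⟶ Z)
    (f g : Δ[n] ⟶ Z) : Prop :=
  ∃ h : Δ[n] ⊗ Δ[1] ⟶ Z, endIncl 0 _ ≫ h = f ∧ endIncl 1 _ ≫ h = g ∧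
    (SSet.boundary.{u} n).ι ▷ _ ≫ h = fst _ _ ≫ c

/-- The contraction of `Δ[n]` to its initial vertex. -/
noncomputable def cone (n : ℕ) : (Δ[n] : SSet.{u}) ⊗ Δ[1] ⟶ Δ[n] where
  app d := ↾fun z ↦ SSet.stdSimplex.objEquiv.symm (SimplexCategory.Hom.mk
    { toFun := fun i ↦ if (SSet.stdSimplex.objEquiv z.2).toOrderHom i = 0 then 0 else
        (SSet.stdSimplex.objEquiv z.1).toOrderHom i
      monotone' := fun i j h ↦ by
        have h1 := (SSet.stdSimplex.objEquiv z.1).toOrderHom.monotone h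
        have h2 := (SSet.stdSimplex.objEquiv z.2).toOrderHom.monotone h
        dsimp only
        split_ifs with h3 h4 h4
        · exact le_rfl
        · exact Fin.zero_le _
        · exact absurd (le_antisymm (h4 ▸ h2) (Fin.zero_le _)) h3
        · exact h1 })
  naturality _ _ _ := rfl

theorem endIncl_cone_one (n : ℕ) : endIncl 1 _ ≫ cone.{u} n = 𝟙 _ := by
  ext ⟨d⟩ x
  induction d using SimplexCategory.rec with | _ d
  ext i
  rfl

theorem endIncl_cone_zero (n : ℕ) :
    endIncl 0 _ ≫ cone.{u} n = SSet.const (SSet.stdSimplex.obj₀Equiv.{u}.symm 0) := by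
  ext ⟨d⟩ x
  induction d using SimplexCategory.rec with | _ d
  rfl

theorem horn_le_boundary (n : ℕ) (k : Fin (n + 2)) :
    SSet.horn.{u} (n + 1) k ≤ SSet.boundary.{u} (n + 1) := by
  rintro ⟨m⟩ x hx
  induction m using SimplexCategory.rec with | _ m
  obtain ⟨j, -, hj⟩ := (SSet.mem_horn_iff_notMem_range _ _).1 hx
  exact (SSet.mem_boundary_iff_notMem_range _).2 ⟨j, hj⟩

theorem cone_mem_horn {n m : ℕ} {x : (Δ[n + 1] : SSet.{u}) _⦋m⦌}
    (hx : x ∈ (SSet.horn.{u} (n + 1) 0).obj (op ⦋m⦌)) (t : (Δ[1] : SSet.{u}) _⦋m⦌) :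
    (cone (n + 1)).app _ (x, t) ∈ (SSet.horn.{u} (n + 1) 0).obj (op ⦋m⦌) := by
  rw [SSet.mem_horn_iff_notMem_range] at hx ⊢
  obtain ⟨j, hj, hjx⟩ := hx
  refine ⟨j, hj, ?_⟩
  rintro ⟨i, hi⟩
  have hi : (if t i = 0 then 0 else x i) = j := hi
  split_ifs at hi
  · exact hj hi.symm
  · exact hjx ⟨i, hi⟩

/-- The horn `Λ[n + 1, 0]` as a subcomplex of the boundary. -/
noncomputable def hornInBoundary (n : ℕ) : (SSet.boundary.{u} (n + 1) : SSet.{u}).Subcomplex :=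
  (SSet.horn.{u} (n + 1) 0).preimage (SSet.boundary.{u} (n + 1)).ι

/-- The contraction of the horn `Λ[n + 1, 0]`. -/
noncomputable def hornCone (n : ℕ) :
    (hornInBoundary.{u} n : SSet.{u}) ⊗ Δ[1] ⟶ (hornInBoundary.{u} n : SSet.{u}) :=
  SSet.Subcomplex.lift (SSet.Subcomplex.lift
    (((hornInBoundary n).ι ≫ (SSet.boundary.{u} (n + 1)).ι) ▷ _ ≫ cone (n + 1)) (by
      rintro ⟨d⟩ _ ⟨⟨x, t⟩, rfl⟩
      induction d using SimplexCategory.rec with | _ d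
      exact horn_le_boundary _ _ _ (cone_mem_horn x.2 t))) (by
      rintro ⟨d⟩ _ ⟨⟨x, t⟩, rfl⟩
      induction d using SimplexCategory.rec with | _ d
      exact cone_mem_horn x.2 t)

theorem hornCone_ι (n : ℕ) :
    hornCone.{u} n ≫ (hornInBoundary n).ι ≫ (SSet.boundary.{u} (n + 1)).ι =
      ((hornInBoundary n).ι ≫ (SSet.boundary.{u} (n + 1)).ι) ▷ _ ≫ cone (n + 1) := rfl

/-- The initial vertex of the horn. -/
noncomputable def boundaryVertex (n : ℕ) : (hornInBoundary.{u} n : SSet.{u}) _⦋0⦌ :=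
  have h : SSet.stdSimplex.obj₀Equiv.{u}.symm 0 ∈ (SSet.horn.{u} (n + 1) 0).obj (op ⦋0⦌) :=
    (SSet.mem_horn_iff_notMem_range _ _).2 ⟨1, one_ne_zero, by
      rintro ⟨i, hi⟩
      exact zero_ne_one (α := Fin (n + 2)) hi⟩
  ⟨⟨SSet.stdSimplex.obj₀Equiv.{u}.symm 0, horn_le_boundary _ _ _ h⟩, h⟩

theorem endIncl_hornCone_one (n : ℕ) : endIncl 1 _ ≫ hornCone.{u} n = 𝟙 _ := by
  rw [← cancel_mono (hornInBoundary n).ι, ← cancel_mono (SSet.boundary.{u} (n + 1)).ι,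
    Category.assoc, Category.assoc, hornCone_ι, endIncl_naturality_assoc, endIncl_cone_one]
  rfl

theorem endIncl_hornCone_zero (n : ℕ) :
    endIncl 0 _ ≫ hornCone.{u} n = SSet.const (boundaryVertex n) := by
  ext ⟨d⟩ x
  induction d using SimplexCategory.rec with | _ d
  rfl

/-- The `0`th face of the boundary. -/
noncomputable abbrev zeroFace (n : ℕ) : (Δ[n] : SSet.{u}) ⟶ SSet.boundary.{u} (n + 1) :=
  SSet.boundary.ι 0

theorem zeroFace_ι (n : ℕ) : zeroFace.{u} n ≫ (SSet.boundary.{u} (n + 1)).ι =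
    SSet.stdSimplex.δ 0 := SSet.boundary.ι_ι _

theorem zeroFace_app {n m : ℕ} (y : (Δ[n] : SSet.{u}) _⦋m⦌) (i : Fin (m + 1)) :
    ((zeroFace n).app _ y).1 i = (y i).succ := rfl

theorem zeroFace_mem_iff {n m : ℕ} (y : (Δ[n] : SSet.{u}) _⦋m⦌) :
    (zeroFace n).app _ y ∈ (hornInBoundary n).obj (op ⦋m⦌) ↔
      y ∈ (SSet.boundary.{u} n).obj (op ⦋m⦌) := by
  change ((zeroFace n).app _ y).1 ∈ (SSet.horn.{u} (n + 1) 0).obj (op ⦋m⦌) ↔ _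
  rw [SSet.mem_horn_iff_notMem_range, SSet.mem_boundary_iff_notMem_range]
  constructor
  · rintro ⟨j, hj, h⟩
    refine ⟨j.pred hj, ?_⟩
    rintro ⟨i, hi⟩
    refine h ⟨i, (zeroFace_app y i).trans ?_⟩
    rw [hi, Fin.succ_pred]
  · rintro ⟨j, h⟩
    refine ⟨j.succ, Fin.succ_ne_zero j, ?_⟩
    rintro ⟨i, hi⟩
    exact h ⟨i, Fin.succ_injective _ hi⟩

/-- The boundary of the `0`th face lies in the horn `Λ[n + 1, 0]`. -/
noncomputable def zeroFaceBoundary (n : ℕ) :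
    (SSet.boundary.{u} n : SSet.{u}) ⟶ (hornInBoundary.{u} n : SSet.{u}) :=
  SSet.Subcomplex.lift ((SSet.boundary.{u} n).ι ≫ zeroFace n) (by
    rintro ⟨d⟩ _ ⟨x, rfl⟩
    induction d using SimplexCategory.rec with | _ d
    exact (zeroFace_mem_iff _).2 x.2)

theorem zeroFaceBoundary_ι_assoc (n : ℕ) {Z : SSet.{u}}
    (g : (SSet.boundary.{u} (n + 1) : SSet.{u}) ⟶ Z) : zeroFaceBoundary n ≫
      (hornInBoundary n).ι ≫ g = (SSet.boundary.{u} n).ι ≫ zeroFace n ≫ g := rfl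

theorem mem_hornInBoundary_or {n m : ℕ} (x : (SSet.boundary.{u} (n + 1) : SSet.{u}) _⦋m⦌) :
    x ∈ (hornInBoundary n).obj (op ⦋m⦌) ∨ ∃ y, (zeroFace n).app _ y = x := by
  obtain ⟨x, hx⟩ := x
  obtain ⟨j, hj⟩ := (SSet.mem_boundary_iff_notMem_range _).1 hx
  by_cases h : j = 0
  · subst h
    have h0 (i) : x i ≠ 0 := fun hi ↦ hj ⟨i, hi⟩
    refine Or.inr ⟨SSet.stdSimplex.objMk ⟨fun i ↦ (x i).pred (h0 i), fun i i' h ↦ ?_⟩, ?_⟩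
    · exact Fin.pred_le_pred_iff.2 (SSet.stdSimplex.monotone_apply x h)
    · refine Subtype.ext ?_
      ext i
      exact congr_arg Fin.val (Fin.succ_pred (x i) (h0 i))
  · exact Or.inl ((SSet.mem_horn_iff_notMem_range _ _).2 ⟨j, h, hj⟩)

theorem boundary_succ_hom_ext {n : ℕ} {Z : SSet.{u}}
    {f g : (SSet.boundary.{u} (n + 1) : SSet.{u}) ⟶ Z}
    (h₁ : (hornInBoundary n).ι ≫ f = (hornInBoundary n).ι ≫ g)
    (h₂ : zeroFace n ≫ f = zeroFace n ≫ g) : f = g := by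
  ext ⟨m⟩ x
  induction m using SimplexCategory.rec with | _ m
  obtain hx | ⟨y, rfl⟩ := mem_hornInBoundary_or x
  · exact ConcreteCategory.congr_hom (congr_app h₁ _) ⟨x, hx⟩
  · exact ConcreteCategory.congr_hom (congr_app h₂ _) y

instance (n : ℕ) : Mono (zeroFace.{u} n) :=
  have : Mono (zeroFace.{u} n ≫ (SSet.boundary.{u} (n + 1)).ι) := by
    rw [zeroFace_ι]; infer_instance
  mono_of_mono _ (SSet.boundary.{u} (n + 1)).ι

/-- A homotopy of the `0`th face, constant on the boundary, extends to a homotopy of the whole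
boundary which is constant on the complementary horn. -/
theorem exists_boundary_homotopy {n : ℕ} {Z : SSet.{u}} (e : Z _⦋0⦌) (h : Δ[n] ⊗ Δ[1] ⟶ Z)
    (hh : (SSet.boundary.{u} n).ι ▷ _ ≫ h = SSet.const e) :
    ∃ w : (SSet.boundary.{u} (n + 1) : SSet.{u}) ⊗ Δ[1] ⟶ Z,
      (hornInBoundary n).ι ▷ _ ≫ w = SSet.const e ∧ zeroFace n ▷ _ ≫ w = h := by
  let B := SSet.Subcomplex.range (zeroFace.{u} n)
  have hB : (hornInBoundary n).prod (⊤ : (Δ[1] : SSet.{u}).Subcomplex) ⊔ B.prod ⊤ = ⊤ := by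
    apply le_antisymm le_top
    rintro ⟨m⟩ ⟨x, t⟩ -
    induction m using SimplexCategory.rec with | _ m
    obtain hx | hx := mem_hornInBoundary_or x
    · exact Or.inl ⟨hx, Set.mem_univ _⟩
    · exact Or.inr ⟨hx, Set.mem_univ _⟩
  obtain ⟨w, hw₁, hw₂⟩ := exists_glue hB
    (SSet.const e)
    ((B.prodIso ⊤).hom ≫ inv (SSet.Subcomplex.toRange (zeroFace.{u} n)) ▷ _ ≫
      Δ[n] ◁ (SSet.Subcomplex.topIso _).hom ≫ h) (by
      rintro ⟨m⟩ ⟨x, t⟩ ⟨hA, hA'⟩ ⟨⟨y, hy⟩, hB'⟩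
      induction m using SimplexCategory.rec with | _ m
      obtain rfl : _ = x := hy
      have h1 := ConcreteCategory.congr_hom (congr_app
        (IsIso.hom_inv_id (SSet.Subcomplex.toRange (zeroFace.{u} n))) (op ⦋m⦌)) y
      refine (ConcreteCategory.congr_hom (congr_app hh (op ⦋m⦌))
        ((⟨y, (zeroFace_mem_iff y).1 hA⟩, t) :
          (SSet.boundary.{u} n : SSet.{u}) _⦋m⦌ × Δ[1] _⦋m⦌)).symm.trans ?_
      exact congr_arg (fun z ↦ h.app (op ⦋m⦌) (z, t)) h1.symm)
  refine ⟨(SSet.Subcomplex.topIso _).inv ≫ w, ?_, ?_⟩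
  · ext m ⟨x, t⟩
    exact ConcreteCategory.congr_hom (congr_app hw₁ m) ⟨⟨x.1, t⟩, x.2, Set.mem_univ _⟩
  · ext m ⟨y, t⟩
    refine (ConcreteCategory.congr_hom (congr_app hw₂ m)
      ⟨⟨(zeroFace n).app _ y, t⟩, ⟨y, rfl⟩, Set.mem_univ _⟩).trans ?_
    have h1 := ConcreteCategory.congr_hom (congr_app
      (IsIso.hom_inv_id (SSet.Subcomplex.toRange (zeroFace.{u} n))) m) y
    exact congr_arg (fun z ↦ h.app m (z, t)) h1

/-! ### Local fillers from local bijectivity on homotopy sets. -/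

variable {C : Type u} [SmallCategory C] {J : GrothendieckTopology C} {E B : Cᵒᵖ ⥤ SSet.{u}}
  {q : E ⟶ B}

/-- A map from `∂Δ[n]` which is constant, or arbitrary if `n = 0`. -/
def IsConstBoundary {n : ℕ} {Z : SSet.{u}} (c : (SSet.boundary.{u} n : SSet.{u}) ⟶ Z) : Prop :=
  n = 0 ∨ ∃ e, c = SSet.const e

variable (J q) in
/-- The maps `q` induces on homotopy sets are locally injective. -/
def PiLocallyInjective (n : ℕ) : Prop :=
  ∀ (X : C) (c : (SSet.boundary.{u} n : SSet.{u}) ⟶ E.obj (op X)), IsConstBoundary c →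
    ∀ ω ω' : Δ[n] ⟶ E.obj (op X), (SSet.boundary.{u} n).ι ≫ ω = c →
      (SSet.boundary.{u} n).ι ≫ ω' = c →
      Relation.EqvGen (BoundaryHomotopic (c ≫ q.app _)) (ω ≫ q.app _) (ω' ≫ q.app _) →
      ∃ R ∈ J X, ∀ ⦃U : C⦄ (f : U ⟶ X), R f → Relation.EqvGen (BoundaryHomotopic (c ≫ E.map f.op))
        (ω ≫ E.map f.op) (ω' ≫ E.map f.op)

variable (J q) in
/-- The maps `q` induces on homotopy sets are locally surjective. -/
def PiLocallySurjective (n : ℕ) : Prop :=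
  ∀ (X : C) (c : (SSet.boundary.{u} n : SSet.{u}) ⟶ E.obj (op X)), IsConstBoundary c →
    ∀ β : Δ[n] ⟶ B.obj (op X), (SSet.boundary.{u} n).ι ≫ β = c ≫ q.app _ →
      ∃ R ∈ J X, ∀ ⦃U : C⦄ (f : U ⟶ X), R f →
        ∃ α : Δ[n] ⟶ E.obj (op U), (SSet.boundary.{u} n).ι ≫ α = c ≫ E.map f.op ∧
          Relation.EqvGen (BoundaryHomotopic (c ≫ E.map f.op ≫ q.app _))
            (α ≫ q.app _) (β ≫ B.map f.op)

variable (J q) in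
/-- All lifting problems with a given map on the boundary can be solved locally. -/
def HasLocalFillers {n : ℕ} {X : C} (a : (SSet.boundary.{u} n : SSet.{u}) ⟶ E.obj (op X)) : Prop :=
  ∀ b, a ≫ q.app _ = (SSet.boundary.{u} n).ι ≫ b → liftSieve (SSet.boundary.{u} n).ι q a b ∈ J X

section

variable (hq : ∀ (n : ℕ) (k : Fin (n + 2)), LocalRLP J (SSet.horn.{u} (n + 1) k).ι q)

include hq

/-- A filling `b` of one end of the boundary homotopy extends to a homotopy in the Kan complex
`B(X)`, whose other end is a problem with a local solution. The solution is carried back along the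
homotopy. -/
theorem HasLocalFillers.of_homotopy {n : ℕ} {X : C} [SSet.KanComplex (B.obj (op X))]
    (a : (SSet.boundary.{u} n : SSet.{u}) ⊗ Δ[1] ⟶ E.obj (op X)) (k k' : Fin 2)
    (h : HasLocalFillers J q (endIncl k _ ≫ a)) : HasLocalFillers J q (endIncl k' _ ≫ a) := by
  intro b hb
  obtain ⟨w, hw₁, rfl⟩ := exists_homotopy_extension k' (a ≫ q.app _) b
    ((Category.assoc _ _ _).symm.trans hb)
  refine liftSieve_mem_of_homotopy hq k k' hw₁.symm (h _ ?_)
  rw [Category.assoc, ← hw₁, endIncl_naturality_assoc]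

/-- With the boundary held fixed, local solvability depends only on the homotopy class of the
simplex downstairs. -/
theorem liftSieve_mem_of_eqvGen {n : ℕ} {X : C}
    (c : (SSet.boundary.{u} n : SSet.{u}) ⟶ E.obj (op X)) {β β' : Δ[n] ⟶ B.obj (op X)}
    (h : Relation.EqvGen (BoundaryHomotopic (c ≫ q.app _)) β β') :
    liftSieve (SSet.boundary.{u} n).ι q c β ∈ J X ↔
      liftSieve (SSet.boundary.{u} n).ι q c β' ∈ J X := by
  induction h with
  | rel β β' h =>
    obtain ⟨h, rfl, rfl, hh⟩ := h
    have key (k k') := liftSieve_mem_of_homotopy hq k k' (a := fst _ _ ≫ c)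
      ((Category.assoc _ _ _).trans hh.symm)
    simp only [endIncl_fst_assoc] at key
    exact ⟨key 0 1, key 1 0⟩
  | refl => rfl
  | symm _ _ _ ih => exact ih.symm
  | trans _ _ _ _ _ ih₁ ih₂ => exact ih₁.trans ih₂

/-- Local surjectivity gives `α` whose image is homotopic to `b` relative to the boundary. The
problem for `α ≫ q` is solved by `α`, hence the one for `b` is solvable locally. -/
theorem HasLocalFillers.of_isConstBoundary {n : ℕ} (hs : PiLocallySurjective J q n) {X : C}
    {c : (SSet.boundary.{u} n : SSet.{u}) ⟶ E.obj (op X)} (hc : IsConstBoundary c) :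
    HasLocalFillers J q c := by
  intro b hb
  obtain ⟨R, hR, h⟩ := hs X c hc b hb.symm
  refine liftSieve_mem_of_cover hR fun U f hf ↦ ?_
  obtain ⟨α, hα, hα'⟩ := h f hf
  rw [← Category.assoc] at hα'
  exact (liftSieve_mem_of_eqvGen hq _ hα').1 (liftSieve_mem_of_lift α hα rfl)

/-- A map on `∂Δ[n + 1]` that is constant on `Λ[n + 1, 0]` is determined by its `0`th face, and a
homotopy of that face relative to its boundary extends by a constant homotopy on the horn. -/
theorem HasLocalFillers.of_eqvGen {n : ℕ} {X : C} [SSet.KanComplex (B.obj (op X))]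
    (e : (E.obj (op X)) _⦋0⦌) {ω ω' : Δ[n] ⟶ E.obj (op X)}
    (h : Relation.EqvGen (BoundaryHomotopic (SSet.const e)) ω ω') :
    (∀ a, (hornInBoundary n).ι ≫ a = SSet.const e → zeroFace n ≫ a = ω → HasLocalFillers J q a) ↔
    (∀ a, (hornInBoundary n).ι ≫ a = SSet.const e → zeroFace n ≫ a = ω' →
      HasLocalFillers J q a) := by
  induction h with
  | rel ω ω' h =>
    obtain ⟨h, rfl, rfl, hh⟩ := h
    obtain ⟨w, hw₁, hw₂⟩ := exists_boundary_homotopy e h hh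
    have key (k k' : Fin 2)
        (H : ∀ a, (hornInBoundary n).ι ≫ a = SSet.const e → zeroFace n ≫ a = endIncl k _ ≫ h →
          HasLocalFillers J q a)
        (a) (ha : (hornInBoundary n).ι ≫ a = SSet.const e)
        (ha' : zeroFace n ≫ a = endIncl k' _ ≫ h) : HasLocalFillers J q a := by
      have h₁ (k) : (hornInBoundary n).ι ≫ endIncl k _ ≫ w = SSet.const e := by
        rw [← endIncl_naturality_assoc, hw₁, SSet.comp_const]
      have h₂ (k) : zeroFace n ≫ endIncl k _ ≫ w = endIncl k _ ≫ h := by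
        rw [← endIncl_naturality_assoc, hw₂]
      obtain rfl : a = endIncl k' _ ≫ w :=
        boundary_succ_hom_ext (ha.trans (h₁ k').symm) (ha'.trans (h₂ k').symm)
      exact HasLocalFillers.of_homotopy hq w k k' (H _ (h₁ k) (h₂ k))
    exact ⟨key 0 1, key 1 0⟩
  | refl => rfl
  | symm _ _ _ ih => exact ih.symm
  | trans _ _ _ _ _ ih₁ ih₂ => exact ih₁.trans ih₂

/-- A local fibration between presheaves of Kan complexes which induces locally bijective maps on
homotopy sets has local liftings with respect to boundary inclusions. -/
theorem LocalRLP.boundary_of_pi [∀ X : C, SSet.KanComplex (E.obj (op X))]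
    [∀ X : C, SSet.KanComplex (B.obj (op X))] (hi : ∀ n, PiLocallyInjective J q n)
    (hs : ∀ n, PiLocallySurjective J q n) (n : ℕ) :
    LocalRLP J (SSet.boundary.{u} n).ι q := by
  cases n with
  | zero => exact fun X a ↦ HasLocalFillers.of_isConstBoundary hq (hs 0) (Or.inl rfl)
  | succ n =>
  intro X a b hab
  -- Contracting the horn `Λ[n + 1, 0]` to its initial vertex and extending the homotopy over `∂Δ[n
  -- + 1]` reduces the problem to maps `a` that are constant on the horn, at the end `0` of the
  -- homotopy.
  obtain ⟨w, hw₁, rfl⟩ := exists_homotopy_extension 1 (hornCone n ≫ (hornInBoundary n).ι ≫ a) a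
    (by rw [← Category.assoc, endIncl_hornCone_one, Category.id_comp])
  refine HasLocalFillers.of_homotopy hq w 0 1 ?_ b hab
  have ha : (hornInBoundary n).ι ≫ endIncl 0 _ ≫ w =
      SSet.const (((hornInBoundary n).ι ≫ endIncl 1 _ ≫ w).app _ (boundaryVertex n)) := by
    rw [← endIncl_naturality_assoc, hw₁, ← Category.assoc, endIncl_hornCone_zero, SSet.const_comp]
  generalize ((hornInBoundary n).ι ≫ endIncl 1 _ ≫ w).app _ (boundaryVertex n) = e at ha
  generalize endIncl 0 _ ≫ w = a at ha
  clear hab b hw₁ w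
  intro b hab
  have hb : (hornInBoundary n).ι ≫ (SSet.boundary.{u} (n + 1)).ι ≫ b =
      SSet.const ((q.app _).app _ e) := by
    rw [← hab, reassoc_of% ha, SSet.const_comp]
  have hω : (SSet.boundary.{u} n).ι ≫ zeroFace n ≫ a = SSet.const e := by
    rw [← zeroFaceBoundary_ι_assoc, ha, SSet.comp_const]
  -- Since `b` fills the image of `a`, composing it with the cone contraction gives a homotopy,
  -- relative to the boundary, from the constant simplex to the image of the `0`th face of `a`.
  have h₀ : endIncl 0 _ ≫ SSet.stdSimplex.δ 0 ▷ _ ≫ cone _ ≫ b =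
      SSet.const (X := Δ[n]) e ≫ q.app _ := by
    rw [SSet.const_comp, endIncl_naturality_assoc, ← Category.assoc (endIncl _ _),
      endIncl_cone_zero, SSet.const_comp, SSet.comp_const]
    exact congr_arg SSet.const ((ConcreteCategory.congr_hom (congr_app hb _)
      (boundaryVertex n)).trans (by simp))
  have h₁ : endIncl 1 _ ≫ SSet.stdSimplex.δ 0 ▷ _ ≫ cone _ ≫ b =
      (zeroFace n ≫ a) ≫ q.app _ := by
    rw [Category.assoc, hab, endIncl_naturality_assoc, ← Category.assoc (endIncl _ _),
      endIncl_cone_one, Category.id_comp, ← Category.assoc (zeroFace n), zeroFace_ι]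
  have h₂ : (SSet.boundary.{u} n).ι ▷ _ ≫ SSet.stdSimplex.δ 0 ▷ _ ≫ cone _ ≫ b =
      fst _ _ ≫ SSet.const e ≫ q.app _ := by
    rw [SSet.const_comp, SSet.comp_const]
    refine (congr_arg (fun g ↦ zeroFaceBoundary n ▷ _ ≫ hornCone n ≫ g) hb).trans ?_
    rw [SSet.comp_const, SSet.comp_const]
  -- Local injectivity turns this into a null homotopy of the `0`th face upstairs, over a covering.
  -- That face may then be replaced by a constant one, which makes the whole boundary map constant,
  -- and local surjectivity in degree `n + 1` applies.
  obtain ⟨R, hR, h⟩ := hi n X (SSet.const e) (Or.inr ⟨e, rfl⟩) (SSet.const e) (zeroFace n ≫ a)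
    (SSet.comp_const _ _) hω (Relation.EqvGen.rel _ _ ⟨_, h₀, h₁, h₂⟩)
  refine liftSieve_mem_of_cover hR fun U f hf ↦ ?_
  have h' := h f hf
  rw [SSet.const_comp, SSet.const_comp] at h'
  refine (HasLocalFillers.of_eqvGen hq _ h').1 ?_ (a ≫ E.map f.op) ?_ (Category.assoc _ _ _).symm _
    (restrict_square f hab)
  · intro a' h₁ h₂
    refine HasLocalFillers.of_isConstBoundary hq (hs _) (Or.inr ⟨(E.map f.op).app _ e, ?_⟩)
    apply boundary_succ_hom_ext
    · rw [h₁, SSet.comp_const]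
    · rw [h₂, SSet.comp_const]
  · rw [reassoc_of% ha, SSet.const_comp]

end

end

end LocalLift

namespace LocalLift

section

/-! ### Connected components and `Ex^∞` -/

open CartesianMonoidalCategory

theorem BoundaryHomotopic.refl {n : ℕ} {Z : SSet.{u}}
    {c : (SSet.boundary.{u} n : SSet.{u}) ⟶ Z} {f : Δ[n] ⟶ Z}
    (h : (SSet.boundary.{u} n).ι ≫ f = c) : BoundaryHomotopic c f f := by
  refine ⟨fst _ _ ≫ f, endIncl_fst_assoc _ _ _, endIncl_fst_assoc _ _ _, ?_⟩
  rw [whiskerRight_fst_assoc, h]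

theorem BoundaryHomotopic.map {n : ℕ} {Z W : SSet.{u}}
    {c : (SSet.boundary.{u} n : SSet.{u}) ⟶ Z} {f g : Δ[n] ⟶ Z} (h : BoundaryHomotopic c f g)
    (φ : Z ⟶ W) : BoundaryHomotopic (c ≫ φ) (f ≫ φ) (g ≫ φ) := by
  obtain ⟨h, rfl, rfl, hh⟩ := h
  exact ⟨h ≫ φ, (Category.assoc _ _ _).symm, (Category.assoc _ _ _).symm, by rw [reassoc_of% hh]⟩

theorem BoundaryHomotopic.left {n : ℕ} {Z : SSet.{u}}
    {c : (SSet.boundary.{u} n : SSet.{u}) ⟶ Z} {f g : Δ[n] ⟶ Z} (h : BoundaryHomotopic c f g) :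
    (SSet.boundary.{u} n).ι ≫ f = c := by
  obtain ⟨h, rfl, rfl, hh⟩ := h
  rw [← endIncl_naturality_assoc, hh, endIncl_fst_assoc]

theorem BoundaryHomotopic.right {n : ℕ} {Z : SSet.{u}}
    {c : (SSet.boundary.{u} n : SSet.{u}) ⟶ Z} {f g : Δ[n] ⟶ Z} (h : BoundaryHomotopic c f g) :
    (SSet.boundary.{u} n).ι ≫ g = c := by
  obtain ⟨h, rfl, rfl, hh⟩ := h
  rw [← endIncl_naturality_assoc, hh, endIncl_fst_assoc]

theorem BoundaryHomotopic.eqvGen_iff {n : ℕ} {Z : SSet.{u}}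
    {c : (SSet.boundary.{u} n : SSet.{u}) ⟶ Z} {f g : Δ[n] ⟶ Z}
    (h : Relation.EqvGen (BoundaryHomotopic c) f g) :
    (SSet.boundary.{u} n).ι ≫ f = c ↔ (SSet.boundary.{u} n).ι ≫ g = c := by
  induction h with
  | rel _ _ h => exact iff_of_true h.left h.right
  | refl => rfl
  | symm _ _ _ ih => exact ih.symm
  | trans _ _ _ _ _ ih₁ ih₂ => exact ih₁.trans ih₂

theorem boundary_zero_hom_ext {Z : SSet.{u}} (f g : (SSet.boundary.{u} 0 : SSet.{u}) ⟶ Z) :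
    f = g := by
  ext

theorem nonempty_edge_of_boundaryHomotopic {Z : SSet.{u}}
    {c : (SSet.boundary.{u} 0 : SSet.{u}) ⟶ Z} {f g : Δ[0] ⟶ Z} (h : BoundaryHomotopic c f g) :
    SSet.π₀Rel (SSet.yonedaEquiv f) (SSet.yonedaEquiv g) := by
  obtain ⟨h, rfl, rfl, -⟩ := h
  let e : (Δ[0] ⊗ Δ[1] : SSet.{u}) _⦋1⦌ :=
    (SSet.stdSimplex.objMk ⟨fun _ ↦ 0, fun _ _ _ ↦ le_rfl⟩, SSet.stdSimplex.objEquiv.symm (𝟙 _))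
  refine ⟨SSet.Edge.mk (h.app _ e) ?_ ?_⟩
  · refine (ConcreteCategory.congr_hom (h.naturality (SimplexCategory.δ 1).op) e).symm.trans ?_
    refine congr_arg (h.app _) (Prod.ext ?_ ?_)
    · ext i
      fin_cases i
      rfl
    · ext i
      fin_cases i
      rfl
  · refine (ConcreteCategory.congr_hom (h.naturality (SimplexCategory.δ 0).op) e).symm.trans ?_
    refine congr_arg (h.app _) (Prod.ext ?_ ?_)
    · ext i
      fin_cases i
      rfl
    · ext i
      fin_cases i
      rfl

theorem boundaryHomotopic_of_edge {Z : SSet.{u}} (c : (SSet.boundary.{u} 0 : SSet.{u}) ⟶ Z)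
    {f g : Δ[0] ⟶ Z} (h : SSet.π₀Rel (SSet.yonedaEquiv f) (SSet.yonedaEquiv g)) :
    BoundaryHomotopic c f g := by
  obtain ⟨e⟩ := h
  refine ⟨snd _ _ ≫ SSet.yonedaEquiv.symm e.edge, SSet.yonedaEquiv.injective ?_,
    SSet.yonedaEquiv.injective ?_, ?_⟩
  · refine (congr_arg ((SSet.yonedaEquiv.symm e.edge).app (op ⦋0⦌)) (?_ : SSet.stdSimplex.objMk
      ⟨fun _ ↦ 0, fun _ _ _ ↦ le_rfl⟩ = SSet.stdSimplex.objEquiv.symm (SimplexCategory.δ 1))).trans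
      ((SSet.yonedaEquiv_symm_app_objEquiv_symm e.edge (SimplexCategory.δ 1)).trans e.src_eq)
    ext i
    fin_cases i
    rfl
  · refine (congr_arg ((SSet.yonedaEquiv.symm e.edge).app (op ⦋0⦌)) (?_ : SSet.stdSimplex.objMk
      ⟨fun _ ↦ 1, fun _ _ _ ↦ le_rfl⟩ = SSet.stdSimplex.objEquiv.symm (SimplexCategory.δ 0))).trans
      ((SSet.yonedaEquiv_symm_app_objEquiv_symm e.edge (SimplexCategory.δ 0)).trans e.tgt_eq)
    ext i
    fin_cases i
    rfl
  · ext ⟨d⟩ x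
    induction d using SimplexCategory.rec with | _ d
    obtain ⟨i, hi⟩ := (SSet.mem_boundary_iff_notMem_range _).1 x.1.2
    exact (hi ⟨0, Subsingleton.elim (α := Fin 1) _ _⟩).elim

theorem eqvGen_boundaryHomotopic_iff {Z : SSet.{u}} (c : (SSet.boundary.{u} 0 : SSet.{u}) ⟶ Z)
    {f g : Δ[0] ⟶ Z} : Relation.EqvGen (BoundaryHomotopic c) f g ↔
      SSet.π₀.mk (SSet.yonedaEquiv f) = SSet.π₀.mk (SSet.yonedaEquiv g) := by
  rw [SSet.π₀.mk_eq_mk_iff]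
  constructor
  · intro h
    induction h with
    | rel _ _ h => exact .rel _ _ (nonempty_edge_of_boundaryHomotopic h)
    | refl => exact .refl _
    | symm _ _ _ ih => exact .symm _ _ ih
    | trans _ _ _ _ _ ih₁ ih₂ => exact .trans _ _ _ ih₁ ih₂
  · intro h
    generalize hf : SSet.yonedaEquiv f = x at h
    generalize hg : SSet.yonedaEquiv g = y at h
    obtain rfl := (Equiv.eq_symm_apply _).2 hf
    obtain rfl := (Equiv.eq_symm_apply _).2 hg
    clear hf hg
    induction h with
    | rel _ _ h =>
      exact .rel _ _ (boundaryHomotopic_of_edge c (by simpa only [Equiv.apply_symm_apply] using h))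
    | refl => exact .refl _
    | symm _ _ _ ih => exact .symm _ _ ih
    | trans _ _ _ _ _ ih₁ ih₂ => exact .trans _ _ _ ih₁ ih₂

/-- The face containing all vertices. -/
noncomputable def topFace (n : SimplexCategory) : Faces.{u} n := chainOfSet Set.univ ⟨⟨0⟩, trivial⟩

theorem le_topFace {n : SimplexCategory} (S : Faces.{u} n) : S ≤ topFace n :=
  fun _ _ ↦ mem_chainOfSet.2 trivial

/-- The subdivision of a simplex is connected: every face is joined by an edge to the top face. -/
theorem mk_sd_eq {n : SimplexCategory} (s t : (SimplexCategory.sd.{u}.obj n) _⦋0⦌) :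
    SSet.π₀.mk s = SSet.π₀.mk t := by
  suffices h : ∀ s : (SimplexCategory.sd.{u}.obj n) _⦋0⦌, SSet.π₀.mk s =
      SSet.π₀.mk (sdMk (fun _ ↦ topFace n) monotone_const : (SimplexCategory.sd.{u}.obj n) _⦋0⦌) from
    (h s).trans (h t).symm
  intro s
  refine SSet.π₀.sound (SSet.Edge.mk (sdMk ![sdVertex s 0, topFace n] ?_) ?_ ?_)
  · refine Fin.monotone_iff_le_succ.2 fun i ↦ ?_
    fin_cases i
    exact le_topFace _
  · refine sd_ext fun i ↦ ?_
    fin_cases i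
    rfl
  · refine sd_ext fun i ↦ ?_
    fin_cases i
    rfl

/-- The only vertex of the subdivision of a point. -/
noncomputable def sdPoint : (SimplexCategory.sd.{u}.obj ⦋0⦌) _⦋0⦌ :=
  sdMk (fun _ ↦ topFace ⦋0⦌) monotone_const

theorem sd_zero_hom_ext {Z : SSet.{u}} {f g : SimplexCategory.sd.{u}.obj ⦋0⦌ ⟶ Z}
    (h : f.app _ sdPoint = g.app _ sdPoint) : f = g := by
  ext d s
  have hs : s = (SimplexCategory.sd.{u}.obj ⦋0⦌).map (d.unop.const ⦋0⦌ 0).op sdPoint := by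
    refine sd_ext fun i ↦ ?_
    change sdVertex s i = topFace ⦋0⦌
    obtain ⟨x, hx⟩ := (sdVertex s i).nonempty
    refine le_antisymm (le_topFace _) fun y _ ↦ ?_
    rwa [show y = x from ULift.ext _ _ (Subsingleton.elim (α := Fin 1) _ _)]
  subst hs
  refine (ConcreteCategory.congr_hom (f.naturality _) _).trans ?_
  refine Eq.trans ?_ (ConcreteCategory.congr_hom (g.naturality _) _).symm
  exact congr_arg (Z.map _) h

theorem toEx_app_sdPoint {K : SSet.{u}} (x : K _⦋0⦌) :
    (ULift.down ((toEx.app K).app _ x)).app _ sdPoint = x := by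
  refine (congr_arg ((SSet.yonedaEquiv.symm x).app (op ⦋0⦌)) (?_ :
    (lastVertex ⦋0⦌).app _ sdPoint = SSet.stdSimplex.objEquiv.symm (𝟙 _))).trans
    ((SSet.yonedaEquiv_symm_app_objEquiv_symm x (𝟙 _)).trans
      (ConcreteCategory.congr_hom (K.map_id _) _))
  exact SSet.stdSimplex.objEquiv.injective (Subsingleton.elim (α := ⦋0⦌ ⟶ ⦋0⦌) _ _)

theorem exists_toEx_eq {K : SSet.{u}} (v : (SSet.ex.obj K) _⦋0⦌) :
    ∃ x, (toEx.app K).app _ x = v ∧ x = (ULift.down v).app _ sdPoint := by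
  refine ⟨_, ULift.down_injective (sd_zero_hom_ext (toEx_app_sdPoint _)), rfl⟩

/-- An edge of `Ex K` is a map `sd Δ[1] ⟶ K`, and `sd Δ[1]` is connected. -/
theorem mk_eq_of_mk_toEx {K : SSet.{u}} {x y : K _⦋0⦌}
    (h : SSet.π₀.mk ((toEx.app K).app _ x) = SSet.π₀.mk ((toEx.app K).app _ y)) :
    SSet.π₀.mk x = SSet.π₀.mk y := by
  have key (v w : (SSet.ex.obj K) _⦋0⦌) (hvw : SSet.π₀.mk v = SSet.π₀.mk w) :
      SSet.π₀.mk ((ULift.down v).app _ sdPoint) = SSet.π₀.mk ((ULift.down w).app _ sdPoint) := by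
    rw [SSet.π₀.mk_eq_mk_iff] at hvw
    induction hvw with
    | rel v w h =>
      obtain ⟨e⟩ := h
      obtain ⟨s, rfl, rfl⟩ : ∃ s, (SSet.ex.obj K).δ 1 s = v ∧ (SSet.ex.obj K).δ 0 s = w :=
        ⟨e.edge, e.src_eq, e.tgt_eq⟩
      exact congr_arg (SSet.mapπ₀ (ULift.down s)) (mk_sd_eq
        ((SimplexCategory.sd.map (SimplexCategory.δ 1)).app _ sdPoint)
        ((SimplexCategory.sd.map (SimplexCategory.δ 0)).app _ sdPoint))
    | refl => rfl
    | symm _ _ _ ih => exact ih.symm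
    | trans _ _ _ _ _ ih₁ ih₂ => exact ih₁.trans ih₂
  simpa only [toEx_app_sdPoint] using! key _ _ h

theorem mk_eq_of_mk_toExIter (m : ℕ) {K : SSet.{u}} {x y : K _⦋0⦌}
    (h : SSet.π₀.mk (((toExIter m).app K).app _ x) = SSet.π₀.mk (((toExIter m).app K).app _ y)) :
    SSet.π₀.mk x = SSet.π₀.mk y := by
  induction m with
  | zero =>
    rw [toExIter_zero] at h
    exact h
  | succ m ih =>
    rw [toExIter_succ] at h
    exact ih (mk_eq_of_mk_toEx h)

theorem exists_toExIter_eq (m : ℕ) {K : SSet.{u}} (v : ((exIter m).obj K) _⦋0⦌) :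
    ∃ x, ((toExIter m).app K).app _ x = v := by
  induction m with
  | zero => exact ⟨v, by rw [toExIter_zero]; rfl⟩
  | succ m ih =>
    obtain ⟨w, rfl, -⟩ := exists_toEx_eq (K := (exIter m).obj K) v
    obtain ⟨x, rfl⟩ := ih w
    exact ⟨x, by rw [toExIter_succ]; rfl⟩

/-- The subdivision of a point is a point, so no stage `Ex^m` creates new vertices. -/
theorem exists_exVertex_eq {K : SSet.{u}} (v : (exInfty.obj K) _⦋0⦌) : ∃ x, exVertex x = v := by
  obtain ⟨m, g, hg⟩ := exists_exι (SSet.yonedaEquiv.symm v)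
  obtain ⟨x, hx⟩ := exists_toExIter_eq m (SSet.yonedaEquiv g)
  refine ⟨x, ?_⟩
  rw [exVertex, ← toExIter_exι m]
  refine (congr_arg (((exι m).app K).app _) hx).trans ?_
  rw [← SSet.yonedaEquiv_comp, ← hg, Equiv.apply_symm_apply]

theorem mk_eq_of_exVertex_eq {K : SSet.{u}} {x y : K _⦋0⦌} (h : exVertex x = exVertex y) :
    SSet.π₀.mk x = SSet.π₀.mk y := by
  obtain ⟨n, v, hv⟩ := exists_exι_eq (m := 0) (SSet.yonedaEquiv.symm x) (SSet.yonedaEquiv.symm y)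
    (SSet.yonedaEquiv.injective (by
      rw [SSet.yonedaEquiv_comp, SSet.yonedaEquiv_comp]
      refine (congr_arg (((exι 0).app K).app _) (Equiv.apply_symm_apply _ _)).trans ?_
      exact h.trans (congr_arg (((exι 0).app K).app _) (Equiv.apply_symm_apply _ _)).symm))
  refine mk_eq_of_mk_toExIter n (congr_arg SSet.π₀.mk ?_)
  have := congr_arg SSet.yonedaEquiv hv
  rw [SSet.yonedaEquiv_comp, SSet.yonedaEquiv_comp] at this
  have h' (z : K _⦋0⦌) : SSet.yonedaEquiv (SSet.yonedaEquiv.symm z) = z := Equiv.apply_symm_apply _ _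
  exact (congr_arg (((exMap v).app K).app _) (h' x).symm).trans
    (this.trans (congr_arg (((exMap v).app K).app _) (h' y)))

/-- Hence `Ex^∞` does not change `π₀`: an edge of `Ex^∞ K` lives at a finite stage, its ends come
from vertices of `K`, and these can be compared one `Ex` at a time. -/
theorem mk_exVertex_eq_iff {K : SSet.{u}} {x y : K _⦋0⦌} :
    SSet.π₀.mk (exVertex x) = SSet.π₀.mk (exVertex y) ↔ SSet.π₀.mk x = SSet.π₀.mk y := by
  refine ⟨fun h ↦ ?_, congr_arg (SSet.mapπ₀ (toExInfty.app K))⟩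
  have key (v w : (exInfty.obj K) _⦋0⦌) (hvw : SSet.π₀.mk v = SSet.π₀.mk w) :
      ∀ x y : K _⦋0⦌, exVertex x = v → exVertex y = w → SSet.π₀.mk x = SSet.π₀.mk y := by
    rw [SSet.π₀.mk_eq_mk_iff] at hvw
    induction hvw with
    | rel v w h =>
      intro x y hx hy
      obtain ⟨e⟩ := h
      obtain ⟨m, s, hs⟩ := exists_exι (SSet.yonedaEquiv.symm e.edge)
      have hs' : ((exι m).app K).app _ (SSet.yonedaEquiv s) = e.edge := by
        rw [← SSet.yonedaEquiv_comp, ← hs, Equiv.apply_symm_apply]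
      generalize SSet.yonedaEquiv s = s at hs'
      obtain ⟨x', hx'⟩ := exists_toExIter_eq m (((exIter m).obj K).δ 1 s)
      obtain ⟨y', hy'⟩ := exists_toExIter_eq m (((exIter m).obj K).δ 0 s)
      have h₁ : exVertex x' = v := by
        rw [exVertex, ← toExIter_exι m]
        refine (congr_arg (((exι m).app K).app _) hx').trans ?_
        refine (ConcreteCategory.congr_hom (((exι m).app K).naturality _) s).trans ?_
        exact (congr_arg ((exInfty.obj K).δ 1) hs').trans e.src_eq
      have h₂ : exVertex y' = w := by
        rw [exVertex, ← toExIter_exι m]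
        refine (congr_arg (((exι m).app K).app _) hy').trans ?_
        refine (ConcreteCategory.congr_hom (((exι m).app K).naturality _) s).trans ?_
        exact (congr_arg ((exInfty.obj K).δ 0) hs').trans e.tgt_eq
      rw [mk_eq_of_exVertex_eq (hx.trans h₁.symm), mk_eq_of_exVertex_eq (hy.trans h₂.symm)]
      exact mk_eq_of_mk_toExIter m (SSet.π₀.sound (SSet.Edge.mk s hx'.symm hy'.symm))
    | refl => exact fun x y hx hy ↦ mk_eq_of_exVertex_eq (hx.trans hy.symm)
    | symm _ _ _ ih => exact fun x y hx hy ↦ (ih y x hy hx).symm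
    | trans v w z _ _ ih₁ ih₂ =>
      intro x y hx hy
      obtain ⟨w', hw'⟩ := exists_exVertex_eq w
      exact (ih₁ x w' hx hw').trans (ih₂ w' y hw' hy)
  exact key _ _ h x y rfl rfl

/-! ### Comparison of homotopy sets -/

variable {n : ℕ} {K L : SSet.{u}}

/-- The element of `π_n(K, x)` represented by a simplex. -/
noncomputable def piMk {x : K _⦋0⦌} (ω : Δ[n] ⟶ exInfty.obj K)
    (h : (SSet.boundary.{u} n).ι ≫ ω = SSet.const (exVertex x)) : HomotopyPi n K x :=
  SSet.RelativeMorphism.homotopyClass ⟨ω, h⟩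

theorem exists_piMk_eq {x : K _⦋0⦌} (c : HomotopyPi n K x) : ∃ ω h, piMk ω h = c := by
  obtain ⟨f, rfl⟩ := c.eq_homotopyClass
  exact ⟨f.map, f.comm, rfl⟩

/-- Homotopy classes are a quotient by the relation of homotopy, so equality of classes is the
generated equivalence relation. -/
theorem piMk_eq_piMk_iff {x : K _⦋0⦌} {ω ω' : Δ[n] ⟶ exInfty.obj K}
    {h : (SSet.boundary.{u} n).ι ≫ ω = SSet.const (exVertex x)}
    {h' : (SSet.boundary.{u} n).ι ≫ ω' = SSet.const (exVertex x)} :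
    piMk ω h = piMk ω' h' ↔
      Relation.EqvGen (BoundaryHomotopic (SSet.const (exVertex x))) ω ω' := by
  constructor
  · intro H
    refine Relation.EqvGen.rec (motive := fun f g _ ↦
      Relation.EqvGen (BoundaryHomotopic (SSet.const (exVertex x))) f.map g.map) ?_ ?_ ?_ ?_
      (Quot.eqvGen_exact H)
    · rintro f g ⟨h⟩
      exact .rel _ _ ⟨h.h, h.h₀, h.h₁, h.rel⟩
    · exact fun _ ↦ .refl _
    · exact fun _ _ _ ih ↦ .symm _ _ ih
    · exact fun _ _ _ _ _ ih₁ ih₂ ↦ .trans _ _ _ ih₁ ih₂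
  · intro H
    induction H with
    | rel f g H =>
      obtain ⟨H, h₀, h₁, hh⟩ := H
      exact SSet.RelativeMorphism.Homotopy.eq ⟨H, h₀, h₁, hh⟩
    | refl => rfl
    | symm _ _ _ ih => exact ih.symm
    | trans _ _ _ H₁ _ ih₁ ih₂ =>
      exact (ih₁ (h' := (BoundaryHomotopic.eqvGen_iff H₁).1 h)).trans ih₂

end

end LocalLift

namespace LocalLift

section

/-! ### Local weak equivalences in terms of `Ex^∞` -/

variable {C : Type u} [SmallCategory C] {J : GrothendieckTopology C} {F G : Cᵒᵖ ⥤ SSet.{u}}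
  {p : F ⟶ G}

theorem isConstBoundary_iff {n : ℕ} (hn : n ≠ 0) {K : SSet.{u}}
    {c : (SSet.boundary.{u} n : SSet.{u}) ⟶ exInfty.obj K} :
    IsConstBoundary c ↔ ∃ x : K _⦋0⦌, c = SSet.const (exVertex x) := by
  constructor
  · rintro (h | ⟨e, rfl⟩)
    · exact (hn h).elim
    · obtain ⟨x, rfl⟩ := exists_exVertex_eq e
      exact ⟨x, rfl⟩
  · rintro ⟨x, rfl⟩
    exact Or.inr ⟨_, rfl⟩

theorem const_exVertex_map (K : SSet.{u}) {Z W : SSet.{u}} (x : Z _⦋0⦌) (f : Z ⟶ W) :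
    SSet.const (X := K) (exVertex x) ≫ exInfty.map f = SSet.const (exVertex (f.app _ x)) := by
  rw [SSet.const_comp]
  exact congr_arg SSet.const
    (ConcreteCategory.congr_hom (congr_app (toExInfty_naturality f) _) x)

theorem exVertex_map {Z W : SSet.{u}} (x : Z _⦋0⦌) (f : Z ⟶ W) :
    (exInfty.map f).app _ (exVertex x) = exVertex (f.app _ x) :=
  ConcreteCategory.congr_hom (congr_app (toExInfty_naturality f) _) x

theorem yonedaEquiv_symm_exVertex_map {Z W : SSet.{u}} (x : Z _⦋0⦌) (f : Z ⟶ W) :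
    SSet.yonedaEquiv.symm (exVertex x) ≫ exInfty.map f =
      SSet.yonedaEquiv.symm (exVertex (f.app _ x)) := by
  apply SSet.yonedaEquiv.injective
  rw [SSet.yonedaEquiv_comp, Equiv.apply_symm_apply, Equiv.apply_symm_apply, exVertex_map]

theorem eqvGen_exVertex_iff {K : SSet.{u}} {c : (SSet.boundary.{u} 0 : SSet.{u}) ⟶ exInfty.obj K}
    {x y : K _⦋0⦌} : Relation.EqvGen (BoundaryHomotopic c) (SSet.yonedaEquiv.symm (exVertex x))
      (SSet.yonedaEquiv.symm (exVertex y)) ↔ SSet.π₀.mk x = SSet.π₀.mk y := by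
  rw [eqvGen_boundaryHomotopic_iff, Equiv.apply_symm_apply, Equiv.apply_symm_apply,
    mk_exVertex_eq_iff]

theorem exists_yonedaEquiv_symm_exVertex_eq {K : SSet.{u}} (ω : Δ[0] ⟶ exInfty.obj K) :
    ∃ x, SSet.yonedaEquiv.symm (exVertex x) = ω := by
  obtain ⟨x, hx⟩ := exists_exVertex_eq (SSet.yonedaEquiv ω)
  exact ⟨x, by rw [hx, Equiv.symm_apply_apply]⟩

/-- As `∂Δ[0]` is empty, the boundary condition is vacuous, and homotopy classes of vertices of
`Ex^∞` are the connected components of the original simplicial set. -/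
theorem piLocallyInjective_zero_iff :
    PiLocallyInjective J (Functor.whiskerRight p exInfty) 0 ↔
      Presheaf.IsLocallyInjective J (Functor.whiskerRight p SSet.π₀Functor.{u}) := by
  constructor
  · refine fun H ↦ ⟨fun {X} s t hst ↦ ?_⟩
    obtain ⟨x, rfl⟩ := SSet.π₀.mk_surjective s
    obtain ⟨y, rfl⟩ := SSet.π₀.mk_surjective t
    obtain ⟨R, hR, h⟩ := H X.unop _ (Or.inl rfl) (SSet.yonedaEquiv.symm (exVertex x))
      (SSet.yonedaEquiv.symm (exVertex y)) rfl (boundary_zero_hom_ext _ _) (by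
        dsimp only [Functor.whiskerRight_app]
        rw [yonedaEquiv_symm_exVertex_map, yonedaEquiv_symm_exVertex_map, eqvGen_exVertex_iff]
        exact hst)
    refine J.superset_covering (fun U f hf ↦ ?_) hR
    have := h f hf
    dsimp only [Functor.comp_map] at this
    rw [yonedaEquiv_symm_exVertex_map, yonedaEquiv_symm_exVertex_map, eqvGen_exVertex_iff] at this
    exact this
  · intro H X c _ ω ω' hω hω' h
    obtain ⟨x, rfl⟩ := exists_yonedaEquiv_symm_exVertex_eq ω
    obtain ⟨y, rfl⟩ := exists_yonedaEquiv_symm_exVertex_eq ω'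
    dsimp only [Functor.whiskerRight_app] at h
    rw [yonedaEquiv_symm_exVertex_map, yonedaEquiv_symm_exVertex_map, eqvGen_exVertex_iff] at h
    refine ⟨_, H.equalizerSieve_mem (X := op X) (SSet.π₀.mk x) (SSet.π₀.mk y) h, fun U f hf ↦ ?_⟩
    dsimp only [Functor.comp_map]
    rw [yonedaEquiv_symm_exVertex_map, yonedaEquiv_symm_exVertex_map, eqvGen_exVertex_iff]
    exact hf

theorem piLocallySurjective_zero_iff :
    PiLocallySurjective J (Functor.whiskerRight p exInfty) 0 ↔
      Presheaf.IsLocallySurjective J (Functor.whiskerRight p SSet.π₀Functor.{u}) := by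
  constructor
  · refine fun H ↦ ⟨fun {X} s ↦ ?_⟩
    obtain ⟨y, rfl⟩ := SSet.π₀.mk_surjective s
    obtain ⟨c⟩ : Nonempty ((SSet.boundary.{u} 0 : SSet.{u}) ⟶ exInfty.obj (F.obj (op X))) := by
      rw [SSet.boundary_zero]
      exact ⟨SSet.Subcomplex.isInitialBot.to _⟩
    obtain ⟨R, hR, h⟩ := H X c (Or.inl rfl) (SSet.yonedaEquiv.symm (exVertex y))
      (boundary_zero_hom_ext _ _)
    refine J.superset_covering (fun U f hf ↦ ?_) hR
    obtain ⟨α, -, hα⟩ := h f hf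
    obtain ⟨x, rfl⟩ := exists_yonedaEquiv_symm_exVertex_eq α
    dsimp only [Functor.comp_map, Functor.whiskerRight_app] at hα
    rw [yonedaEquiv_symm_exVertex_map, yonedaEquiv_symm_exVertex_map, eqvGen_exVertex_iff] at hα
    exact ⟨SSet.π₀.mk x, hα⟩
  · intro H X c _ β _
    obtain ⟨y, rfl⟩ := exists_yonedaEquiv_symm_exVertex_eq β
    refine ⟨_, H.imageSieve_mem (SSet.π₀.mk y), fun U f hf ↦ ?_⟩
    obtain ⟨s, hs⟩ := hf
    obtain ⟨x, rfl⟩ := SSet.π₀.mk_surjective s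
    refine ⟨SSet.yonedaEquiv.symm (exVertex x), boundary_zero_hom_ext _ _, ?_⟩
    dsimp only [Functor.comp_map, Functor.whiskerRight_app]
    rw [yonedaEquiv_symm_exVertex_map, yonedaEquiv_symm_exVertex_map, eqvGen_exVertex_iff]
    exact hs

theorem eqvGen_boundaryHomotopic_congr {n : ℕ} {Z : SSet.{u}}
    {c c' : (SSet.boundary.{u} n : SSet.{u}) ⟶ Z} (h : c = c') {f g : Δ[n] ⟶ Z}
    (H : Relation.EqvGen (BoundaryHomotopic c) f g) :
    Relation.EqvGen (BoundaryHomotopic c') f g := h ▸ H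

theorem const_exVertex_vertexRes {X : C} (x : (F.obj (op X)) _⦋0⦌) {K : SSet.{u}} {U V : Over X}
    (f : V ⟶ U) : SSet.const (X := K) (exVertex (vertexRes F x U)) ≫
      (F ⋙ exInfty).map f.left.op = SSet.const (exVertex (vertexRes F x V)) :=
  (const_exVertex_map _ _ _).trans
    (congr_arg (fun z ↦ SSet.const (exVertex z)) (vertexRes_map F x f))

theorem const_exVertex_app_vertexRes {X : C} (x : (F.obj (op X)) _⦋0⦌) {K : SSet.{u}}
    (U : Over X) : SSet.const (X := K) (exVertex (vertexRes F x U)) ≫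
      (Functor.whiskerRight p exInfty).app (op U.left) =
        SSet.const (exVertex (vertexRes G ((p.app (op X)).app _ x) U)) :=
  (const_exVertex_map _ _ _).trans
    (congr_arg (fun z ↦ SSet.const (exVertex z)) (app_vertexRes p x U))

theorem vertexRes_id {X : C} (x : (F.obj (op X)) _⦋0⦌) : vertexRes F x (Over.mk (𝟙 X)) = x :=
  ConcreteCategory.congr_hom (congr_app (F.map_id _) _) x

theorem const_exVertex_vertexRes_id {X : C} (x : (F.obj (op X)) _⦋0⦌) {K : SSet.{u}} :
    SSet.const (X := K) (exVertex x) = SSet.const (exVertex (vertexRes F x (Over.mk (𝟙 X)))) :=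
  congr_arg (fun z ↦ SSet.const (exVertex z)) (vertexRes_id x).symm

/-- Every base point of `Ex^∞ F(X)` comes from a vertex of `F(X)`, and coverings in `C/X` are
coverings in `C`. For the converse the presheaf on `C/X` is evaluated at the identity of `X`. -/
theorem piLocallyInjective_iff {n : ℕ} (hn : n ≠ 0) :
    PiLocallyInjective J (Functor.whiskerRight p exInfty) n ↔
      ∀ (X : C) (x : (F.obj (op X)) _⦋0⦌),
        Presheaf.IsLocallyInjective (J.over X) (piPresheafMap n p x) := by
  constructor
  · refine fun H X x ↦ ⟨fun {U} s t hst ↦ ?_⟩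
    obtain ⟨ω, hω, rfl⟩ := exists_piMk_eq s
    obtain ⟨ω', hω', rfl⟩ := exists_piMk_eq t
    obtain ⟨R, hR, h⟩ := H U.unop.left _ (Or.inr ⟨_, rfl⟩) ω ω' hω hω'
      (eqvGen_boundaryHomotopic_congr (const_exVertex_app_vertexRes x U.unop).symm
        (piMk_eq_piMk_iff.1 hst))
    rw [GrothendieckTopology.mem_over_iff]
    refine J.superset_covering (fun V f hf ↦ ?_) hR
    rw [Sieve.overEquiv_iff]
    exact piMk_eq_piMk_iff.2 (eqvGen_boundaryHomotopic_congr
      (const_exVertex_vertexRes x (Over.homMk f)) (h f hf))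
  · intro H X c hc ω ω' hω hω' h
    obtain ⟨x, rfl⟩ := (isConstBoundary_iff hn).1 hc
    rw [const_exVertex_vertexRes_id] at hω hω' h
    have := (H X x).equalizerSieve_mem (X := op (Over.mk (𝟙 X))) (piMk ω hω) (piMk ω' hω')
      (piMk_eq_piMk_iff.2 (eqvGen_boundaryHomotopic_congr
        (const_exVertex_app_vertexRes x (Over.mk (𝟙 X))) h))
    rw [GrothendieckTopology.mem_over_iff] at this
    refine ⟨_, this, fun V f hf ↦ ?_⟩
    rw [Sieve.overEquiv_iff] at hf
    rw [const_exVertex_vertexRes_id]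
    exact eqvGen_boundaryHomotopic_congr (const_exVertex_vertexRes x (Over.homMk f :
      Over.mk (f ≫ 𝟙 X) ⟶ Over.mk (𝟙 X))).symm (piMk_eq_piMk_iff.1 hf)

theorem piLocallySurjective_iff {n : ℕ} (hn : n ≠ 0) :
    PiLocallySurjective J (Functor.whiskerRight p exInfty) n ↔
      ∀ (X : C) (x : (F.obj (op X)) _⦋0⦌),
        Presheaf.IsLocallySurjective (J.over X) (piPresheafMap n p x) := by
  have key {X : C} (x : (F.obj (op X)) _⦋0⦌) {U V : Over X} (f : V ⟶ U) :
      SSet.const (X := SSet.boundary.{u} n) (exVertex (vertexRes F x U)) ≫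
        (F ⋙ exInfty).map f.left.op ≫ (Functor.whiskerRight p exInfty).app _ =
          SSet.const (exVertex (vertexRes G ((p.app (op X)).app _ x) V)) := by
    rw [← Category.assoc, const_exVertex_vertexRes, const_exVertex_app_vertexRes]
  constructor
  · refine fun H X x ↦ ⟨fun {U} s ↦ ?_⟩
    obtain ⟨ω, hω, rfl⟩ := exists_piMk_eq s
    obtain ⟨R, hR, h⟩ := H U.left _ (Or.inr ⟨exVertex (vertexRes F x U), rfl⟩) ω
      (hω.trans (const_exVertex_app_vertexRes x U).symm)
    rw [GrothendieckTopology.mem_over_iff]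
    refine J.superset_covering (fun V f hf ↦ ?_) hR
    rw [Sieve.overEquiv_iff]
    obtain ⟨α, hα, hα'⟩ := h f hf
    let f' : Over.mk (f ≫ U.hom) ⟶ U := Over.homMk f
    have h₁ := hα.trans (const_exVertex_vertexRes x f')
    have h₂ := eqvGen_boundaryHomotopic_congr (key x f') hα'
    exact ⟨piMk α h₁, piMk_eq_piMk_iff.2 h₂⟩
  · intro H X c hc β hβ
    obtain ⟨x, rfl⟩ := (isConstBoundary_iff hn).1 hc
    rw [const_exVertex_vertexRes_id] at hβ ⊢
    have := (H X x).imageSieve_mem (U := Over.mk (𝟙 X))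
      (piMk β (hβ.trans (const_exVertex_app_vertexRes x (Over.mk (𝟙 X)))))
    rw [GrothendieckTopology.mem_over_iff] at this
    refine ⟨_, this, fun V f hf ↦ ?_⟩
    rw [Sieve.overEquiv_iff] at hf
    obtain ⟨t, ht⟩ := hf
    obtain ⟨α, hα, rfl⟩ := exists_piMk_eq t
    let f' : Over.mk (f ≫ 𝟙 X) ⟶ Over.mk (𝟙 X) := Over.homMk f
    have h₁ := hα.trans (const_exVertex_vertexRes x f').symm
    have h₂ := eqvGen_boundaryHomotopic_congr (key x f').symm (piMk_eq_piMk_iff.1 ht)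
    exact ⟨α, h₁, h₂⟩

/-- A map of presheaves becomes an isomorphism of associated sheaves if and only if it is locally
injective and locally surjective. This removes sheafification from the argument. -/
theorem isLocalWeakEquivalence_iff : IsLocalWeakEquivalence J p ↔ ∀ n,
    PiLocallyInjective J (Functor.whiskerRight p exInfty) n ∧
      PiLocallySurjective J (Functor.whiskerRight p exInfty) n := by
  simp only [IsLocalWeakEquivalence, ← GrothendieckTopology.W_iff,
    GrothendieckTopology.W_iff_isLocallyBijective]
  constructor
  · rintro ⟨⟨h₁, h₂⟩, h⟩ n
    obtain rfl | hn := eq_or_ne n 0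
    · exact ⟨piLocallyInjective_zero_iff.2 h₁, piLocallySurjective_zero_iff.2 h₂⟩
    · have hn' := Nat.one_le_iff_ne_zero.2 hn
      exact ⟨(piLocallyInjective_iff hn).2 fun X x ↦ (h n hn' X x).1,
        (piLocallySurjective_iff hn).2 fun X x ↦ (h n hn' X x).2⟩
  · intro h
    refine ⟨⟨piLocallyInjective_zero_iff.1 (h 0).1, piLocallySurjective_zero_iff.1 (h 0).2⟩,
      fun n hn X x ↦ ?_⟩
    have hn' := Nat.one_le_iff_ne_zero.1 hn
    exact ⟨(piLocallyInjective_iff hn').1 (h n).1 X x, (piLocallySurjective_iff hn').1 (h n).2 X x⟩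

end

end LocalLift

namespace LocalLift

section

/-! ### Local acyclic fibrations -/

open CartesianMonoidalCategory

variable {C : Type u} [SmallCategory C] {J : GrothendieckTopology C} {F G : Cᵒᵖ ⥤ SSet.{u}}
  {p : F ⟶ G}

/-- A map on the boundary of a prism which is constant on the lateral faces. -/
theorem exists_prism_hom {n : ℕ} {Z W : SSet.{u}} {φ : Z ⟶ W}
    {c : (SSet.boundary.{u} n : SSet.{u}) ⟶ Z} {f g : Δ[n] ⟶ Z}
    (hf : (SSet.boundary.{u} n).ι ≫ f = c) (hg : (SSet.boundary.{u} n).ι ≫ g = c)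
    {h : Δ[n] ⊗ Δ[1] ⟶ W} (h₀ : endIncl 0 _ ≫ h = f ≫ φ) (h₁ : endIncl 1 _ ≫ h = g ≫ φ)
    (hh : (SSet.boundary.{u} n).ι ▷ _ ≫ h = fst _ _ ≫ c ≫ φ) :
    ∃ (D : (Δ[n] ⊗ Δ[1] : SSet.{u}).Subcomplex) (w : (D : SSet.{u}) ⟶ Z), w ≫ φ = D.ι ≫ h ∧
      ∀ ⦃V : SSet.{u}⦄ (ψ : Z ⟶ V) (k : Δ[n] ⊗ Δ[1] ⟶ V), D.ι ≫ k = w ≫ ψ →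
        endIncl 0 _ ≫ k = f ≫ ψ ∧ endIncl 1 _ ≫ k = g ≫ ψ ∧
          (SSet.boundary.{u} n).ι ▷ _ ≫ k = fst _ _ ≫ c ≫ ψ := by
  obtain ⟨w, hw₁, hw₂⟩ := exists_unionProd_hom (k := 0) (fst _ _ ≫ c) f
    (by rw [endIncl_fst_assoc, hf])
  -- The first gluing covers the sides and the end `0`; adding the end `1` gives the full boundary
  -- of the prism.
  obtain ⟨w', hw'₁, hw'₂⟩ := exists_glue
    (A := (SSet.boundary.{u} n).unionProd (SSet.horn.{u} 1 0))
    (B := (⊤ : Δ[n].Subcomplex).prod (SSet.horn.{u} 1 1)) rfl w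
    (SSet.Subcomplex.ι _ ≫ fst _ _ ≫ g) (by
      rintro ⟨m⟩ ⟨x, t⟩ hA ⟨-, hB⟩
      induction m using SimplexCategory.rec with | _ m
      obtain rfl := (mem_horn_one_iff _ _).1 hB
      obtain hA' | hA' := (SSet.Subcomplex.mem_unionProd_iff _ _ _).1 hA
      · have := DFunLike.congr_fun ((mem_horn_one_iff _ _).1 hA') 0
        exact (one_ne_zero (α := Fin 2) this).elim
      · refine (ConcreteCategory.congr_hom (congr_app hw₁ _)
          ((⟨x, hA'⟩, _) : (SSet.boundary.{u} n : SSet.{u}) _⦋m⦌ × Δ[1] _⦋m⦌)).trans ?_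
        exact (ConcreteCategory.congr_hom (congr_app hg _) ⟨x, hA'⟩).symm)
  refine ⟨_, w', glue_hom_ext rfl ?_ ?_, ?_⟩
  · rw [reassoc_of% hw'₁, SSet.Subcomplex.homOfLE_ι_assoc]
    apply unionProd_hom_ext
    · rw [reassoc_of% hw₁, SSet.Subcomplex.unionProd.ι₂_ι_assoc, hh]
    · rw [reassoc_of% hw₂, ← Category.assoc (endUnion _ _), endUnion_ι, h₀]
  · rw [reassoc_of% hw'₂, SSet.Subcomplex.homOfLE_ι_assoc]
    ext ⟨m⟩ ⟨⟨x, t⟩, -, ht⟩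
    induction m using SimplexCategory.rec with | _ m
    obtain rfl := (mem_horn_one_iff _ _).1 ht
    exact ConcreteCategory.congr_hom (congr_app h₁.symm _) x
  · intro V ψ k hk
    have h₁ := congr_arg (fun f ↦ SSet.Subcomplex.homOfLE le_sup_left ≫ f) hk
    have h₂ := congr_arg (fun f ↦ SSet.Subcomplex.homOfLE le_sup_right ≫ f) hk
    rw [SSet.Subcomplex.homOfLE_ι_assoc] at h₁ h₂
    rw [reassoc_of% hw'₁] at h₁
    rw [reassoc_of% hw'₂] at h₂
    refine ⟨?_, ?_, ?_⟩
    · rw [← hw₂, Category.assoc, ← h₁, ← Category.assoc, endUnion_ι]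
    · ext ⟨m⟩ x
      induction m using SimplexCategory.rec with | _ m
      exact ConcreteCategory.congr_hom (congr_app h₂ _)
        ⟨(endIncl 1 _).app _ x, Set.mem_univ _, (mem_horn_one_iff _ _).2 rfl⟩
    · rw [← Category.assoc, ← hw₁, Category.assoc, ← h₁, SSet.Subcomplex.unionProd.ι₂_ι_assoc]

variable (hp : ∀ n, LocalRLP J (SSet.boundary.{u} n).ι p)

include hp

theorem LocalRLP.piLocallySurjective (n : ℕ) : PiLocallySurjective J p n := by
  intro X c _ β hβ
  refine ⟨_, hp n X c β hβ.symm, ?_⟩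
  rintro U f ⟨l, h₁, h₂⟩
  exact ⟨l, h₁, h₂ ▸ .refl _⟩

/-- A homotopy downstairs, with both ends and the sides already lifted, is a lifting problem for the
inclusion of the boundary of a prism, which is a monomorphism of finite simplicial sets. -/
theorem exists_cover_boundaryHomotopic {n : ℕ} {X : C}
    {c : (SSet.boundary.{u} n : SSet.{u}) ⟶ F.obj (op X)} {ω ω' : Δ[n] ⟶ F.obj (op X)}
    (hω : (SSet.boundary.{u} n).ι ≫ ω = c) (hω' : (SSet.boundary.{u} n).ι ≫ ω' = c)
    (h : BoundaryHomotopic (c ≫ p.app _) (ω ≫ p.app _) (ω' ≫ p.app _)) :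
    ∃ R ∈ J X, ∀ ⦃U : C⦄ (f : U ⟶ X), R f →
      BoundaryHomotopic (c ≫ F.map f.op) (ω ≫ F.map f.op) (ω' ≫ F.map f.op) := by
  obtain ⟨h, h₀, h₁, hh⟩ := h
  obtain ⟨D, w, hw, hD⟩ := exists_prism_hom hω hω' h₀ h₁ hh
  refine ⟨_, LocalRLP.of_mono hp D.ι X w h hw, ?_⟩
  rintro U f ⟨l, hl, -⟩
  exact ⟨l, hD _ l hl⟩

theorem LocalRLP.piLocallyInjective (n : ℕ) : PiLocallyInjective J p n := by
  -- In a chain of homotopies downstairs the intermediate simplices have no chosen liftings.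
  -- Allowing arbitrary liftings over any `U ⟶ X` makes the statement suitable for induction along
  -- the chain.
  suffices H : ∀ {X : C} (c : (SSet.boundary.{u} n : SSet.{u}) ⟶ F.obj (op X))
      (β β' : Δ[n] ⟶ G.obj (op X)), (SSet.boundary.{u} n).ι ≫ β = c ≫ p.app _ →
      Relation.EqvGen (BoundaryHomotopic (c ≫ p.app _)) β β' →
      ∀ {U : C} (f : U ⟶ X) (ω ω' : Δ[n] ⟶ F.obj (op U)),
        (SSet.boundary.{u} n).ι ≫ ω = c ≫ F.map f.op →
        (SSet.boundary.{u} n).ι ≫ ω' = c ≫ F.map f.op → ω ≫ p.app _ = β ≫ G.map f.op →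
        ω' ≫ p.app _ = β' ≫ G.map f.op → ∃ R ∈ J U, ∀ ⦃V : C⦄ (g : V ⟶ U), R g →
          Relation.EqvGen (BoundaryHomotopic (c ≫ F.map f.op ≫ F.map g.op))
            (ω ≫ F.map g.op) (ω' ≫ F.map g.op) by
    intro X c _ ω ω' hω hω' h
    have := H c _ _ (by rw [reassoc_of% hω]) h (𝟙 X) ω ω' (by simpa) (by simpa) (by simp) (by simp)
    simpa using this
  intro X c β β' hβ h
  induction h with
  | rel β β' h =>
    intro U f ω ω' hω hω' hβ hβ'
    have h := h.map (G.map f.op)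
    rw [← hβ, ← hβ', Category.assoc, ← p.naturality, ← Category.assoc] at h
    obtain ⟨R, hR, h⟩ := exists_cover_boundaryHomotopic hp hω hω' h
    refine ⟨R, hR, fun V g hg ↦ .rel _ _ ?_⟩
    rw [← Category.assoc]
    exact h g hg
  -- Here `ω` and `ω'` are two liftings of one simplex and need not be equal; a homotopy between
  -- them is found locally by lifting the constant one.
  | refl β =>
    intro U f ω ω' hω hω' hβ hβ'
    obtain ⟨R, hR, h⟩ := exists_cover_boundaryHomotopic hp hω hω' (by
      rw [hβ, hβ']
      refine .refl ?_
      rw [← hβ, reassoc_of% hω, Category.assoc])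
    refine ⟨R, hR, fun V g hg ↦ .rel _ _ ?_⟩
    rw [← Category.assoc]
    exact h g hg
  | symm β β' h ih =>
    intro U f ω ω' hω hω' h₁ h₂
    obtain ⟨R, hR, h⟩ := ih ((BoundaryHomotopic.eqvGen_iff h).2 hβ) f ω' ω hω' hω h₂ h₁
    exact ⟨R, hR, fun V g hg ↦ .symm _ _ (h g hg)⟩
  | trans β β'' β' h h' ih₁ ih₂ =>
    intro U f ω ω' hω hω' h₁ h₂
    have hβ'' := (BoundaryHomotopic.eqvGen_iff h).1 hβ
    -- The intermediate simplex `β''` lifts over a covering of `X`, which is pulled back to `U`.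
    -- Both induction hypotheses are applied over its members and the resulting coverings are
    -- composed.
    have hS := J.pullback_stable f (hp n X c β'' hβ''.symm)
    have key : ∀ ⦃V : C⦄ (g : V ⟶ U), ((liftSieve (SSet.boundary.{u} n).ι p c β'').pullback f) g →
        ∃ R ∈ J V, ∀ ⦃W : C⦄ (k : W ⟶ V), R k →
          Relation.EqvGen (BoundaryHomotopic (c ≫ F.map f.op ≫ F.map (k ≫ g).op))
            (ω ≫ F.map (k ≫ g).op) (ω' ≫ F.map (k ≫ g).op) := by
      rintro V g ⟨ω'', hω'', h₃⟩
      obtain ⟨R₁, hR₁, H₁⟩ := ih₁ hβ (g ≫ f) (ω ≫ F.map g.op) ω'' (by simp [reassoc_of% hω]) hω''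
        (by rw [Category.assoc, p.naturality, reassoc_of% h₁, op_comp, G.map_comp]) h₃
      obtain ⟨R₂, hR₂, H₂⟩ := ih₂ hβ'' (g ≫ f) ω'' (ω' ≫ F.map g.op) hω'' (by simp [reassoc_of% hω'])
        h₃ (by rw [Category.assoc, p.naturality, reassoc_of% h₂, op_comp, G.map_comp])
      refine ⟨R₁ ⊓ R₂, J.intersection_covering hR₁ hR₂, fun W k hk ↦ ?_⟩
      have := (H₁ k hk.1).trans _ _ _ (H₂ k hk.2)
      simpa only [op_comp, Functor.map_comp, Category.assoc] using this
    choose R hR H using key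
    refine ⟨Sieve.bind (liftSieve (SSet.boundary.{u} n).ι p c β'' |>.pullback f).arrows R,
      J.bind_covering hS (fun V g hg ↦ hR g hg), ?_⟩
    rintro W _ ⟨V, k, g, hg, hk, rfl⟩
    exact H g hg k hk

end

section

variable {C : Type u} [SmallCategory C] {J : GrothendieckTopology C} {F G : Cᵒᵖ ⥤ SSet.{u}}
  {p : F ⟶ G}

/-- The map `Ex^∞ p` is a local fibration between presheaves of Kan complexes that is locally
bijective on homotopy sets, so it lifts locally against boundaries; these liftings descend to `p`.
-/
theorem IsLocalAcyclicFibration.boundary (hp : IsLocalAcyclicFibration J p) (n : ℕ) :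
    LocalRLP J (SSet.boundary.{u} n).ι p := by
  have hp₁ (n : ℕ) (k : Fin (n + 2)) : LocalRLP J (SSet.horn.{u} (n + 1) k).ι p :=
    (hasLocalLiftings_iff _).1 (hp.1 n k)
  have hp₂ := isLocalWeakEquivalence_iff.1 hp.2
  have (H : Cᵒᵖ ⥤ SSet.{u}) (X : C) : SSet.KanComplex ((H ⋙ exInfty).obj (op X)) :=
    kanComplex_exInfty (H.obj (op X))
  exact LocalRLP.boundary_of_exInfty hp₁ (LocalRLP.boundary_of_pi (LocalRLP.exInfty_horn hp₁)
    (fun n ↦ (hp₂ n).1) (fun n ↦ (hp₂ n).2)) n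

/-- A map is a local acyclic fibration if and only if it has local liftings with respect to
the inclusions `∂Δ[n] ⟶ Δ[n]`. -/
theorem isLocalAcyclicFibration_iff : IsLocalAcyclicFibration J p ↔
    ∀ n, LocalRLP J (SSet.boundary.{u} n).ι p := by
  refine ⟨fun hp ↦ hp.boundary, fun hp ↦ ⟨fun n k ↦ (hasLocalLiftings_iff _).2 (.of_mono hp _),
    isLocalWeakEquivalence_iff.2 fun n ↦ ⟨?_, ?_⟩⟩⟩
  · exact LocalRLP.piLocallyInjective (LocalRLP.exInfty_boundary hp) n
  · exact LocalRLP.piLocallySurjective (LocalRLP.exInfty_boundary hp) n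

end

end LocalLift

namespace LocalLift

noncomputable section

/-! ### The presheaf of liftings -/

/-- The subcomplex `D` is `K × Y ∪ L × A`, with `K` identified with its image in `L`. Maps out of it
are glued from the two pieces, and the final clause makes `s` and `t` jointly epimorphic. -/
theorem exists_pushoutProduct {K L Y Z : SSet.{u}} (i : K ⟶ L) [Mono i] (A : Y.Subcomplex)
    (f : K ⊗ Y ⟶ Z) (g : L ⊗ (A : SSet.{u}) ⟶ Z) (h : i ▷ _ ≫ g = K ◁ A.ι ≫ f) :
    ∃ (D : (L ⊗ Y).Subcomplex) (w : (D : SSet.{u}) ⟶ Z) (s : K ⊗ Y ⟶ D)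
      (t : L ⊗ (A : SSet.{u}) ⟶ D), s ≫ D.ι = i ▷ _ ∧ t ≫ D.ι = L ◁ A.ι ∧ s ≫ w = f ∧ t ≫ w = g ∧
        ∀ ⦃W : SSet.{u}⦄ (f g : (D : SSet.{u}) ⟶ W), s ≫ f = s ≫ g → t ≫ f = t ≫ g → f = g := by
  let S := SSet.Subcomplex.range i
  have hi (d) (k : K.obj d) :
      (inv (SSet.Subcomplex.toRange i)).app d ⟨i.app d k, ⟨k, rfl⟩⟩ = k :=
    ConcreteCategory.congr_hom (congr_app (IsIso.hom_inv_id (SSet.Subcomplex.toRange i)) d) k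
  obtain ⟨w, hw₁, hw₂⟩ := exists_glue (Y := L ⊗ Y) (A := S.prod ⊤) (B := (⊤ : L.Subcomplex).prod A)
    rfl ((S.prodIso ⊤).hom ≫ inv (SSet.Subcomplex.toRange i) ▷ _ ≫
      K ◁ (SSet.Subcomplex.topIso _).hom ≫ f)
    ((SSet.Subcomplex.prodIso ⊤ _).hom ≫ (SSet.Subcomplex.topIso _).hom ▷ _ ≫ g) (by
      rintro d ⟨x, t⟩ ⟨⟨k, hk⟩, -⟩ ⟨-, ht⟩
      obtain rfl : _ = x := hk
      refine (congr_arg (fun z ↦ f.app d (z, t)) (hi d k)).trans ?_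
      exact (ConcreteCategory.congr_hom (congr_app h d) ((k, ⟨t, ht⟩) : K.obj d × A.obj d)).symm)
  refine ⟨_, w, SSet.Subcomplex.lift (i ▷ _) ?_, SSet.Subcomplex.lift (L ◁ A.ι) ?_, rfl, rfl,
    ?_, ?_, ?_⟩
  · rintro d _ ⟨⟨k, y⟩, rfl⟩
    exact Or.inl ⟨⟨k, rfl⟩, Set.mem_univ _⟩
  · rintro d _ ⟨⟨l, y⟩, rfl⟩
    exact Or.inr ⟨Set.mem_univ _, y.2⟩
  · ext d ⟨k, y⟩
    refine (ConcreteCategory.congr_hom (congr_app hw₁ d)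
      ⟨((i.app d k, y) : L.obj d × Y.obj d), ⟨k, rfl⟩, Set.mem_univ _⟩).trans ?_
    exact congr_arg (fun z ↦ f.app d (z, y)) (hi d k)
  · ext d ⟨l, y⟩
    exact ConcreteCategory.congr_hom (congr_app hw₂ d) ⟨(l, y.1), Set.mem_univ _, y.2⟩
  · intro W f g h₁ h₂
    ext d ⟨⟨l, y⟩, h⟩
    obtain ⟨⟨k, hk⟩, _⟩ | ⟨-, hy⟩ := h
    · obtain rfl : _ = l := hk
      exact ConcreteCategory.congr_hom (congr_app h₁ d) ((k, y) : K.obj d × Y.obj d)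
    · exact ConcreteCategory.congr_hom (congr_app h₂ d) ((l, ⟨y, hy⟩) : L.obj d × A.obj d)

variable {C : Type u} [SmallCategory C] {J : GrothendieckTopology C} {F G U : Cᵒᵖ ⥤ SSet.{u}}
  {K L : SSet.{u}} (i : K ⟶ L) (p : F ⟶ G) (a : tensor K U ⟶ F) (b : tensor L U ⟶ G)

/-- A simplex of `U(Y)` together with a solution of the lifting problem it defines. -/
@[ext]
structure LiftSimplex (Y : Cᵒᵖ) (n : SimplexCategory) : Type u where
  /-- the simplex of `U(Y)` -/
  base : (U.obj Y).obj (op n)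
  /-- the lifting -/
  lift : L ⊗ SSet.stdSimplex.obj n ⟶ F.obj Y
  left : i ▷ _ ≫ lift = K ◁ SSet.yonedaEquiv.symm base ≫ a.app Y
  right : lift ≫ p.app Y = L ◁ SSet.yonedaEquiv.symm base ≫ b.app Y

theorem yonedaEquiv_symm_map {Z : SSet.{u}} {n m : SimplexCategory} (f : m ⟶ n)
    (z : Z.obj (op n)) : SSet.yonedaEquiv.symm (Z.map f.op z) =
      SSet.stdSimplex.map f ≫ SSet.yonedaEquiv.symm z :=
  (SSet.yonedaEquiv_symm_naturality_left _ _).symm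

/-- The simplicial presheaf of solutions of the lifting problem. -/
def liftPresheaf : Cᵒᵖ ⥤ SSet.{u} where
  obj Y :=
    { obj n := LiftSimplex i p a b Y n.unop
      map {n m} f := ↾fun s ↦
        { base := (U.obj Y).map f s.base
          lift := L ◁ SSet.stdSimplex.map f.unop ≫ s.lift
          left := by
            rw [← whisker_exchange_assoc, s.left, ← whiskerLeft_comp_assoc]
            exact congr_arg (fun g ↦ K ◁ g ≫ a.app Y) (yonedaEquiv_symm_map f.unop s.base).symm
          right := by
            rw [Category.assoc, s.right, ← whiskerLeft_comp_assoc]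
            exact congr_arg (fun g ↦ L ◁ g ≫ b.app Y) (yonedaEquiv_symm_map f.unop s.base).symm }
      map_id n := by
        refine ConcreteCategory.hom_ext _ _ fun s ↦ LiftSimplex.ext ?_ ?_
        · exact ConcreteCategory.congr_hom ((U.obj Y).map_id n) s.base
        · refine (congr_arg (fun g ↦ L ◁ g ≫ s.lift) (SSet.stdSimplex.map_id _)).trans ?_
          exact (congr_arg (· ≫ s.lift) (whiskerLeft_id _ _)).trans (Category.id_comp _)
      map_comp f g := by
        refine ConcreteCategory.hom_ext _ _ fun s ↦ LiftSimplex.ext ?_ ?_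
        · exact ConcreteCategory.congr_hom ((U.obj Y).map_comp f g) s.base
        · refine (congr_arg (fun g ↦ L ◁ g ≫ s.lift) (SSet.stdSimplex.map_comp _ _)).trans ?_
          exact whiskerLeft_comp_assoc _ _ _ _ }
  map {Y Z} f :=
    { app n := ↾fun s ↦
        { base := (U.map f).app _ s.base
          lift := s.lift ≫ F.map f
          left := by
            rw [← Category.assoc, s.left, ← SSet.yonedaEquiv_symm_comp, whiskerLeft_comp_assoc,
              Category.assoc]
            exact congr_arg _ (a.naturality f).symm
          right := by
            rw [Category.assoc, p.naturality, ← Category.assoc, s.right,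
              ← SSet.yonedaEquiv_symm_comp, whiskerLeft_comp_assoc, Category.assoc]
            exact congr_arg _ (b.naturality f).symm } 
      naturality n m g := by
        refine ConcreteCategory.hom_ext _ _ fun s ↦ LiftSimplex.ext ?_ ?_
        · exact ConcreteCategory.congr_hom ((U.map f).naturality g) s.base
        · exact Category.assoc _ _ _ }
  map_id Y := by
    refine NatTrans.ext (funext fun n ↦ ConcreteCategory.hom_ext _ _ fun s ↦ LiftSimplex.ext ?_ ?_)
    · exact ConcreteCategory.congr_hom (congr_app (U.map_id Y) n) s.base
    · exact (congr_arg (s.lift ≫ ·) (F.map_id Y)).trans (Category.comp_id _)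
  map_comp f g := by
    refine NatTrans.ext (funext fun n ↦ ConcreteCategory.hom_ext _ _ fun s ↦ LiftSimplex.ext ?_ ?_)
    · exact ConcreteCategory.congr_hom (congr_app (U.map_comp f g) n) s.base
    · exact (congr_arg (s.lift ≫ ·) (F.map_comp f g)).trans (Category.assoc _ _ _).symm

/-- The projection to `U`. -/
def liftPresheafπ : liftPresheaf i p a b ⟶ U where
  app Y := { app n := ↾fun s ↦ s.base }

/-- The universal lifting. -/
def liftPresheafEval : tensor L (liftPresheaf i p a b) ⟶ F where
  app Y :=
    { app n := ↾fun (s : L.obj n × LiftSimplex i p a b Y n.unop) ↦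
        s.2.lift.app n (s.1, SSet.stdSimplex.objEquiv.symm (𝟙 _))
      naturality n m f := by
        refine ConcreteCategory.hom_ext _ _ fun ⟨l, s⟩ ↦ ?_
        exact ConcreteCategory.congr_hom (s.lift.naturality f)
          ((l, SSet.stdSimplex.objEquiv.symm (𝟙 _)) :
            L.obj n × (SSet.stdSimplex.obj n.unop).obj n) }

theorem liftPresheafEval_left : tensorMapLeft i _ ≫ liftPresheafEval i p a b =
    tensorMapRight K (liftPresheafπ i p a b) ≫ a := by
  refine NatTrans.ext (funext fun Y ↦ NatTrans.ext (funext fun n ↦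
    ConcreteCategory.hom_ext _ _ fun ⟨k, s⟩ ↦ ?_))
  refine (ConcreteCategory.congr_hom (congr_app s.left n)
    ((k, SSet.stdSimplex.objEquiv.symm (𝟙 _)) :
      K.obj n × (SSet.stdSimplex.obj n.unop).obj n)).trans ?_
  exact congr_arg (fun z ↦ (a.app Y).app n (k, z))
    (ConcreteCategory.congr_hom ((U.obj Y).map_id n) s.base)

theorem liftPresheafEval_right : liftPresheafEval i p a b ≫ p =
    tensorMapRight L (liftPresheafπ i p a b) ≫ b := by
  refine NatTrans.ext (funext fun Y ↦ NatTrans.ext (funext fun n ↦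
    ConcreteCategory.hom_ext _ _ fun ⟨l, s⟩ ↦ ?_))
  refine (ConcreteCategory.congr_hom (congr_app s.right n)
    ((l, SSet.stdSimplex.objEquiv.symm (𝟙 _)) :
      L.obj n × (SSet.stdSimplex.obj n.unop).obj n)).trans ?_
  exact congr_arg (fun z ↦ (b.app Y).app n (l, z))
    (ConcreteCategory.congr_hom ((U.obj Y).map_id n) s.base)

variable {i p a b}

/-- The existence half of the universal property of `liftPresheaf`, extending its definition from
simplices to arbitrary simplicial sets `A`. -/
theorem exists_hom_liftPresheaf {A : SSet.{u}} {Y : Cᵒᵖ} (β : A ⟶ U.obj Y) (l : L ⊗ A ⟶ F.obj Y)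
    (h₁ : i ▷ _ ≫ l = K ◁ β ≫ a.app Y) (h₂ : l ≫ p.app Y = L ◁ β ≫ b.app Y) :
    ∃ w : A ⟶ (liftPresheaf i p a b).obj Y, w ≫ (liftPresheafπ i p a b).app Y = β ∧
      L ◁ w ≫ (liftPresheafEval i p a b).app Y = l := by
  let w : A ⟶ (liftPresheaf i p a b).obj Y :=
    { app n := ↾fun s ↦
        { base := β.app n s
          lift := L ◁ SSet.yonedaEquiv.symm s ≫ l
          left := by
            rw [← whisker_exchange_assoc, h₁, ← whiskerLeft_comp_assoc, SSet.yonedaEquiv_symm_comp]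
          right := by
            rw [Category.assoc, h₂, ← whiskerLeft_comp_assoc, SSet.yonedaEquiv_symm_comp] }
      naturality n m f := by
        refine ConcreteCategory.hom_ext _ _ fun s ↦ LiftSimplex.ext ?_ ?_
        · exact ConcreteCategory.congr_hom (β.naturality f) s
        · refine (congr_arg (fun g ↦ L ◁ g ≫ l) (yonedaEquiv_symm_map f.unop s)).trans ?_
          exact (whiskerLeft_comp_assoc _ _ _ _) }
  refine ⟨w, rfl, NatTrans.ext (funext fun n ↦ ConcreteCategory.hom_ext _ _ fun ⟨x, s⟩ ↦ ?_)⟩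
  exact congr_arg (fun z ↦ l.app n (x, z)) (ConcreteCategory.congr_hom (A.map_id n) s)

theorem liftSimplex_ext {Y : Cᵒᵖ} {n : SimplexCategory} {s t : LiftSimplex i p a b Y n}
    (h₁ : s.base = t.base)
    (h₂ : ∀ (m : SimplexCategory) (f : m ⟶ n) (l : L.obj (op m)),
      s.lift.app (op m) (l, SSet.stdSimplex.objEquiv.symm f) =
        t.lift.app (op m) (l, SSet.stdSimplex.objEquiv.symm f)) : s = t := by
  refine LiftSimplex.ext h₁ (NatTrans.ext (funext fun m ↦
    ConcreteCategory.hom_ext _ _ fun ⟨l, f⟩ ↦ ?_))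
  obtain ⟨f, rfl⟩ := SSet.stdSimplex.objEquiv.symm.surjective f
  exact h₂ m.unop f l

/-- The uniqueness half: by naturality, the evaluation on the restrictions of a simplex recovers the
whole lifting stored in it. -/
theorem liftPresheaf_hom_ext {A : SSet.{u}} {Y : Cᵒᵖ} {w w' : A ⟶ (liftPresheaf i p a b).obj Y}
    (h₁ : w ≫ (liftPresheafπ i p a b).app Y = w' ≫ (liftPresheafπ i p a b).app Y)
    (h₂ : L ◁ w ≫ (liftPresheafEval i p a b).app Y =
      L ◁ w' ≫ (liftPresheafEval i p a b).app Y) : w = w' := by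
  have key (w : A ⟶ (liftPresheaf i p a b).obj Y) {n : SimplexCategoryᵒᵖ} (s : A.obj n)
      {m : SimplexCategory} (f : m ⟶ n.unop) (l : L.obj (op m)) :
      (show LiftSimplex i p a b Y n.unop from w.app n s).lift.app (op m)
          (l, SSet.stdSimplex.objEquiv.symm f) =
        (L ◁ w ≫ (liftPresheafEval i p a b).app Y).app (op m)
          ((l, A.map f.op s) : L.obj (op m) × A.obj (op m)) := by
    refine Eq.trans ?_ (congr_arg
      (fun t : LiftSimplex i p a b Y m ↦ t.lift.app (op m) (l, SSet.stdSimplex.objEquiv.symm (𝟙 _)))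
      (ConcreteCategory.congr_hom (w.naturality f.op) s)).symm
    refine congr_arg (fun z ↦ (show LiftSimplex i p a b Y n.unop from w.app n s).lift.app (op m)
      (l, z)) ?_
    rw [← Category.id_comp f]
    rfl
  refine NatTrans.ext (funext fun n ↦ ConcreteCategory.hom_ext _ _ fun s ↦ liftSimplex_ext
    (ConcreteCategory.congr_hom (congr_app h₁ n) s) fun m f l ↦ ?_)
  refine (key w s f l).trans (Eq.trans ?_ (key w' s f l).symm)
  rw [h₂]

/-- By adjunction, a problem for `∂Δ[n] ⟶ Δ[n]` over `U` is a problem for `K × Δ[n] ∪ L × ∂Δ[n] ⟶ L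
× Δ[n]` over `G`, and the latter inclusion is a monomorphism of finite simplicial sets. -/
theorem LocalRLP.liftPresheafπ [K.Finite] [L.Finite] [Mono i]
    (hp : ∀ n, LocalRLP J (SSet.boundary.{u} n).ι p) (sq : CommSq a (tensorMapLeft i U) p b)
    (n : ℕ) : LocalRLP J (SSet.boundary.{u} n).ι (liftPresheafπ i p a b) := by
  intro X α β hαβ
  have hl := congr_app (liftPresheafEval_left i p a b) (op X)
  have hr := congr_app (liftPresheafEval_right i p a b) (op X)
  have hsq := congr_app sq.w (op X)
  dsimp at hl hr hsq
  obtain ⟨D, w, s, t, hs, ht, hsw, htw, hD⟩ := exists_pushoutProduct i (SSet.boundary.{u} n)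
    (K ◁ β ≫ a.app (op X)) (L ◁ α ≫ (liftPresheafEval i p a b).app (op X)) (by
      rw [← whisker_exchange_assoc, hl, ← whiskerLeft_comp_assoc, hαβ, whiskerLeft_comp_assoc])
  refine J.superset_covering ?_ (LocalRLP.of_mono hp D.ι X w (L ◁ β ≫ b.app (op X)) (hD _ _ ?_ ?_))
  · rintro V f ⟨l, h₁, h₂⟩
    have ha := a.naturality f.op
    have hb := b.naturality f.op
    have he := (liftPresheafEval i p a b).naturality f.op
    have hπ := (LocalLift.liftPresheafπ i p a b).naturality f.op
    dsimp at ha hb he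
    obtain ⟨m, hm₁, hm₂⟩ := exists_hom_liftPresheaf (β ≫ U.map f.op) l
      (i := i) (p := p) (a := a) (b := b) (by
        rw [← hs, Category.assoc, h₁, reassoc_of% hsw, whiskerLeft_comp_assoc, ha])
      (by rw [h₂, Category.assoc, whiskerLeft_comp_assoc, hb])
    refine ⟨m, liftPresheaf_hom_ext ?_ ?_, hm₁⟩
    · rw [Category.assoc, hm₁, Category.assoc, hπ, reassoc_of% hαβ]
    · rw [whiskerLeft_comp_assoc, hm₂, whiskerLeft_comp_assoc, he, ← ht, Category.assoc, h₁,
        reassoc_of% htw]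
  · rw [reassoc_of% hsw, reassoc_of% hs, hsq, whisker_exchange_assoc]
  · rw [reassoc_of% htw, reassoc_of% ht, hr, ← whiskerLeft_comp_assoc, hαβ, whiskerLeft_comp_assoc]

end

end LocalLift

namespace LocalLift

noncomputable section

/-! ### Coproducts of representable presheaves -/

variable {C : Type u} [SmallCategory C]

/-- Coproducts of presheaves are formed objectwise, so bijectivity on sections makes the maps given
by the Yoneda lemma from the `g j` a colimit cocone. -/
theorem IsCoproductOfRepresentables.of_bijective {Q : Cᵒᵖ ⥤ Type u} {ι : Type u} (Y : ι → C)
    (g : ∀ j, Q.obj (op (Y j)))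
    (h : ∀ Z : C, Function.Bijective fun x : Σ j, (Z ⟶ Y j) ↦ Q.map x.2.op (g x.1)) :
    IsCoproductOfRepresentables Q := by
  let e (Z : C) := Equiv.ofBijective _ (h Z)
  have he (Z W : C) (f : W ⟶ Z) (x : Σ j, (Z ⟶ Y j)) : (e W).symm (Q.map f.op (e Z x)) =
      ⟨x.1, f ≫ x.2⟩ := by
    rw [Equiv.symm_apply_eq]
    change Q.map f.op (Q.map x.2.op (g x.1)) = Q.map (f ≫ x.2).op (g x.1)
    rw [op_comp, Q.map_comp]
    rfl
  let c : Limits.Cofan fun j ↦ yoneda.obj (Y j) :=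
    Limits.Cofan.mk Q fun j ↦ yonedaEquiv.symm (g j)
  have hc : Limits.IsColimit c := Limits.Cofan.IsColimit.mk c
    (fun s ↦
      { app Z := ↾fun x ↦ (s.inj ((e Z.unop).symm x).1).app Z ((e Z.unop).symm x).2
        naturality Z W f := by
          ext x
          obtain ⟨x, rfl⟩ := (e Z.unop).surjective x
          change (s.inj ((e W.unop).symm (Q.map f.unop.op (e Z.unop x))).1).app W
            ((e W.unop).symm (Q.map f.unop.op (e Z.unop x))).2 =
              s.pt.map f ((s.inj ((e Z.unop).symm (e Z.unop x)).1).app Z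
                ((e Z.unop).symm (e Z.unop x)).2)
          rw [he, Equiv.symm_apply_apply]
          exact ConcreteCategory.congr_hom ((s.inj x.1).naturality f) x.2 })
    (fun s j ↦ by
      ext Z f
      change (s.inj ((e Z.unop).symm (e Z.unop ⟨j, f⟩)).1).app Z
        ((e Z.unop).symm (e Z.unop ⟨j, f⟩)).2 = _
      rw [Equiv.symm_apply_apply]
      rfl)
    (fun s m hm ↦ by
      ext Z x
      obtain ⟨x, rfl⟩ := (e Z.unop).surjective x
      refine (ConcreteCategory.congr_hom (congr_app (hm x.1) Z) x.2).trans ?_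
      change _ = (s.inj ((e Z.unop).symm (e Z.unop x)).1).app Z ((e Z.unop).symm (e Z.unop x)).2
      rw [Equiv.symm_apply_apply])
  exact ⟨ι, Y, ⟨hc.coconePointUniqueUpToIso (Limits.coproductIsCoproduct _)⟩⟩

/-! ### Sequential colimits and pushouts of sets -/

theorem injective_of_isPushout {X₁ X₂ X₃ X₄ : Type u} {t : X₁ ⟶ X₂} {l : X₁ ⟶ X₃} {r : X₂ ⟶ X₄}
    {b : X₃ ⟶ X₄} (sq : IsPushout t l r b) (hl : Function.Injective l) : Function.Injective r :=
  Limits.Types.pushoutCocone_inr_injective_of_isColimit sq.flip.isColimit hl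

theorem eq_of_isPushout {X₁ X₂ X₃ X₄ : Type u} {t : X₁ ⟶ X₂} {l : X₁ ⟶ X₃} {r : X₂ ⟶ X₄}
    {b : X₃ ⟶ X₄} (sq : IsPushout t l r b) {x y : X₃} (hx : x ∉ Set.range l) (h : b x = b y) :
    x = y := by
  classical
  -- The map collapses the image of `l` to one point and separates everything else, so it descends
  -- to the pushout and detects `x`.
  let φ : X₃ ⟶ Option X₃ := ↾fun z ↦ if z ∈ Set.range l then none else some z
  let ψ : X₂ ⟶ Option X₃ := ↾fun _ ↦ none
  have hφ : t ≫ ψ = l ≫ φ := by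
    refine ConcreteCategory.hom_ext _ _ fun z ↦ ?_
    exact (if_pos (⟨z, rfl⟩ : l z ∈ Set.range l)).symm
  have h' : φ x = φ y := by
    rw [← sq.inr_desc ψ φ hφ]
    exact congr_arg (sq.desc ψ φ hφ) h
  have h₁ : φ x = some x := if_neg hx
  rw [h₁] at h'
  by_cases hy : y ∈ Set.range l
  · have h₂ : φ y = none := if_pos hy
    rw [h₂] at h'
    cases h'
  · have h₂ : φ y = some y := if_neg hy
    rw [h₂] at h'
    exact Option.some_injective _ h'

theorem notMem_range_of_isPushout {X₁ X₂ X₃ X₄ : Type u} {t : X₁ ⟶ X₂} {l : X₁ ⟶ X₃} {r : X₂ ⟶ X₄}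
    {b : X₃ ⟶ X₄} (sq : IsPushout t l r b) (hl : Function.Injective l) {x : X₃}
    (hx : x ∉ Set.range l) : b x ∉ Set.range r := by
  rintro ⟨y, hy⟩
  obtain ⟨s, hs, -⟩ := (Limits.Types.pushoutCocone_inl_eq_inr_iff_of_isColimit
    sq.flip.isColimit hl x y).1 hy.symm
  exact hx ⟨s, hs⟩

section

variable {T : ℕ ⥤ Type u} {c : Limits.Cocone T} (hc : Limits.IsColimit c)
  (hT : ∀ m, Function.Injective (T.map (homOfLE (Nat.le_succ m))))

include hT in
theorem injective_map_of_le {m n : ℕ} (h : m ≤ n) : Function.Injective (T.map (homOfLE h)) := by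
  induction n, h using Nat.le_induction with
  | base =>
    have : T.map (homOfLE (le_refl m)) = 𝟙 _ := T.map_id m
    rw [this]
    exact Function.injective_id
  | succ n h ih =>
    have : T.map (homOfLE (h.trans (Nat.le_succ n))) =
        T.map (homOfLE h) ≫ T.map (homOfLE (Nat.le_succ n)) := T.map_comp _ _
    rw [this]
    exact (hT n).comp ih

include hc hT in
theorem injective_ι_of_isColimit_nat (m : ℕ) : Function.Injective (c.ι.app m) := by
  intro x y h
  obtain ⟨k, f, g, h⟩ := (Limits.Types.FilteredColimit.isColimit_eq_iff T hc).1 h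
  exact injective_map_of_le hT (leOfHom f) h

include hc hT in
/-- The colimit of a sequence of injections is the disjoint union of the complements. -/
theorem bijective_of_isColimit_nat (h₀ : IsEmpty (T.obj 0)) (d : ∀ m, T.obj m ⟶ T.obj (m + 1))
    (hd : ∀ m, T.map (homOfLE (Nat.le_succ m)) = d m) :
    Function.Bijective fun x : Σ m, {x : T.obj (m + 1) // x ∉ Set.range (d m)} ↦
      c.ι.app (x.1 + 1) x.2.1 := by
  obtain rfl := funext hd
  have hι {m n : ℕ} (h : m ≤ n) (x : T.obj m) : c.ι.app n (T.map (homOfLE h) x) = c.ι.app m x :=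
    ConcreteCategory.congr_hom (c.w (homOfLE h)) x
  have hlt {m m' : ℕ} (x : T.obj (m + 1)) (x' : T.obj (m' + 1))
      (hx' : x' ∉ Set.range (T.map (homOfLE (Nat.le_succ m'))))
      (h : c.ι.app (m + 1) x = c.ι.app (m' + 1) x') : ¬ m < m' := by
    intro hm
    refine hx' ⟨T.map (homOfLE (Nat.succ_le_of_lt hm)) x, ?_⟩
    apply injective_ι_of_isColimit_nat hc hT
    exact (hι (Nat.le_succ m') _).trans ((hι (Nat.succ_le_of_lt hm) x).trans h)
  constructor
  · rintro ⟨m, x, hx⟩ ⟨m', x', hx'⟩ h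
    obtain rfl := le_antisymm (not_lt.1 (hlt x' x hx h.symm)) (not_lt.1 (hlt x x' hx' h))
    obtain rfl := injective_ι_of_isColimit_nat hc hT _ h
    rfl
  · intro z
    classical
    have hz : ∃ m, ∃ x, c.ι.app m x = z := by
      obtain ⟨m, x, h⟩ := Limits.Types.jointly_surjective_of_isColimit hc z
      exact ⟨m, x, h⟩
    obtain ⟨x, hx⟩ := Nat.find_spec hz
    have hmin {m : ℕ} (h : m < Nat.find hz) := Nat.find_min hz h
    generalize Nat.find hz = m at x hx hmin
    cases m with
    -- Each element is recorded at the first stage where it appears. This is never stage `0`, which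
    -- is empty.
    | zero => exact h₀.elim x
    | succ m =>
      refine ⟨⟨m, x, ?_⟩, hx⟩
      rintro ⟨y, rfl⟩
      exact hmin (Nat.lt_succ_self m) ⟨y, (hι (Nat.le_succ m) y).symm.trans hx⟩

end

/-! ### Attaching cells -/

variable {ι : Type u} (Z Z' : ι → SSet.{u}) (X : ι → C) {F G : Cᵒᵖ ⥤ SSet.{u}}

/-- The coproduct of the simplicial presheaves `Z i ⊗ X i`. -/
def sumTensor : Cᵒᵖ ⥤ SSet.{u} where
  obj Y :=
    { obj k := Σ i, (Z i).obj k × (Y.unop ⟶ X i)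
      map f := ↾fun s ↦ ⟨s.1, (Z s.1).map f s.2.1, s.2.2⟩ }
  map g := { app k := ↾fun s ↦ ⟨s.1, s.2.1, g.unop ≫ s.2.2⟩ }

variable {Z Z'} in
/-- The map of coproducts induced by a family of maps. -/
def sumTensorMap (φ : ∀ i, Z i ⟶ Z' i) : sumTensor Z X ⟶ sumTensor Z' X where
  app Y :=
    { app k := ↾fun s ↦ ⟨s.1, (φ s.1).app k s.2.1, s.2.2⟩
      naturality k l f := ConcreteCategory.hom_ext _ _ fun s ↦
        congr_arg (fun z ↦ (⟨s.1, z, s.2.2⟩ : Σ i, (Z' i).obj l × (Y.unop ⟶ X i)))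
          (ConcreteCategory.congr_hom ((φ s.1).naturality f) s.2.1) }

variable {Z X} in
/-- The map from the coproduct induced by a family of maps. -/
def sumTensorDesc (a : ∀ i, Z i ⟶ F.obj (op (X i))) : sumTensor Z X ⟶ F where
  app _ :=
    { app k := ↾fun s ↦ (F.map s.2.2.op).app k ((a s.1).app k s.2.1)
      naturality _ l f := ConcreteCategory.hom_ext _ _ fun s ↦
        (congr_arg ((F.map s.2.2.op).app l)
          (ConcreteCategory.congr_hom ((a s.1).naturality f) s.2.1)).trans
            (ConcreteCategory.congr_hom ((F.map s.2.2.op).naturality f) _) }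
  naturality _ _ f := NatTrans.ext (funext fun k ↦ ConcreteCategory.hom_ext _ _ fun s ↦
    ConcreteCategory.congr_hom (congr_app (F.map_comp s.2.2.op f) k) ((a s.1).app k s.2.1))

/-- The inclusion of a summand. -/
def sumTensorι (i : ι) : Z i ⟶ (sumTensor Z X).obj (op (X i)) where
  app k := ↾fun s ↦ ⟨i, s, 𝟙 _⟩

variable {Z X} in
theorem sumTensorι_desc (a : ∀ i, Z i ⟶ F.obj (op (X i))) (i : ι) :
    sumTensorι Z X i ≫ (sumTensorDesc a).app _ = a i :=
  NatTrans.ext (funext fun k ↦ ConcreteCategory.hom_ext _ _ fun s ↦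
    ConcreteCategory.congr_hom (congr_app (F.map_id _) k) ((a i).app k s))

variable {Z Z' X} in
theorem sumTensorDesc_comp (φ : ∀ i, Z i ⟶ Z' i) (a : ∀ i, Z i ⟶ F.obj (op (X i)))
    (b : ∀ i, Z' i ⟶ G.obj (op (X i))) (p : F ⟶ G) (h : ∀ i, a i ≫ p.app _ = φ i ≫ b i) :
    sumTensorDesc a ≫ p = sumTensorMap X φ ≫ sumTensorDesc b :=
  NatTrans.ext (funext fun _ ↦ NatTrans.ext (funext fun k ↦ ConcreteCategory.hom_ext _ _ fun s ↦
    (ConcreteCategory.congr_hom (congr_app (p.naturality s.2.2.op) k) ((a s.1).app k s.2.1)).trans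
      (congr_arg ((G.map s.2.2.op).app k)
        (ConcreteCategory.congr_hom (congr_app (h s.1) k) s.2.1))))

end

end LocalLift

namespace LocalLift

noncomputable section

/-! ### Approximation by cellular simplicial presheaves -/

variable {C : Type u} [SmallCategory C] {V P : Cᵒᵖ ⥤ SSet.{u}}

/-- A commutative square from `∂Δ[n] ⟶ Δ[n]` to `V(X) ⟶ P(X)`. -/
structure Cell (w : V ⟶ P) : Type u where
  /-- the dimension -/
  dim : ℕ
  /-- the object -/
  obj : C
  /-- the boundary -/
  bdry : (SSet.boundary.{u} dim : SSet.{u}) ⟶ V.obj (op obj)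
  /-- the filling -/
  fill : Δ[dim] ⟶ P.obj (op obj)
  comm : bdry ≫ w.app (op obj) = (SSet.boundary dim).ι ≫ fill

/-- The simplicial presheaf obtained by attaching all cells over `P`. -/
def attach (w : V ⟶ P) : Cᵒᵖ ⥤ SSet.{u} :=
  Limits.pushout (sumTensorDesc (F := V) fun c : Cell w ↦ c.bdry)
    (sumTensorMap Cell.obj fun c : Cell w ↦ (SSet.boundary c.dim).ι)

/-- The inclusion into the simplicial presheaf with cells attached. -/
def attachInl (w : V ⟶ P) : V ⟶ attach w := Limits.pushout.inl _ _

/-- The attached cells. -/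
def attachInr (w : V ⟶ P) : sumTensor (fun c : Cell w ↦ Δ[c.dim]) Cell.obj ⟶ attach w :=
  Limits.pushout.inr _ _

theorem isPushout_attach (w : V ⟶ P) :
    IsPushout (sumTensorDesc (F := V) fun c : Cell w ↦ c.bdry)
      (sumTensorMap Cell.obj fun c : Cell w ↦ (SSet.boundary c.dim).ι) (attachInl w)
      (attachInr w) := IsPushout.of_hasPushout _ _

theorem isPushout_attach_app (w : V ⟶ P) (Y : Cᵒᵖ) (k : SimplexCategoryᵒᵖ) :
    IsPushout (((sumTensorDesc (F := V) fun c : Cell w ↦ c.bdry).app Y).app k)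
      (((sumTensorMap Cell.obj fun c : Cell w ↦ (SSet.boundary c.dim).ι).app Y).app k)
      (((attachInl w).app Y).app k) (((attachInr w).app Y).app k) :=
  ((isPushout_attach w).map ((evaluation _ _).obj Y)).map ((evaluation _ _).obj k)

/-- The map to `P` from the simplicial presheaf with cells attached. -/
def attachDesc (w : V ⟶ P) : attach w ⟶ P :=
  (isPushout_attach w).desc w (sumTensorDesc fun c : Cell w ↦ c.fill)
    (sumTensorDesc_comp _ _ _ w fun c ↦ c.comm)

theorem attachInl_desc (w : V ⟶ P) : attachInl w ≫ attachDesc w = w :=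
  (isPushout_attach w).inl_desc _ _ _

theorem attachInr_desc (w : V ⟶ P) :
    attachInr w ≫ attachDesc w = sumTensorDesc fun c : Cell w ↦ c.fill :=
  (isPushout_attach w).inr_desc _ _ _

/-- The simplex of the attached cell `c`. -/
def attachCell (w : V ⟶ P) (c : Cell w) : Δ[c.dim] ⟶ (attach w).obj (op c.obj) :=
  sumTensorι (fun c : Cell w ↦ Δ[c.dim]) Cell.obj c ≫ (attachInr w).app _

theorem boundary_attachCell (w : V ⟶ P) (c : Cell w) :
    (SSet.boundary c.dim).ι ≫ attachCell w c = c.bdry ≫ (attachInl w).app _ := by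
  have h := congr_arg
    (fun g ↦ sumTensorι (fun c : Cell w ↦ (SSet.boundary c.dim : SSet.{u})) Cell.obj c ≫ g)
    (congr_app (isPushout_attach w).w (op c.obj))
  refine Eq.trans ?_ (h.symm.trans ?_)
  · exact (Category.assoc _ _ _).symm
  · refine (Category.assoc _ _ _).symm.trans ?_
    exact congr_arg (fun g ↦ g ≫ (attachInl w).app _)
      (sumTensorι_desc (F := V) (fun c : Cell w ↦ c.bdry) c)

theorem attachCell_desc (w : V ⟶ P) (c : Cell w) :
    attachCell w c ≫ (attachDesc w).app _ = c.fill := by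
  refine (Category.assoc _ _ _).trans ?_
  refine (congr_arg (fun g ↦ sumTensorι (fun c : Cell w ↦ Δ[c.dim]) Cell.obj c ≫ g)
    (congr_app (attachInr_desc w) (op c.obj))).trans ?_
  exact sumTensorι_desc (F := P) (fun c : Cell w ↦ c.fill) c

theorem injective_sumTensorMap_boundary (w : V ⟶ P) (Y : Cᵒᵖ) (k : SimplexCategoryᵒᵖ) :
    Function.Injective
      (((sumTensorMap Cell.obj fun c : Cell w ↦ (SSet.boundary c.dim).ι).app Y).app k) := by
  rintro ⟨c, s, f⟩ ⟨c', s', f'⟩ h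
  obtain rfl : c = c' := congr_arg Sigma.fst h
  have h' := eq_of_heq (Sigma.mk.inj h).2
  obtain rfl : s = s' := Subtype.ext (congr_arg Prod.fst h')
  obtain rfl : f = f' := congr_arg Prod.snd h'
  rfl

theorem mem_range_sumTensorMap_boundary (w : V ⟶ P) (Y : Cᵒᵖ) (k : SimplexCategoryᵒᵖ)
    (c : Cell w) (s : (Δ[c.dim] : SSet.{u}).obj k) (f : Y.unop ⟶ c.obj) :
    (⟨c, s, f⟩ : Σ c : Cell w, (Δ[c.dim] : SSet.{u}).obj k × (Y.unop ⟶ c.obj)) ∈ Set.range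
      (((sumTensorMap Cell.obj fun c : Cell w ↦ (SSet.boundary c.dim).ι).app Y).app k) ↔
        s ∈ (SSet.boundary c.dim).obj k := by
  constructor
  · rintro ⟨⟨c', s', f'⟩, h⟩
    obtain rfl : c' = c := congr_arg Sigma.fst h
    have h' := eq_of_heq (Sigma.mk.inj h).2
    obtain rfl : s'.1 = s := congr_arg Prod.fst h'
    exact s'.2
  · exact fun h ↦ ⟨⟨c, ⟨s, h⟩, f⟩, rfl⟩

theorem injective_attachInl (w : V ⟶ P) (Y : Cᵒᵖ) (k : SimplexCategoryᵒᵖ) :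
    Function.Injective (((attachInl w).app Y).app k) :=
  injective_of_isPushout (isPushout_attach_app w Y k) (injective_sumTensorMap_boundary w Y k)

/-- The simplices of the simplicial presheaf with cells attached that do not come from `V`
correspond to the simplices of `Δ[n]` not in `∂Δ[n]`, for all cells. -/
theorem attachInr_notMem_range (w : V ⟶ P) (Y : Cᵒᵖ) (k : SimplexCategoryᵒᵖ) (c : Cell w)
    {s : (Δ[c.dim] : SSet.{u}).obj k} (hs : s ∉ (SSet.boundary c.dim).obj k)
    (f : Y.unop ⟶ c.obj) :
    ((attachInr w).app Y).app k ⟨c, s, f⟩ ∉ Set.range (((attachInl w).app Y).app k) :=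
  notMem_range_of_isPushout (isPushout_attach_app w Y k) (injective_sumTensorMap_boundary w Y k)
    fun h ↦ hs ((mem_range_sumTensorMap_boundary w Y k c s f).1 h)

theorem exists_of_notMem_range (w : V ⟶ P) (Y : Cᵒᵖ) (k : SimplexCategoryᵒᵖ)
    {x : ((attach w).obj Y).obj k} (hx : x ∉ Set.range (((attachInl w).app Y).app k)) :
    ∃ (c : Cell w) (s : (Δ[c.dim] : SSet.{u}).obj k) (f : Y.unop ⟶ c.obj),
      s ∉ (SSet.boundary c.dim).obj k ∧ ((attachInr w).app Y).app k ⟨c, s, f⟩ = x := by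
  obtain ⟨y, hy⟩ | ⟨⟨c, s, f⟩, hc, hs⟩ := Limits.Types.eq_or_eq_of_isPushout'
    (isPushout_attach_app w Y k) x
  · exact (hx ⟨y, hy⟩).elim
  · exact ⟨c, s, f, fun h ↦ hs ((mem_range_sumTensorMap_boundary w Y k c s f).2 h), hc⟩

variable (P) in
/-- The stages of the small object argument. -/
def stage (m : ℕ) : Over P :=
  -- Starting from the empty presheaf ensures that every simplex of the colimit comes from an
  -- attached cell.
  Nat.rec (Over.mk (Limits.initial.to P)) (fun _ E ↦ Over.mk (attachDesc E.hom)) m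

variable (P) in
/-- The sequence of stages of the small object argument. -/
def stages : ℕ ⥤ Over P :=
  Functor.ofSequence (X := stage P) fun m ↦
    (Over.homMk (attachInl (stage P m).hom) (attachInl_desc _) :
      stage P m ⟶ Over.mk (attachDesc (stage P m).hom))

theorem stages_map_left (m : ℕ) :
    ((stages P).map (homOfLE (Nat.le_succ m))).left = attachInl (stage P m).hom :=
  congr_arg (fun f : stage P m ⟶ stage P (m + 1) ↦ f.left)
    (Functor.ofSequence_map_homOfLE_succ (X := stage P) _ m)

variable (P) in
/-- The colimit of the stages of the small object argument. -/
def stageColimit : Over P := Limits.colimit (stages P)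

variable (P) in
/-- The cocone on the stages after forgetting the maps to `P`. -/
def stageCocone : Limits.Cocone (stages P ⋙ Over.forget P) :=
  (Over.forget P).mapCocone (Limits.colimit.cocone (stages P))

variable (P) in
/-- The colimit of the stages is formed in simplicial presheaves. -/
def isColimitStageCocone : Limits.IsColimit (stageCocone P) :=
  Limits.isColimitOfPreserves (Over.forget P) (Limits.colimit.isColimit (stages P))

variable (P) in
/-- The inclusion of a stage into the colimit. -/
def stageι (m : ℕ) : (stage P m).left ⟶ (stageColimit P).left := (stageCocone P).ι.app m

theorem stageι_hom (m : ℕ) : stageι P m ≫ (stageColimit P).hom = (stage P m).hom :=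
  Over.w (Limits.colimit.ι (stages P) m)

theorem attachInl_stageι (m : ℕ) :
    attachInl (stage P m).hom ≫ stageι P (m + 1) = stageι P m :=
  (congr_arg (fun g ↦ g ≫ stageι P (m + 1)) (stages_map_left m).symm).trans
    ((stageCocone P).w (homOfLE (Nat.le_succ m)))

-- Since `∂Δ[n]` is finite, the boundary of a square factors through some stage `m`; the square is
-- then one of the cells attached at stage `m + 1`. Thus a lifting exists over `X` itself, for any
-- topology, and countably many stages suffice.
variable (P) in
theorem localRLP_stageColimit (J : GrothendieckTopology C) (n : ℕ) :
    LocalRLP J (SSet.boundary.{u} n).ι (stageColimit P).hom := by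
  intro X a b h
  obtain ⟨m, a, rfl⟩ := exists_hom_of_isColimit_nat
    (Limits.isColimitOfPreserves ((evaluation _ _).obj (op X)) (isColimitStageCocone P)) a
  let c : Cell (stage P m).hom :=
    { dim := n, obj := X, bdry := a, fill := b
      comm := by
        refine Eq.trans ?_ h
        refine Eq.trans ?_ (Category.assoc _ _ _).symm
        exact congr_arg (fun g ↦ a ≫ g) (congr_app (stageι_hom m) (op X)).symm }
  refine liftSieve_mem_of_lift (attachCell _ c ≫ (stageι P (m + 1)).app (op X)) ?_ ?_
  · refine (Category.assoc _ _ _).symm.trans ?_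
    refine (congr_arg (fun g ↦ g ≫ (stageι P (m + 1)).app (op X))
      (boundary_attachCell _ c)).trans ?_
    refine (Category.assoc _ _ _).trans ?_
    exact congr_arg (fun g ↦ a ≫ g) (congr_app (attachInl_stageι m) (op X))
  · refine (Category.assoc _ _ _).trans ?_
    refine (congr_arg (fun g ↦ attachCell _ c ≫ g)
      (congr_app (stageι_hom (m + 1)) (op X))).trans ?_
    exact attachCell_desc _ c

variable (P) in
theorem bijective_stageι (Y : Cᵒᵖ) (k : SimplexCategoryᵒᵖ) :
    Function.Bijective fun x : Σ m, {x : ((attach (stage P m).hom).obj Y).obj k //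
      x ∉ Set.range (((attachInl (stage P m).hom).app Y).app k)} ↦
        ((stageι P (x.1 + 1)).app Y).app k x.2.1 := by
  have hm (m : ℕ) : (((stages P ⋙ Over.forget P) ⋙ (evaluation _ _).obj Y) ⋙
      (evaluation _ _).obj k).map (homOfLE (Nat.le_succ m)) =
      ((attachInl (stage P m).hom).app Y).app k :=
    congr_arg (fun g : (stage P m).left ⟶ (stage P (m + 1)).left ↦ (g.app Y).app k)
      (stages_map_left m)
  exact bijective_of_isColimit_nat (Limits.isColimitOfPreserves ((evaluation _ _).obj k)
    (Limits.isColimitOfPreserves ((evaluation _ _).obj Y) (isColimitStageCocone P)))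
    (fun m ↦ by rw [hm]; exact injective_attachInl _ Y k)
    ⟨fun x ↦ PEmpty.elim (((Limits.initial.to ((Functor.const Cᵒᵖ).obj
      ((Functor.const SimplexCategoryᵒᵖ).obj PEmpty.{u + 1} : SSet.{u}))).app Y).app k x)⟩
    (fun m ↦ ((attachInl (stage P m).hom).app Y).app k) hm

-- The simplices of the colimit are the disjoint union of those that are new at each stage. By the
-- pushout description, new `k`-simplices over `Y` correspond uniquely to a cell `c`, a `k`-simplex
-- of its standard simplex outside the boundary, and a map `Y ⟶ c.obj`; for fixed `c` and simplex
-- this is the presheaf represented by `c.obj`.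
variable (P) in
theorem isCoproductOfRepresentables_stageColimit (k : ℕ) :
    IsCoproductOfRepresentables (level (stageColimit P).left k) := by
  refine IsCoproductOfRepresentables.of_bijective
    (ι := Σ (m : ℕ) (c : Cell (stage P m).hom), {s : (Δ[c.dim] : SSet.{u}).obj (op ⦋k⦌) //
      s ∉ (SSet.boundary c.dim).obj (op ⦋k⦌)}) (fun j ↦ j.2.1.obj)
    (fun j ↦ ((stageι P (j.1 + 1)).app _).app _ (((attachInr (stage P j.1).hom).app _).app _
      ⟨j.2.1, j.2.2.1, 𝟙 _⟩)) fun Y ↦ ?_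
  have hB := bijective_stageι P (op Y) (op ⦋k⦌)
  have hg (m : ℕ) (c : Cell (stage P m).hom) (s : (Δ[c.dim] : SSet.{u}).obj (op ⦋k⦌))
      (f : Y ⟶ c.obj) : (level (stageColimit P).left k).map f.op (((stageι P (m + 1)).app _).app _
        (((attachInr (stage P m).hom).app _).app _ ⟨c, s, 𝟙 _⟩)) =
      ((stageι P (m + 1)).app _).app _ (((attachInr (stage P m).hom).app _).app _ ⟨c, s, f⟩) := by
    refine (ConcreteCategory.congr_hom (congr_app ((stageι P (m + 1)).naturality f.op) (op ⦋k⦌))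
      _).symm.trans (congr_arg (((stageι P (m + 1)).app _).app _) ?_)
    refine (ConcreteCategory.congr_hom (congr_app ((attachInr (stage P m).hom).naturality f.op)
      (op ⦋k⦌)) _).symm.trans (congr_arg (((attachInr (stage P m).hom).app _).app _) ?_)
    exact congr_arg (fun f ↦ (⟨c, s, f⟩ : Σ c : Cell (stage P m).hom,
      (Δ[c.dim] : SSet.{u}).obj (op ⦋k⦌) × (Y ⟶ c.obj))) (Category.comp_id f)
  constructor
  · rintro ⟨⟨m, c, s, hs⟩, f⟩ ⟨⟨m', c', s', hs'⟩, f'⟩ h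
    replace h := (hg m c s f).symm.trans (Eq.trans h (hg m' c' s' f'))
    have h := hB.1 (a₁ := ⟨m, _, attachInr_notMem_range _ _ _ c hs f⟩)
      (a₂ := ⟨m', _, attachInr_notMem_range _ _ _ c' hs' f'⟩) h
    obtain rfl : m = m' := congr_arg Sigma.fst h
    have h := congr_arg Subtype.val (eq_of_heq (Sigma.mk.inj h).2)
    cases eq_of_isPushout (isPushout_attach_app _ (op Y) (op ⦋k⦌))
      (fun h ↦ hs ((mem_range_sumTensorMap_boundary _ _ _ c s f).1 h)) h
    rfl
  · intro z
    obtain ⟨⟨m, x, hx⟩, rfl⟩ := hB.2 z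
    have h := exists_of_notMem_range (stage P m).hom (op Y) (op ⦋k⦌) hx
    obtain ⟨c, s, f, hs, h⟩ := h
    refine ⟨⟨⟨m, c, s, hs⟩, f⟩, (hg m c s f).trans ?_⟩
    exact congr_arg (((stageι P (m + 1)).app (op Y)).app (op ⦋k⦌)) h

end

end LocalLift

/-! ### The refined hypercover and the lifting. -/

theorem mainTheorem5 {C : Type u} [SmallCategory C] (J : GrothendieckTopology C)
    {F G : Cᵒᵖ ⥤ SSet.{u}} (p : F ⟶ G) (hp : LocalLift.IsLocalAcyclicFibration J p)
    {K L : SSet.{u}} [K.Finite] [L.Finite] (i : K ⟶ L) [Mono i]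
    {X : C} {U : Cᵒᵖ ⥤ SSet.{u}} (q : U ⟶ LocalLift.rObj X) (hq : LocalLift.IsHypercover J q)
    (a : LocalLift.tensor K U ⟶ F) (b : LocalLift.tensor L U ⟶ G)
    (sq : CommSq a (LocalLift.tensorMapLeft i U) p b) :
    ∃ (V : Cᵒᵖ ⥤ SSet.{u}) (v : V ⟶ U), LocalLift.IsHypercover J (v ≫ q) ∧
      ∃ l : LocalLift.tensor L V ⟶ F,
        LocalLift.tensorMapLeft i V ≫ l = LocalLift.tensorMapRight K v ≫ a ∧
        l ≫ p = LocalLift.tensorMapRight L v ≫ b := by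
  have h (n : ℕ) := LocalLift.LocalRLP.liftPresheafπ hp.boundary sq n
  -- The presheaf `V` is the cellular approximation of the presheaf of liftings, and the lifting is
  -- the tautological one pulled back along `w`.
  let w := (LocalLift.stageColimit (LocalLift.liftPresheaf i p a b)).hom
  refine ⟨_, w ≫ LocalLift.liftPresheafπ i p a b, ⟨?_, ?_⟩,
    LocalLift.tensorMapRight L w ≫ LocalLift.liftPresheafEval i p a b, ?_, ?_⟩
  · exact LocalLift.isCoproductOfRepresentables_stageColimit _
  · exact LocalLift.isLocalAcyclicFibration_iff.2 fun n ↦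
      ((LocalLift.localRLP_stageColimit _ J n).comp_map (h n)).comp_map
        (hq.isLocalAcyclicFibration.boundary n)
  · have h₁ : LocalLift.tensorMapLeft i _ ≫ LocalLift.tensorMapRight L w =
        LocalLift.tensorMapRight K w ≫ LocalLift.tensorMapLeft i _ := rfl
    rw [reassoc_of% h₁, LocalLift.liftPresheafEval_left]
    rfl
  · rw [Category.assoc, LocalLift.liftPresheafEval_right]
    rfl
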